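/- Let $A$ be a nonzero unital $C^*$-algebra and let $n\ge 1$ be an integer. Positive elements $a,b$ of a $C^*$-algebra $B$ are called *equivalent* if $a=x^*x$ and $b=xx^*$ for some $x\in B$. For positive $a\in M_k(A)$ and $b\in M_l(A)$ write $a\precsim b$ if $a$ is a norm limit of elements of the form $x^*bx$ with $x\in M_{l,k}(A)$. Let $W(A)$ be the Cuntz semigroup of $A$, i.e. the set of classes $\langle a\rangle$ of positive elements $a$ of $\bigcup_k M_k(A)$ modulo the relation "$a\precsim b$ and $b\precsim a$", ordered by $\precsim$, with addition $\langle a\rangle+\langle b\rangle=\langle a\oplus b\rangle$. Put $$Z_{n,n+1}=\{f\in C([0,1],M_n(\mathbb C)\otimes M_{n+1}(\mathbb C)) : f(0)\in M_n(\mathbb C)\otimes\mathbb C,\ f(1)\in\mathbb C\otimes M_{n+1}(\mathbb C)\}.$$ Consider the following conditions. (i) There exists $x\in W(A)$ such that $nx\le\langle 1_A\rangle\le(n+1)x$. (ii) There exist $\varepsilon>0$ and mutually equivalent and pairwise orthogonal positive elements $b_1,\dots,b_n\in A$ such that $1_A-(b_1+\cdots+b_n)$ is positive and $1_A-(b_1+\cdots+b_n)\precsim(b_1-\varepsilon)_+$.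 (iii) There are elements $s_1,\dots,s_n\in A$ of norm $1$ and $v\in A$ of norm at most $1$ such that $s_1^*s_1=s_is_i^*$ for all $i$, $\;s_i^*s_i\,s_j^*s_j=0$ for all $i\ne j$, $\;v^*v=1_A-\sum_{k=1}^n s_k^*s_k$, and $vv^*s_1^*s_1=vv^*$. (iv) There is a unital $^*$-homomorphism $Z_{n,n+1}\to A$. If $A$ has stable rank one (that is, the invertible elements of $A$ are dense in $A$), then (i)–(iv) are equivalent. Moreover, stable rank one is needed only for (i) $\Rightarrow$ (ii): the implications (ii) $\Rightarrow$ (iii) $\Rightarrow$ (iv) $\Rightarrow$ (i) hold for every nonzero unital $C^*$-algebra $A$. -/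

import Mathlib

noncomputable section

namespace CStarCuntz

section Subequivalence

variable {A : Type*} [CStarAlgebra A]
variable {k l m : Type*} [Fintype k] [Fintype l] [Fintype m]

/-- Cuntz subequivalence `a ≾ b` of elements of a C⋆-algebra: `a` is a norm limit of elements of the
form `x⋆ b x`. It is only used for positive `a` and `b`. -/
def Subeq {A : Type*} [CStarAlgebra A] (a b : A) : Prop :=
  a ∈ closure (Set.range fun x : A => star x * b * x)

/-- Cuntz subequivalence `a ≾ b` of square matrices, possibly of different sizes, over a C⋆-algebra:
`a` is a norm limit of elements of the form `x⋆ b x`, with `x` a rectangular matrix of the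
appropriate size. It is only used for positive `a` and `b`. -/
def MatSubeq {A : Type*} [CStarAlgebra A] {k l : Type*} [Fintype k] [Fintype l]
    (a : CStarMatrix k k A) (b : CStarMatrix l l A) : Prop :=
  a ∈ closure (Set.range fun x : CStarMatrix l k A => x.conjTranspose * b * x)

/-- The block diagonal sum `a ⊕ b` of two square matrices. -/
def oplus {A : Type*} [CStarAlgebra A] {p q : ℕ} (a : CStarMatrix (Fin p) (Fin p) A)
    (b : CStarMatrix (Fin q) (Fin q) A) : CStarMatrix (Fin (p + q)) (Fin (p + q)) A :=
  CStarMatrix.ofMatrix (Matrix.reindex finSumFinEquiv finSumFinEquiv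
    (Matrix.fromBlocks (CStarMatrix.ofMatrix.symm a) 0 0 (CStarMatrix.ofMatrix.symm b)))

theorem nonneg_iff_exists_star_mul_self {B : Type*} [CStarAlgebra B] [PartialOrder B]
    [StarOrderedRing B] {a : B} : 0 ≤ a ↔ ∃ b, a = star b * b :=
  CStarAlgebra.nonneg_iff_eq_star_mul_self

theorem continuous_conj {A : Type*} [CStarAlgebra A] {k l : Type*} [Fintype l] (x : Matrix l k A) :
    Continuous fun b : Matrix l l A => x.conjTranspose * b * x := by
  fun_prop

theorem MatSubeq.of_eq {a : CStarMatrix k k A} {b : CStarMatrix l l A} (x : CStarMatrix l k A)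
    (h : a = x.conjTranspose * b * x) : MatSubeq a b :=
  subset_closure ⟨x, h.symm⟩

theorem MatSubeq.trans {a : CStarMatrix k k A} {b : CStarMatrix l l A} {c : CStarMatrix m m A}
    (hab : MatSubeq a b) (hbc : MatSubeq b c) : MatSubeq a c := by
  refine closure_minimal ?_ isClosed_closure hab
  rintro _ ⟨x, rfl⟩
  refine map_mem_closure (f := fun b : CStarMatrix l l A => x.conjTranspose * b * x)
    (continuous_conj (A := A) x) hbc ?_
  rintro _ ⟨y, rfl⟩
  refine ⟨y * x, ?_⟩
  change Matrix.conjTranspose (Matrix.of y * Matrix.of x) * Matrix.of c *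
      (Matrix.of y * Matrix.of x) =
    Matrix.conjTranspose (Matrix.of x) *
      (Matrix.conjTranspose (Matrix.of y) * Matrix.of c * Matrix.of y) * Matrix.of x
  simp only [Matrix.conjTranspose_mul, Matrix.mul_assoc]

theorem MatSubeq.submatrix [DecidableEq l] (b : Matrix l l A) (e : k ≃ l) :
    MatSubeq (CStarMatrix.ofMatrix (b.submatrix e e)) (CStarMatrix.ofMatrix b) := by
  refine MatSubeq.of_eq (CStarMatrix.ofMatrix ((1 : Matrix l l A).submatrix id e)) ?_
  change b.submatrix e e = Matrix.conjTranspose ((1 : Matrix l l A).submatrix id e) * b *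
    (1 : Matrix l l A).submatrix id e
  rw [Matrix.conjTranspose_submatrix, Matrix.conjTranspose_one]
  have h1 : (1 : Matrix l l A).submatrix e id * b = b.submatrix e id := by
    have := Matrix.submatrix_mul_equiv (1 : Matrix l l A) b e (Equiv.refl l) id
    simpa using this
  have h2 : b.submatrix e id * (1 : Matrix l l A).submatrix id e = b.submatrix e e := by
    have := Matrix.submatrix_mul_equiv b (1 : Matrix l l A) e (Equiv.refl l) e
    simpa using this
  rw [h1, h2]

theorem MatSubeq.submatrix' [DecidableEq k] (b : Matrix l l A) (e : k ≃ l) :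
    MatSubeq (CStarMatrix.ofMatrix b) (CStarMatrix.ofMatrix (b.submatrix e e)) := by
  have := MatSubeq.submatrix (b.submatrix e e) e.symm
  simpa using this

theorem MatSubeq.refl [DecidableEq k] (a : CStarMatrix k k A) : MatSubeq a a :=
  MatSubeq.submatrix (CStarMatrix.ofMatrix.symm a) (Equiv.refl k)

theorem MatSubeq.oplus {p q p' q' : ℕ} {a : CStarMatrix (Fin p) (Fin p) A}
    {b : CStarMatrix (Fin q) (Fin q) A} {a' : CStarMatrix (Fin p') (Fin p') A}
    {b' : CStarMatrix (Fin q') (Fin q') A} (ha : MatSubeq a a') (hb : MatSubeq b b') :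
    MatSubeq (oplus a b) (oplus a' b') := by
  have hc : Continuous fun z : Matrix (Fin p) (Fin p) A × Matrix (Fin q) (Fin q) A =>
      Matrix.reindex finSumFinEquiv finSumFinEquiv (Matrix.fromBlocks z.1 0 0 z.2) :=
    (Continuous.matrix_fromBlocks continuous_fst continuous_const continuous_const
      continuous_snd).matrix_reindex _ _
  refine map_mem_closure₂ (f := fun a b => CStarCuntz.oplus a b) hc ha hb ?_
  rintro _ ⟨x, rfl⟩ _ ⟨y, rfl⟩
  refine ⟨CStarMatrix.ofMatrix (Matrix.reindex finSumFinEquiv finSumFinEquiv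
    (Matrix.fromBlocks (CStarMatrix.ofMatrix.symm x) 0 0 (CStarMatrix.ofMatrix.symm y))), ?_⟩
  change Matrix.conjTranspose (Matrix.reindex finSumFinEquiv finSumFinEquiv
      (Matrix.fromBlocks (Matrix.of x) 0 0 (Matrix.of y))) *
      (Matrix.reindex finSumFinEquiv finSumFinEquiv
        (Matrix.fromBlocks (Matrix.of a') 0 0 (Matrix.of b'))) *
      (Matrix.reindex finSumFinEquiv finSumFinEquiv
        (Matrix.fromBlocks (Matrix.of x) 0 0 (Matrix.of y))) =
    Matrix.reindex finSumFinEquiv finSumFinEquiv (Matrix.fromBlocks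
      (Matrix.conjTranspose (Matrix.of x) * Matrix.of a' * Matrix.of x) 0 0
      (Matrix.conjTranspose (Matrix.of y) * Matrix.of b' * Matrix.of y))
  simp [Matrix.reindex_apply, Matrix.conjTranspose_submatrix, Matrix.fromBlocks_conjTranspose,
    Matrix.fromBlocks_multiply, Matrix.submatrix_mul_equiv]

theorem oplus_nonneg [PartialOrder A] [StarOrderedRing A] {p q : ℕ} {a : CStarMatrix (Fin p) (Fin p) A}
    {b : CStarMatrix (Fin q) (Fin q) A} (ha : 0 ≤ a) (hb : 0 ≤ b) : 0 ≤ oplus a b := by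
  obtain ⟨x, rfl⟩ := nonneg_iff_exists_star_mul_self.1 ha
  obtain ⟨y, rfl⟩ := nonneg_iff_exists_star_mul_self.1 hb
  refine nonneg_iff_exists_star_mul_self.2 ⟨oplus x y, ?_⟩
  change Matrix.reindex finSumFinEquiv finSumFinEquiv (Matrix.fromBlocks
      (Matrix.conjTranspose (Matrix.of x) * Matrix.of x) 0 0
      (Matrix.conjTranspose (Matrix.of y) * Matrix.of y)) =
    Matrix.conjTranspose (Matrix.reindex finSumFinEquiv finSumFinEquiv
      (Matrix.fromBlocks (Matrix.of x) 0 0 (Matrix.of y))) *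
      (Matrix.reindex finSumFinEquiv finSumFinEquiv
        (Matrix.fromBlocks (Matrix.of x) 0 0 (Matrix.of y)))
  simp [Matrix.reindex_apply, Matrix.conjTranspose_submatrix, Matrix.fromBlocks_conjTranspose,
    Matrix.fromBlocks_multiply, Matrix.submatrix_mul_equiv]

end Subequivalence

section Semigroup

/-- The positive elements of `M_∞(A)`, the disjoint union of the matrix algebras `M_k(A)`. (The
trivial algebra `M_0(A)` contributes only a copy of the element `0`.) -/
def PosMat (A : Type*) [CStarAlgebra A] [PartialOrder A] [StarOrderedRing A] : Type _ :=
  Σ k : ℕ, {a : CStarMatrix (Fin k) (Fin k) A // 0 ≤ a}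

variable {A : Type*} [CStarAlgebra A] [PartialOrder A] [StarOrderedRing A]

instance : Preorder (PosMat A) where
  le a b := MatSubeq a.2.1 b.2.1
  le_refl a := MatSubeq.refl a.2.1
  le_trans _ _ _ hab hbc := MatSubeq.trans hab hbc

instance : Add (PosMat A) where
  add a b := ⟨a.1 + b.1, oplus a.2.1 b.2.1, oplus_nonneg a.2.2 b.2.2⟩

instance : Zero (PosMat A) where
  zero := ⟨0, 0, le_rfl⟩

theorem PosMat.add_le_add {a b c d : PosMat A} (h : a ≤ b) (h' : c ≤ d) : a + c ≤ b + d :=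
  MatSubeq.oplus h h'

/-- Two positive matrices that differ by a permutation of the indices are Cuntz equivalent. -/
theorem PosMat.antisymmRel_of_submatrix {a b : PosMat A} (e : Fin a.1 ≃ Fin b.1)
    (h : ∀ i j, a.2.1 i j = b.2.1 (e i) (e j)) : AntisymmRel (· ≤ ·) a b := by
  have h' : a.2.1 = CStarMatrix.ofMatrix
      ((CStarMatrix.ofMatrix.symm b.2.1).submatrix e e) := CStarMatrix.ext h
  constructor
  · change MatSubeq a.2.1 b.2.1
    rw [h']
    exact MatSubeq.submatrix (CStarMatrix.ofMatrix.symm b.2.1) e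
  · change MatSubeq b.2.1 a.2.1
    rw [h']
    exact MatSubeq.submatrix' (CStarMatrix.ofMatrix.symm b.2.1) e

theorem PosMat.add_comm_rel (a b : PosMat A) : AntisymmRel (· ≤ ·) (a + b) (b + a) := by
  refine PosMat.antisymmRel_of_submatrix
    (finSumFinEquiv.symm.trans ((Equiv.sumComm _ _).trans finSumFinEquiv)) fun i j => ?_
  obtain ⟨i, rfl⟩ := finSumFinEquiv.surjective i
  obtain ⟨j, rfl⟩ := finSumFinEquiv.surjective j
  change (Matrix.reindex finSumFinEquiv finSumFinEquiv
      (Matrix.fromBlocks (Matrix.of a.2.1) 0 0 (Matrix.of b.2.1))) _ _ =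
    (Matrix.reindex finSumFinEquiv finSumFinEquiv
      (Matrix.fromBlocks (Matrix.of b.2.1) 0 0 (Matrix.of a.2.1))) _ _
  simp only [Matrix.reindex_apply, Matrix.submatrix_apply, Equiv.trans_apply,
    Equiv.symm_apply_apply]
  rcases i with i | i <;> rcases j with j | j <;> rfl

theorem oplus_assoc_aux {R : Type*} [Zero R] {p q r : ℕ} (a : Matrix (Fin p) (Fin p) R)
    (b : Matrix (Fin q) (Fin q) R) (c : Matrix (Fin r) (Fin r) R) (i j : Fin (p + q + r)) :
    let e : Fin (p + q + r) ≃ Fin (p + (q + r)) :=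
      finSumFinEquiv.symm.trans ((Equiv.sumCongr finSumFinEquiv.symm (Equiv.refl _)).trans
        ((Equiv.sumAssoc _ _ _).trans ((Equiv.sumCongr (Equiv.refl _) finSumFinEquiv).trans
          finSumFinEquiv)))
    (Matrix.reindex finSumFinEquiv finSumFinEquiv
      (Matrix.fromBlocks (Matrix.reindex finSumFinEquiv finSumFinEquiv
        (Matrix.fromBlocks a 0 0 b)) 0 0 c)) i j =
    (Matrix.reindex finSumFinEquiv finSumFinEquiv
      (Matrix.fromBlocks a 0 0 (Matrix.reindex finSumFinEquiv finSumFinEquiv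
        (Matrix.fromBlocks b 0 0 c)))) (e i) (e j) := by
  intro e
  obtain ⟨i, rfl⟩ := finSumFinEquiv.surjective i
  obtain ⟨j, rfl⟩ := finSumFinEquiv.surjective j
  obtain ⟨i, rfl⟩ := (Equiv.sumCongr finSumFinEquiv (Equiv.refl _)).surjective i
  obtain ⟨j, rfl⟩ := (Equiv.sumCongr finSumFinEquiv (Equiv.refl _)).surjective j
  rcases i with (i | i) | i <;> rcases j with (j | j) | j <;> simp [e]

theorem PosMat.add_assoc_rel (a b c : PosMat A) :
    AntisymmRel (· ≤ ·) (a + b + c) (a + (b + c)) := by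
  refine PosMat.antisymmRel_of_submatrix
    (finSumFinEquiv.symm.trans ((Equiv.sumCongr finSumFinEquiv.symm (Equiv.refl _)).trans
      ((Equiv.sumAssoc _ _ _).trans ((Equiv.sumCongr (Equiv.refl _) finSumFinEquiv).trans
        finSumFinEquiv)))) fun i j => ?_
  exact oplus_assoc_aux (CStarMatrix.ofMatrix.symm a.2.1) (CStarMatrix.ofMatrix.symm b.2.1)
    (CStarMatrix.ofMatrix.symm c.2.1) i j

theorem PosMat.zero_add_rel (a : PosMat A) : AntisymmRel (· ≤ ·) (0 + a) a := by
  refine PosMat.antisymmRel_of_submatrix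
    (finSumFinEquiv.symm.trans (Equiv.emptySum (Fin 0) (Fin a.1))) fun i j => ?_
  obtain ⟨i, rfl⟩ := finSumFinEquiv.surjective i
  obtain ⟨j, rfl⟩ := finSumFinEquiv.surjective j
  change (Matrix.reindex finSumFinEquiv finSumFinEquiv
      (Matrix.fromBlocks (0 : Matrix (Fin 0) (Fin 0) A) 0 0 (Matrix.of a.2.1))) _ _ = _
  simp only [Matrix.reindex_apply, Matrix.submatrix_apply, Equiv.trans_apply,
    Equiv.symm_apply_apply]
  rcases i with i | i
  · exact i.elim0
  rcases j with j | j
  · exact j.elim0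
  rfl

variable (A) in
/-- The Cuntz semigroup `W(A)`: the positive elements of `M_∞(A)` modulo the relation
`a ≾ b ∧ b ≾ a`, with the partial order induced by `≾`. -/
def CuntzSemigroup : Type _ := Antisymmetrization (PosMat A) (· ≤ ·)

namespace CuntzSemigroup

instance : PartialOrder (CuntzSemigroup A) :=
  inferInstanceAs (PartialOrder (Antisymmetrization (PosMat A) (· ≤ ·)))

/-- The class `⟨a⟩` in `W(A)` of a positive matrix `a` over `A`. -/
def mk (a : PosMat A) : CuntzSemigroup A := toAntisymmetrization (· ≤ ·) a

theorem mk_le_mk {a b : PosMat A} : mk a ≤ mk b ↔ MatSubeq a.2.1 b.2.1 := Iff.rfl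

theorem mk_eq {a b : PosMat A} (h : AntisymmRel (· ≤ ·) a b) : mk a = mk b := Quotient.sound h

/-- Addition in `W(A)` is induced by the block diagonal sum. -/
instance : Add (CuntzSemigroup A) where
  add := Quotient.map₂ (· + ·) fun _ _ h _ _ h' =>
    ⟨PosMat.add_le_add h.1 h'.1, PosMat.add_le_add h.2 h'.2⟩

instance : Zero (CuntzSemigroup A) where
  zero := mk 0

theorem mk_add_mk (a b : PosMat A) : mk a + mk b = mk (a + b) := rfl

instance : AddCommMonoid (CuntzSemigroup A) where
  add_assoc x y z := by
    induction x using Quotient.ind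
    induction y using Quotient.ind
    induction z using Quotient.ind
    exact mk_eq (PosMat.add_assoc_rel _ _ _)
  zero_add x := by
    induction x using Quotient.ind
    exact mk_eq (PosMat.zero_add_rel _)
  add_zero x := by
    induction x using Quotient.ind
    exact mk_eq ((PosMat.add_comm_rel _ _).trans (PosMat.zero_add_rel _))
  add_comm x y := by
    induction x using Quotient.ind
    induction y using Quotient.ind
    exact mk_eq (PosMat.add_comm_rel _ _)
  nsmul := nsmulRec

instance : IsOrderedAddMonoid (CuntzSemigroup A) where
  add_le_add_left x y h z := by
    induction x using Quotient.ind
    induction y using Quotient.ind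
    induction z using Quotient.ind
    exact PosMat.add_le_add h (le_refl _)

variable (A) in
/-- The class `⟨1_A⟩` in `W(A)` of the unit of `A`, viewed as a one by one matrix. -/
def unitClass : CuntzSemigroup A :=
  mk ⟨1, 1, nonneg_iff_exists_star_mul_self.2 ⟨1, by simp⟩⟩

end CuntzSemigroup

end Semigroup

/-- A unital C⋆-algebra has stable rank one if its invertible elements are dense. -/
def HasStableRankOne (A : Type*) [CStarAlgebra A] : Prop :=
  Dense {a : A | IsUnit a}

/-- Equivalence of positive elements: `a ∼ b` if `a = x⋆ x` and `b = x x⋆` for some `x`. -/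
def Equivalent {A : Type*} [CStarAlgebra A] (a b : A) : Prop :=
  ∃ x : A, a = star x * x ∧ b = x * star x

section DimensionDrop

open scoped ComplexOrder Kronecker

/-- The C⋆-algebra `M_p ⊗ M_q`, realized as the matrices indexed by pairs, the tensor product of
matrices being the Kronecker product. -/
def TensorMat (p q : ℕ) : Type := CStarMatrix (Fin p × Fin q) (Fin p × Fin q) ℂ

instance (p q : ℕ) : CStarAlgebra (TensorMat p q) :=
  inferInstanceAs (CStarAlgebra (CStarMatrix (Fin p × Fin q) (Fin p × Fin q) ℂ))

/-- The elementary tensor `x ⊗ y` in `M_p ⊗ M_q`. -/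
def TensorMat.tmul {p q : ℕ} (x : Matrix (Fin p) (Fin p) ℂ) (y : Matrix (Fin q) (Fin q) ℂ) :
    TensorMat p q :=
  CStarMatrix.ofMatrix (x ⊗ₖ y)

theorem TensorMat.tmul_mul_tmul {p q : ℕ} (x x' : Matrix (Fin p) (Fin p) ℂ)
    (y y' : Matrix (Fin q) (Fin q) ℂ) : tmul x y * tmul x' y' = tmul (x * x') (y * y') :=
  (Matrix.mul_kronecker_mul x x' y y').symm

theorem TensorMat.star_tmul {p q : ℕ} (x : Matrix (Fin p) (Fin p) ℂ)
    (y : Matrix (Fin q) (Fin q) ℂ) : star (tmul x y) = tmul (star x) (star y) :=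
  Matrix.conjTranspose_kronecker x y

theorem TensorMat.one_tmul_one {p q : ℕ} :
    tmul (1 : Matrix (Fin p) (Fin p) ℂ) (1 : Matrix (Fin q) (Fin q) ℂ) = 1 :=
  Matrix.one_kronecker_one

/-- The map `x ↦ x ⊗ 1` from `M_p` to `M_p ⊗ M_q`. -/
def TensorMat.inl (p q : ℕ) : Matrix (Fin p) (Fin p) ℂ →ₗ[ℂ] TensorMat p q where
  toFun x := tmul x 1
  map_add' x y := Matrix.add_kronecker x y 1
  map_smul' c x := Matrix.smul_kronecker c x 1

/-- The map `y ↦ 1 ⊗ y` from `M_q` to `M_p ⊗ M_q`. -/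
def TensorMat.inr (p q : ℕ) : Matrix (Fin q) (Fin q) ℂ →ₗ[ℂ] TensorMat p q where
  toFun y := tmul 1 y
  map_add' x y := Matrix.kronecker_add 1 x y
  map_smul' c x := Matrix.kronecker_smul c 1 x

/-- The dimension-drop C⋆-algebra
`Z_{p,q} = {f ∈ C([0,1], M_p ⊗ M_q) | f(0) ∈ M_p ⊗ ℂ, f(1) ∈ ℂ ⊗ M_q}`, as a ⋆-subalgebra of
`C([0,1], M_p ⊗ M_q)`. -/
def dimensionDrop (p q : ℕ) : StarSubalgebra ℂ C(unitInterval, TensorMat p q) where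
  carrier := {f | (∃ x : Matrix (Fin p) (Fin p) ℂ, TensorMat.tmul x 1 = f 0) ∧
    (∃ y : Matrix (Fin q) (Fin q) ℂ, TensorMat.tmul 1 y = f 1)}
  mul_mem' := by
    rintro f g ⟨⟨x, hx⟩, y, hy⟩ ⟨⟨x', hx'⟩, y', hy'⟩
    refine ⟨⟨x * x', ?_⟩, y * y', ?_⟩
    · rw [ContinuousMap.mul_apply, ← hx, ← hx', TensorMat.tmul_mul_tmul, one_mul]
    · rw [ContinuousMap.mul_apply, ← hy, ← hy', TensorMat.tmul_mul_tmul, one_mul]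
  add_mem' := by
    rintro f g ⟨⟨x, hx⟩, y, hy⟩ ⟨⟨x', hx'⟩, y', hy'⟩
    refine ⟨⟨x + x', ?_⟩, y + y', ?_⟩
    · rw [ContinuousMap.add_apply, ← hx, ← hx']
      exact map_add (TensorMat.inl p q) x x'
    · rw [ContinuousMap.add_apply, ← hy, ← hy']
      exact map_add (TensorMat.inr p q) y y'
  algebraMap_mem' c := by
    refine ⟨⟨c • 1, ?_⟩, c • 1, ?_⟩
    · rw [Algebra.algebraMap_eq_smul_one, ContinuousMap.smul_apply, ContinuousMap.one_apply,
        ← TensorMat.one_tmul_one]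
      exact map_smul (TensorMat.inl p q) c 1
    · rw [Algebra.algebraMap_eq_smul_one, ContinuousMap.smul_apply, ContinuousMap.one_apply,
        ← TensorMat.one_tmul_one]
      exact map_smul (TensorMat.inr p q) c 1
  star_mem' := by
    rintro f ⟨⟨x, hx⟩, y, hy⟩
    refine ⟨⟨star x, ?_⟩, star y, ?_⟩
    · rw [ContinuousMap.star_apply, ← hx, TensorMat.star_tmul, star_one]
    · rw [ContinuousMap.star_apply, ← hy, TensorMat.star_tmul, star_one]

theorem isClosed_dimensionDrop (p q : ℕ) :
    IsClosed (dimensionDrop p q : Set C(unitInterval, TensorMat p q)) := by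
  have hL : IsClosed (LinearMap.range (TensorMat.inl p q) : Set (TensorMat p q)) :=
    Submodule.closed_of_finiteDimensional _
  have hR : IsClosed (LinearMap.range (TensorMat.inr p q) : Set (TensorMat p q)) :=
    Submodule.closed_of_finiteDimensional _
  exact (hL.preimage (continuous_eval_const (0 : unitInterval))).inter
    (hR.preimage (continuous_eval_const (1 : unitInterval)))

/-- The dimension-drop C⋆-algebra `Z_{p,q}` as a type. -/
def DimensionDrop (p q : ℕ) : Type := dimensionDrop p q

instance (p q : ℕ) : CStarAlgebra (DimensionDrop p q) :=
  StarSubalgebra.cstarAlgebra (dimensionDrop p q) (h_closed := isClosed_dimensionDrop p q)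

end DimensionDrop

section Conditions

variable (A : Type*) [CStarAlgebra A] (n : ℕ) [NeZero n]

/-- There is `x ∈ W(A)` with `n x ≤ ⟨1_A⟩ ≤ (n + 1) x`. -/
def AlmostDivisible [PartialOrder A] [StarOrderedRing A] : Prop :=
  ∃ x : CuntzSemigroup A,
    n • x ≤ CuntzSemigroup.unitClass A ∧ CuntzSemigroup.unitClass A ≤ (n + 1) • x

/-- There are `ε > 0` and mutually equivalent and orthogonal positive elements `b_1, …, b_n` of `A`
with `1 - (b_1 + ⋯ + b_n) ≾ (b_1 - ε)_+`. As `≾` is a relation between positive elements, this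
includes that `1 - (b_1 + ⋯ + b_n)` is positive. The elements are indexed from `0`. -/
def HasAlmostPartition [PartialOrder A] [StarOrderedRing A] : Prop :=
  ∃ ε : ℝ, 0 < ε ∧ ∃ b : Fin n → A,
    (∀ i, 0 ≤ b i) ∧
    (∀ i j, Equivalent (b i) (b j)) ∧
    (∀ i j, i ≠ j → b i * b j = 0) ∧
    0 ≤ 1 - ∑ i, b i ∧
    Subeq (1 - ∑ i, b i) ((b 0 - algebraMap ℝ A ε)⁺)

/-- There are `v, s_1, …, s_n ∈ A`, the `s_i` of norm one and `v` of norm at most one, with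
`s_1⋆ s_1 = s_i s_i⋆`, `s_i⋆ s_i ⟂ s_j⋆ s_j` for `i ≠ j`, `v⋆ v = 1 - ∑ s_k⋆ s_k` and
`v v⋆ s_1⋆ s_1 = v v⋆`. The elements `s_i` are indexed from `0`. -/
def HasGenerators : Prop :=
  ∃ (v : A) (s : Fin n → A),
    ‖v‖ ≤ 1 ∧ (∀ i, ‖s i‖ = 1) ∧
    (∀ i, star (s 0) * s 0 = s i * star (s i)) ∧
    (∀ i j, i ≠ j → (star (s i) * s i) * (star (s j) * s j) = 0) ∧
    star v * v = 1 - ∑ k, star (s k) * s k ∧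
    v * star v * (star (s 0) * s 0) = v * star v

/-- There is a unital ⋆-homomorphism `Z_{n,n+1} → A`. -/
def ReceivesDimensionDrop (A : Type*) [CStarAlgebra A] (n : ℕ) : Prop :=
  Nonempty (DimensionDrop n (n + 1) →⋆ₐ[ℂ] A)

end Conditions

end CStarCuntz

end

/-! The four conditions are linked in the cycle (i) ⇒ (ii) ⇒ (iii) ⇒ (iv) ⇒ (i).

(i) ⇒ (ii), `AlmostDivisible.hasAlmostPartition`. Cutting `a` down slightly turns `n⟨a⟩ ≤ ⟨1⟩` into
an exact statement (`exists_orthogonal_rows`): `n` orthogonal rows over `A` share one Gram matrix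
close to `a`. They give orthogonal equivalent elements of `A`, whose functional calculus yields
contractions `P i`. From `⟨1⟩ ≤ (n+1)⟨a⟩` come `X`, `Y` with `X⋆X + Y⋆Y = 1`, where `∑ P i` is a
left unit for `X` and `P 0` is one for `Y`. Put `L = √(1 - ∑ P i)`, so `L X = 0`. Stable rank one
gives a unitary `u` with `u X⋆X u⋆` close to `X X⋆`. Hence `L u X⋆X u⋆ L` is nearly zero, and `1 - ∑
P i = L²` is nearly `L u Y⋆Y u⋆ L`, which is `≾ (P 0 - 1/2)₊`.

(ii) ⇒ (iii), `hasGenerators_of_lt_one`. Replace `b i` by `g (b i)` with `g = 1` on `[ε, ∞)`. The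
defect `1 - ∑ g (b i)` then lives where `∑ b i` is at most `ε`, so there `1 - ∑ b i` is bounded
below. The approximation of `1 - ∑ b i` by some `y⋆ (b 0 - ε)₊ y` therefore dominates a multiple of
the defect, and a Douglas-type factorization (`exists_factorization`) produces `v`.

(iii) ⇒ (iv), `GeneratorRelations.exists_localUnits` and `glue_mul`. No universal property of
`Z_{n,n+1}` is used. The generators yield a positive contraction `T`, acting as the coordinate `t`,
and three systems of matrix units commuting with `T`, weighted by `1 - t`, `t` and `t (1 - t)`.
After a unitary path straightens `Z_{n,n+1}`, the homomorphism is formally `f ↦ f ∘ ramp`, with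
`ramp` constant near both ends. With `r = coord ∘ ramp` it is written as `(1 - r) f(0) + r f(1)`
plus a remainder supported where `t (1 - t)` is invertible, so that every division by a weight makes
sense.

(iv) ⇒ (i), `exists_generatorRelations_dimensionDrop` and `GeneratorRelations.almostDivisible`.
Explicit functions in `Z_{n,n+1}` satisfy the relations of (iii), and relations pass to `A`. With `a
= s_1⋆ s_1` and `b = ∑ s_i⋆ s_i`, the row of the `s_i⋆` shows `n⟨a⟩ ≤ ⟨1⟩`, while `∑ s_i⋆ a s_i + v⋆
a v = 1 - b + b² ≥ 3/4` shows `⟨1⟩ ≤ (n+1)⟨a⟩`. -/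

noncomputable section

namespace CStarCuntz

/-! ### Functional calculus, orthogonality and factorization. -/

section FunctionalCalculus

variable {A : Type*} [CStarAlgebra A]

/-- An element intertwining two self-adjoint elements intertwines their functional calculi. -/
theorem cfc_mul_eq_mul_cfc {b b' y : A} (hb : IsSelfAdjoint b) (hb' : IsSelfAdjoint b')
    (h : b' * y = y * b) {f : ℝ → ℝ} (hf : Continuous f) :
    cfc f b' * y = y * cfc f b := by
  -- Both calculi are pulled back to one compact set, where Stone–Weierstrass reduces the claim to
  -- the coordinate function.
  let K : Set ℝ := spectrum ℝ b' ∪ spectrum ℝ b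
  have hK : IsCompact K := (ContinuousFunctionalCalculus.isCompact_spectrum b').union
    (ContinuousFunctionalCalculus.isCompact_spectrum b)
  have : CompactSpace K := isCompact_iff_compactSpace.1 hK
  let i' : C(spectrum ℝ b', K) := ⟨Set.inclusion Set.subset_union_left, continuous_inclusion _⟩
  let i : C(spectrum ℝ b, K) := ⟨Set.inclusion Set.subset_union_right, continuous_inclusion _⟩
  let L' : C(K, ℝ) →⋆ₐ[ℝ] A := (cfcHom hb').comp (ContinuousMap.compStarAlgHom' ℝ ℝ i')
  let L : C(K, ℝ) →⋆ₐ[ℝ] A := (cfcHom hb).comp (ContinuousMap.compStarAlgHom' ℝ ℝ i)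
  have hL' : Continuous L' := (cfcHom_continuous hb').comp (ContinuousMap.continuous_precomp i')
  have hL : Continuous L := (cfcHom_continuous hb).comp (ContinuousMap.continuous_precomp i)
  have key : ∀ g : C(K, ℝ), L' g * y = y * L g := by
    intro g
    have hid : L' (.restrict K (.id ℝ)) * y = y * L (.restrict K (.id ℝ)) := by
      have h1 : L' (.restrict K (.id ℝ)) = b' := cfcHom_id hb'
      have h2 : L (.restrict K (.id ℝ)) = b := cfcHom_id hb
      rw [h1, h2, h]
    induction g using ContinuousMap.induction_on_of_compact with
    | const r =>
      have : ContinuousMap.const K r = algebraMap ℝ C(K, ℝ) r := rfl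
      rw [this, AlgHomClass.commutes, AlgHomClass.commutes]
      exact Algebra.commutes r y
    | id => exact hid
    | star_id => simpa using hid
    | add f g hf hg => rw [map_add, map_add, add_mul, mul_add, hf, hg]
    | mul f g hf hg => rw [map_mul, map_mul, mul_assoc, hg, ← mul_assoc, hf, mul_assoc]
    | frequently f hf =>
      have hc : IsClosed {g : C(K, ℝ) | L' g * y = y * L g} :=
        isClosed_eq (by fun_prop) (by fun_prop)
      exact hc.mem_of_frequently_of_tendsto hf Filter.tendsto_id
  rw [cfc_apply f b' hb' hf.continuousOn, cfc_apply f b hb hf.continuousOn]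
  exact key ⟨fun x => f x, by fun_prop⟩

/-- A function vanishing at zero, applied to a sum of orthogonal self-adjoint elements. -/
theorem cfc_sum_of_orthogonal {ι : Type*} [Fintype ι] {b : ι → A} (hb : ∀ i, IsSelfAdjoint (b i))
    (horth : ∀ i j, i ≠ j → b i * b j = 0) {k : ℝ → ℝ} (hk : Continuous k) :
    cfc (fun s => k s * s) (∑ i, b i) = ∑ i, cfc (fun s => k s * s) (b i) := by
  classical
  have hB : IsSelfAdjoint (∑ i, b i) := isSelfAdjoint_sum _ fun i _ => hb i
  rw [cfc_mul k (fun s => s) _ hk.continuousOn, cfc_id' ℝ _ hB, Finset.mul_sum]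
  refine Finset.sum_congr rfl fun i _ => ?_
  rw [cfc_mul k (fun s => s) _ hk.continuousOn, cfc_id' ℝ _ (hb i)]
  -- By orthogonality `(∑ b j) * b i = b i * b i`, so `b i` itself intertwines `b i` with the sum.
  rw [cfc_mul_eq_mul_cfc (hb i) hB _ hk]
  · exact ((Commute.refl (b i)).cfc_real k).symm.eq
  · rw [Finset.sum_mul, Finset.sum_eq_single i (fun j _ hj => horth j i hj) (by simp)]

/-- Functions vanishing at zero of orthogonal elements are orthogonal. -/
theorem cfc_mul_cfc_eq_zero {b c : A} (hb : IsSelfAdjoint b) (hc : IsSelfAdjoint c)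
    (h : b * c = 0) {f g : ℝ → ℝ} (hf : Continuous f) (hg : Continuous g) (hf0 : f 0 = 0)
    (hg0 : g 0 = 0) : cfc f b * cfc g c = 0 := by
  have h1 : cfc f b * c = 0 := by
    -- `b c = 0 = c 0` says that `c` intertwines `0` with `b`.
    have := cfc_mul_eq_mul_cfc (b' := b) (b := 0) (y := c) (.zero A) hb (by simp [h]) hf
    rw [this, cfc_apply_zero]
    simp [hf0]
  have h2 : c * cfc f b = 0 := by
    have := congrArg star h1
    simpa [hc.star_eq, (cfc_predicate f b : IsSelfAdjoint _).star_eq] using this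
  have h3 := cfc_mul_eq_mul_cfc (b' := c) (b := 0) (y := cfc f b) (.zero A) hc (by simp [h2]) hg
  rw [cfc_apply_zero] at h3
  have h4 := congrArg star h3
  simpa [hg0, (cfc_predicate f b : IsSelfAdjoint _).star_eq,
    (cfc_predicate g c : IsSelfAdjoint _).star_eq] using h4

theorem mul_eq_zero_of_star_mul_self_mul_eq_zero {w x : A} (h : star w * w * x = 0) :
    w * x = 0 := by
  rw [← CStarRing.star_mul_self_eq_zero_iff, star_mul, mul_assoc, ← mul_assoc (star w), h, mul_zero]

variable [PartialOrder A] [StarOrderedRing A]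

/-- If `p` is positive and `p x = 0` then `√p x = 0`. -/
theorem sqrt_mul_eq_zero {p x : A} (hp : 0 ≤ p) (h : p * x = 0) : CFC.sqrt p * x = 0 := by
  refine mul_eq_zero_of_star_mul_self_mul_eq_zero ?_
  rw [(CFC.sqrt_nonneg p).isSelfAdjoint.star_eq, CFC.sqrt_mul_sqrt_self p hp, h]

/-- The inverse square root of an invertible positive element. -/
theorem exists_conj_eq_one {N : A} (h0 : 0 ≤ N) (hN : IsUnit N) :
    ∃ r : A, IsSelfAdjoint r ∧ r * N * r = 1 :=
  ⟨N ^ (-(1 / 2) : ℝ), CFC.rpow_nonneg.isSelfAdjoint,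
    CFC.conjugate_rpow_neg_one_half N (IsStrictlyPositive.iff_of_unital.2 ⟨h0, hN⟩)⟩

/-- The sum of orthogonal positive contractions is a contraction. -/
theorem one_sub_sum_nonneg {ι : Type*} [Fintype ι] {p : ι → A} (h0 : ∀ i, 0 ≤ p i)
    (h1 : ∀ i, p i ≤ 1) (horth : ∀ i j, i ≠ j → p i * p j = 0) : 0 ≤ 1 - ∑ i, p i := by
  classical
  have hP : IsSelfAdjoint (∑ i, p i) := isSelfAdjoint_sum _ fun i _ => (h0 i).isSelfAdjoint
  have hsq : (∑ i, p i) * ∑ i, p i = ∑ i, p i * p i := by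
    rw [Finset.sum_mul]
    refine Finset.sum_congr rfl fun i _ => ?_
    rw [Finset.mul_sum, Finset.sum_eq_single i (fun j _ hj => horth i j hj.symm) (by simp)]
  have hle : 0 ≤ ∑ i, (p i - p i * p i) := by
    refine Finset.sum_nonneg fun i _ => ?_
    have : p i - p i * p i = p i * (1 - p i) := by noncomm_ring
    rw [this]
    exact Commute.mul_nonneg (h0 i) (sub_nonneg.2 (h1 i)) (by
      simp [Commute, SemiconjBy, mul_sub, sub_mul])
  -- For `P = ∑ p i` this is `1 - P = (1 - P)² + (P - P²)`, and orthogonality splits `P - P²`.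
  have : (1 - ∑ i, p i) = star (1 - ∑ i, p i) * (1 - ∑ i, p i) + ∑ i, (p i - p i * p i) := by
    rw [star_sub, star_one, hP.star_eq, Finset.sum_sub_distrib, ← hsq]
    noncomm_ring
  rw [this]
  exact add_nonneg (star_mul_self_nonneg _) hle

/-- Douglas factorization with values in the closed right ideal generated by `z`. -/
theorem exists_factorization {w z : A} (hw : IsSelfAdjoint w) (h : w * w ≤ star z * z) :
    ∃ v : A, v ∈ closure (Set.range fun x => z * x) ∧ star v * v = w * w := by
  set h' := CFC.sqrt (star z * z) with hh'
  have hpos : 0 ≤ star z * z := star_mul_self_nonneg z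
  have h0 : 0 ≤ h' := CFC.sqrt_nonneg _
  have hsa : IsSelfAdjoint h' := h0.isSelfAdjoint
  have hsq : h' * h' = star z * z := CFC.sqrt_mul_sqrt_self _ hpos
  -- Regularized inverses of `h' = |z|`. The factor is `v = lim z (R n) w`, formally `z |z|⁻¹ w`.
  let R : ℕ → A := fun n => cfc (fun s : ℝ => (|s| + 1 / (n + 1 : ℝ))⁻¹) h'
  have hcont : ∀ n : ℕ, Continuous fun s : ℝ => (|s| + 1 / (n + 1 : ℝ))⁻¹ := fun n =>
    (by fun_prop : Continuous fun s : ℝ => |s| + 1 / (n + 1 : ℝ)).inv₀ fun s => by positivity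
  have hRsa : ∀ n, IsSelfAdjoint (R n) := fun n => cfc_predicate _ _
  have hRh : ∀ n : ℕ, 1 - h' * R n = (1 / (n + 1 : ℝ)) • R n := by
    intro n
    have e1 : h' * R n = cfc (fun s : ℝ => s * (|s| + 1 / (n + 1 : ℝ))⁻¹) h' := by
      rw [cfc_mul (fun s => s) _ h' continuousOn_id (hcont n).continuousOn, cfc_id' ℝ h' hsa]
    have e2 : (1 / (n + 1 : ℝ)) • R n =
        cfc (fun s : ℝ => (1 / (n + 1 : ℝ)) • (|s| + 1 / (n + 1 : ℝ))⁻¹) h' := by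
      rw [cfc_smul _ _ h' (hcont n).continuousOn]
    have hcont' : Continuous fun s : ℝ => s * (|s| + 1 / (n + 1 : ℝ))⁻¹ :=
      continuous_id.mul (hcont n)
    rw [e1, e2, ← cfc_one ℝ h', ← cfc_sub 1 _ h' continuousOn_const hcont'.continuousOn]
    refine cfc_congr fun s hs => ?_
    have hs0 : 0 ≤ s := spectrum_nonneg_of_nonneg h0 hs
    have : |s| + 1 / (n + 1 : ℝ) ≠ 0 := by positivity
    simp only [Pi.one_apply, smul_eq_mul, abs_of_nonneg hs0] at this ⊢
    field_simp
    ring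
  have hcomm : ∀ n, h' * R n = R n * h' := fun n => ((Commute.refl h').cfc_real _).symm.eq
  have hRhn : ∀ n, ‖h' * R n‖ ≤ 1 := by
    intro n
    have e1 : h' * R n = cfc (fun s : ℝ => s * (|s| + 1 / (n + 1 : ℝ))⁻¹) h' := by
      rw [cfc_mul (fun s => s) _ h' continuousOn_id (hcont n).continuousOn, cfc_id' ℝ h' hsa]
    rw [e1]
    refine norm_cfc_le zero_le_one fun s hs => ?_
    have hs0 : 0 ≤ s := spectrum_nonneg_of_nonneg h0 hs
    have hp : 0 < s + 1 / (n + 1 : ℝ) := by positivity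
    rw [abs_of_nonneg hs0, Real.norm_of_nonneg (by positivity), ← div_eq_mul_inv, div_le_one hp]
    linarith [show 0 ≤ 1 / (n + 1 : ℝ) by positivity]
  -- The hypothesis `w² ≤ h'²` bounds `R n * w` uniformly, so `h' * R n * w` differs from `w` by at
  -- most `1 / (n + 1)`.
  have hRw : ∀ n, ‖R n * w‖ ≤ 1 := by
    intro n
    have h1 : R n * w * star (R n * w) ≤ (h' * R n) * (h' * R n) := by
      have := star_left_conjugate_le_conjugate h (R n)
      rw [(hRsa n).star_eq, ← hsq] at this
      rw [star_mul, hw.star_eq, (hRsa n).star_eq]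
      calc _ = R n * (w * w) * R n := by noncomm_ring
        _ ≤ _ := this
        _ = _ := by rw [hcomm n]; simp only [mul_assoc]; rw [hcomm n]
    have h2 := CStarAlgebra.norm_le_norm_of_nonneg_of_le (mul_star_self_nonneg (R n * w)) h1
    rw [CStarRing.norm_self_mul_star] at h2
    have h3 : ‖h' * R n * (h' * R n)‖ ≤ 1 := (norm_mul_le _ _).trans (by
      nlinarith [hRhn n, norm_nonneg (h' * R n)])
    nlinarith [norm_nonneg (R n * w)]
  have hlim : Filter.Tendsto (fun n => h' * (R n * w)) Filter.atTop (nhds w) := by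
    rw [tendsto_iff_norm_sub_tendsto_zero]
    refine squeeze_zero (fun _ => norm_nonneg _) (fun n => ?_)
      (tendsto_one_div_add_atTop_nhds_zero_nat (𝕜 := ℝ))
    have : h' * (R n * w) - w = -((1 / (n + 1 : ℝ)) • (R n * w)) := by
      rw [← smul_mul_assoc, ← hRh n]
      noncomm_ring
    rw [this, norm_neg, norm_smul, Real.norm_of_nonneg (by positivity)]
    exact mul_le_of_le_one_right (by positivity) (hRw n)
  -- Convergence of `h' * (R n * w)` transfers to `z * (R n * w)` through this isometry.
  have hnorm : ∀ x, ‖z * x‖ = ‖h' * x‖ := by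
    intro x
    rw [← sq_eq_sq₀ (norm_nonneg _) (norm_nonneg _), sq, sq, ← CStarRing.norm_star_mul_self,
      ← CStarRing.norm_star_mul_self, star_mul, star_mul, hsa.star_eq]
    congr 1
    rw [mul_assoc, ← mul_assoc (star z), ← hsq]
    noncomm_ring
  have hcau : CauchySeq fun n => z * (R n * w) := by
    have := hlim.cauchySeq
    rw [Metric.cauchySeq_iff] at this ⊢
    intro ε hε
    obtain ⟨N, hN⟩ := this ε hε
    refine ⟨N, fun m hm n hn => ?_⟩
    have := hN m hm n hn
    rwa [dist_eq_norm, ← mul_sub, hnorm, mul_sub, ← dist_eq_norm]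
  obtain ⟨v, hv⟩ := cauchySeq_tendsto_of_complete hcau
  refine ⟨v, mem_closure_of_tendsto hv (.of_forall fun n => ⟨_, rfl⟩), ?_⟩
  have t1 : Filter.Tendsto (fun n => star (z * (R n * w)) * (z * (R n * w))) Filter.atTop
      (nhds (star v * v)) := hv.star.mul hv
  have t2 : Filter.Tendsto (fun n => star (h' * (R n * w)) * (h' * (R n * w))) Filter.atTop
      (nhds (star w * w)) := hlim.star.mul hlim
  rw [hw.star_eq] at t2
  refine tendsto_nhds_unique t1 (t2.congr fun n => ?_)
  simp only [star_mul, hsa.star_eq]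
  calc _ = star w * star (R n) * (h' * h') * (R n * w) := by noncomm_ring
    _ = _ := by rw [hsq]; noncomm_ring

end FunctionalCalculus

/-! ### From almost partitions of the unit to generators: (ii) ⇒ (iii). -/

section PartitionToGenerators

variable {A : Type*} [CStarAlgebra A]

/-- Reweighting an intertwiner by functional calculus. -/
theorem star_mul_cfc_self {b y : A} (κ : ℝ → ℝ) :
    star (y * cfc κ b) * (y * cfc κ b) = cfc κ b * (star y * y) * cfc κ b := by
  rw [star_mul, (cfc_predicate κ b : IsSelfAdjoint _).star_eq]
  noncomm_ring

theorem mul_cfc_self_star {b b' y : A} (hb : IsSelfAdjoint b) (hb' : IsSelfAdjoint b')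
    (h : b' * y = y * b) {κ : ℝ → ℝ} (hκ : Continuous κ) :
    (y * cfc κ b) * star (y * cfc κ b) = cfc (fun s => κ s * κ s) b' * (y * star y) := by
  have e := cfc_mul_eq_mul_cfc hb hb' h hκ
  rw [star_mul, (cfc_predicate κ b : IsSelfAdjoint _).star_eq,
    cfc_mul κ κ b' hκ.continuousOn hκ.continuousOn]
  calc y * cfc κ b * (cfc κ b * star y) = cfc κ b' * (y * cfc κ b) * star y := by
        rw [← mul_assoc, ← e, mul_assoc (cfc κ b') y, e]
    _ = _ := by rw [← e]; noncomm_ring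

theorem posPart_sub_algebraMap {b : A} (hb : IsSelfAdjoint b) (ε : ℝ) :
    (b - algebraMap ℝ A ε)⁺ = cfc (fun s : ℝ => max (s - ε) 0) b := by
  have h1 : b - algebraMap ℝ A ε = cfc (fun s : ℝ => s - ε) b := by
    rw [cfc_sub (fun s => s) (fun _ => ε) b, cfc_id' ℝ b hb, cfc_const ε b hb]
  have h2 : (fun s : ℝ => max (s - ε) 0) = fun s => (fun r : ℝ => r⁺) (s - ε) := by
    ext s; simp [posPart_def]
  rw [h1, CFC.posPart_def, cfcₙ_eq_cfc, h2, cfc_comp' (fun r : ℝ => r⁺) (fun s => s - ε) b]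

theorem continuous_inv_max {ε : ℝ} (hε : 0 < ε) : Continuous fun s : ℝ => (max s ε)⁻¹ :=
  (by fun_prop : Continuous fun s : ℝ => max s ε).inv₀ fun s => (lt_max_of_lt_right hε).ne'

variable [PartialOrder A] [StarOrderedRing A]

theorem hasGenerators_of_lt_one [Nontrivial A] {n : ℕ} [NeZero n] {ε : ℝ} (hε : 0 < ε)
    (hε1 : ε < 1) {b : Fin n → A} (h0 : ∀ i, 0 ≤ b i) (heq : ∀ i j, Equivalent (b i) (b j))
    (horth : ∀ i j, i ≠ j → b i * b j = 0) (hle : 0 ≤ 1 - ∑ i, b i)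
    (hsub : Subeq (1 - ∑ i, b i) ((b 0 - algebraMap ℝ A ε)⁺)) : HasGenerators A n := by
  have hsa : ∀ i, IsSelfAdjoint (b i) := fun i => (h0 i).isSelfAdjoint
  set B := ∑ i, b i with hBdef
  have hB0 : 0 ≤ B := Finset.sum_nonneg fun i _ => h0 i
  have hBsa : IsSelfAdjoint B := hB0.isSelfAdjoint
  have hB1 : B ≤ 1 := sub_nonneg.1 hle
  set e := (b 0 - algebraMap ℝ A ε)⁺ with he
  have he0 : 0 ≤ e := CFC.posPart_nonneg _
  have heC : e = cfc (fun s : ℝ => max (s - ε) 0) (b 0) := posPart_sub_algebraMap (hsa 0) ε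
  have hk := continuous_inv_max hε
  let g : ℝ → ℝ := fun s => (max s ε)⁻¹ * s
  have hg : Continuous g := hk.mul continuous_id
  have hg1 : ∀ s, ε ≤ s → g s = 1 := fun s hs => by
    simp only [g, max_eq_left hs]
    exact inv_mul_cancel₀ (hε.trans_le hs).ne'
  have hgle : ∀ s, g s ≤ 1 := fun s => by
    have : 0 < max s ε := lt_max_of_lt_right hε
    simp only [g]
    rw [inv_mul_le_iff₀ this, mul_one]
    exact le_max_left _ _
  have hg0 : ∀ s, 0 ≤ s → 0 ≤ g s := fun s hs => by
    have : 0 < max s ε := lt_max_of_lt_right hε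
    positivity
  have hG : cfc g B = ∑ i, cfc g (b i) := cfc_sum_of_orthogonal hsa horth hk
  have hspec : ∀ {c : A}, 0 ≤ c → ∀ s ∈ spectrum ℝ c, 0 ≤ s := fun hc s hs =>
    spectrum_nonneg_of_nonneg hc hs
  -- Needed for `‖s i‖ = 1`: `g` must attain `1` on the spectrum of `b 0`. Otherwise `e = 0`, hence
  -- `B = 1`, and `b 0` is a projection of norm below `ε < 1`. Then all the `b i` vanish, against `B
  -- = 1 ≠ 0`.
  have hball : ε ≤ ‖b 0‖ := by
    by_contra! hlt
    have hez : e = 0 := by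
      rw [heC]
      rw [show (0 : A) = cfc (fun _ : ℝ => 0) (b 0) by simp]
      refine cfc_congr fun s hs => ?_
      have : ‖s‖ ≤ ‖b 0‖ := spectrum.norm_le_norm_of_mem hs
      simp only [max_eq_right_iff]
      linarith [le_abs_self s, Real.norm_eq_abs s]
    have hB : B = 1 := by
      have : (1 - B) ∈ closure (Set.range fun x : A => star x * e * x) := hsub
      rw [hez] at this
      simp only [mul_zero, zero_mul, Set.range_const, closure_singleton,
        Set.mem_singleton_iff] at this
      exact (sub_eq_zero.1 this).symm
    have hb2 : b 0 = star (b 0) * b 0 := by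
      rw [(hsa 0).star_eq]
      calc b 0 = b 0 * B := by rw [hB, mul_one]
        _ = _ := by
          rw [hBdef, Finset.mul_sum]
          exact Finset.sum_eq_single 0 (fun j _ hj => horth 0 j hj.symm) (by simp)
    have hz : b 0 = 0 := by
      have := congrArg norm hb2
      rw [CStarRing.norm_star_mul_self] at this
      by_contra hne
      have hpos : 0 < ‖b 0‖ := norm_pos_iff.2 hne
      nlinarith
    have hall : ∀ i, b i = 0 := fun i => by
      obtain ⟨x, hx, hx'⟩ := heq i 0
      rw [hz] at hx'
      have : x = 0 := CStarRing.mul_star_self_eq_zero_iff x |>.1 hx'.symm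
      rw [hx, this, mul_zero]
    exact one_ne_zero (α := A) (by rw [← hB, hBdef]; simp [hall])
  -- the elements `s i`
  let κ : ℝ → ℝ := fun s => √((max s ε)⁻¹)
  have hκ : Continuous κ := Real.continuous_sqrt.comp hk
  have hκκ : ∀ s, κ s * κ s = (max s ε)⁻¹ := fun s => Real.mul_self_sqrt
    (inv_nonneg.2 (hε.le.trans (le_max_right _ _)))
  choose x hx hx' using fun i => heq i 0
  have hint : ∀ i, b 0 * x i = x i * b i := fun i => by rw [hx' i, hx i]; simp only [mul_assoc]
  let s : Fin n → A := fun i => x i * cfc κ (b i)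
  have hss : ∀ i, star (s i) * s i = cfc g (b i) := fun i => by
    rw [star_mul_cfc_self, ← hx i]
    have : g = fun s => κ s * s * κ s := by
      ext s; simp only [g, ← hκκ]; ring
    rw [this, cfc_mul (fun s => κ s * s) κ (b i) (by fun_prop) hκ.continuousOn,
      cfc_mul κ (fun s => s) (b i) hκ.continuousOn, cfc_id' ℝ _ (hsa i)]
  have hss' : ∀ i, s i * star (s i) = cfc g (b 0) := fun i => by
    rw [mul_cfc_self_star (hsa i) (hsa 0) (hint i) hκ, ← hx' i]
    have : g = fun s => (κ s * κ s) * s := by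
      ext s; simp only [g, ← hκκ]
    rw [this, cfc_mul (fun s => κ s * κ s) (fun s => s) (b 0) (by fun_prop), cfc_id' ℝ _ (hsa 0)]
  -- the element `v`
  let ω : ℝ → ℝ := fun s => √(1 - g s)
  have hω : Continuous ω := Real.continuous_sqrt.comp (continuous_const.sub hg)
  set w := cfc ω B with hw
  have hwsa : IsSelfAdjoint w := cfc_predicate _ _
  have hww : w * w = 1 - cfc g B := by
    rw [hw, ← cfc_mul ω ω B hω.continuousOn hω.continuousOn, ← cfc_one ℝ B,
      ← cfc_sub 1 g B continuousOn_const hg.continuousOn]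
    exact cfc_congr fun s _ => Real.mul_self_sqrt (sub_nonneg.2 (hgle s))
  -- Compressed by `w`, the element `1 - B` is at least `(1 - ε) w² = 2c w²`. An approximation error
  -- of `c` leaves `c w² ≤ w y⋆ e y w`.
  set c : ℝ := (1 - ε) / 2 with hc
  have hc0 : 0 < c := by rw [hc]; linarith
  obtain ⟨_, ⟨y, rfl⟩, hy⟩ := Metric.mem_closure_iff.1 hsub c hc0
  set q := CFC.sqrt e with hq
  have hq0 : IsSelfAdjoint q := (CFC.sqrt_nonneg e).isSelfAdjoint
  have hqq : q * q = e := CFC.sqrt_mul_sqrt_self e he0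
  have hy1 : 1 - B - star (q * y) * (q * y) ≤ algebraMap ℝ A c := by
    have h1 : star (q * y) * (q * y) = star y * e * y := by
      rw [star_mul, hq0.star_eq, ← hqq]; noncomm_ring
    rw [h1]
    have h2 : IsSelfAdjoint (1 - B - star y * e * y) :=
      (hle.isSelfAdjoint).sub (star_left_conjugate_nonneg he0 y).isSelfAdjoint
    refine (h2.le_algebraMap_norm_self).trans (algebraMap_mono A ?_)
    rw [← dist_eq_norm]
    exact hy.le
  let z : A := (√c)⁻¹ • (q * y * w)
  have hzz : w * w ≤ star z * z := by
    have h1 : star z * z = c⁻¹ • (w * (star (q * y) * (q * y)) * w) := by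
      simp only [z, star_smul, star_trivial, star_mul, hwsa.star_eq, smul_mul_smul_comm]
      congr 1
      · rw [← mul_inv, Real.mul_self_sqrt hc0.le]
      · noncomm_ring
    have h2 : c • (w * w) ≤ w * (star (q * y) * (q * y)) * w := by
      have h3 := star_left_conjugate_le_conjugate hy1 w
      rw [hwsa.star_eq] at h3
      -- `ω` vanishes on `[ε, ∞)`, so `w` only sees the part of `B` below `ε`.
      have h4 : 0 ≤ w * (algebraMap ℝ A ε - B) * w := by
        have e1 : w * (algebraMap ℝ A ε - B) * w = cfc (fun s => ω s * (ε - s) * ω s) B := by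
          rw [cfc_mul (fun s => ω s * (ε - s)) ω B (by fun_prop) hω.continuousOn,
            cfc_mul ω (fun s => ε - s) B hω.continuousOn, cfc_sub (fun _ => ε) (fun s => s) B,
            cfc_id' ℝ B hBsa, cfc_const ε B hBsa]
        rw [e1]
        refine cfc_nonneg fun s hs => ?_
        rcases le_total s ε with h | h
        · have := sub_nonneg.2 h
          have : 0 ≤ ω s := Real.sqrt_nonneg _
          positivity
        · simp [ω, hg1 s h]
      have e2 : w * (star (q * y) * (q * y)) * w - c • (w * w) =
          (w * algebraMap ℝ A c * w - w * (1 - B - star (q * y) * (q * y)) * w) +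
            w * (algebraMap ℝ A ε - B) * w := by
        have : (1 : ℝ) - ε - 2 * c = 0 := by rw [hc]; ring
        simp only [Algebra.algebraMap_eq_smul_one, mul_sub, sub_mul, mul_smul_comm, smul_mul_assoc,
          mul_one]
        have e3 : w * w = (ε + 2 * c) • (w * w) := by
          rw [show ε + 2 * c = 1 by linarith, one_smul]
        nth_rewrite 3 [e3]
        rw [add_smul, two_mul, add_smul]
        abel
      rw [← sub_nonneg, e2]
      exact add_nonneg (sub_nonneg.2 h3) h4
    rw [h1]
    calc w * w = c⁻¹ • (c • (w * w)) := by rw [smul_smul, inv_mul_cancel₀ hc0.ne', one_smul]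
      _ ≤ _ := smul_le_smul_of_nonneg_left h2 (inv_nonneg.2 hc0.le)
  obtain ⟨v, hv, hvv⟩ := exists_factorization hwsa hzz
  -- `g` equals `1` wherever `max (s - ε) 0` is nonzero. As `v` lies in the closed right ideal
  -- generated by `q = √e`, this gives `g (b 0) v = v`.
  have hgq : cfc g (b 0) * q = q := by
    have h1 : e * (1 - cfc g (b 0)) = 0 := by
      have hm : Continuous fun s : ℝ => max (s - ε) 0 := by fun_prop
      rw [heC, mul_sub, mul_one, ← cfc_mul _ g _ hm.continuousOn hg.continuousOn, sub_eq_zero]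
      refine cfc_congr fun s _ => ?_
      rcases le_total s ε with h | h
      · simp [max_eq_right (sub_nonpos.2 h)]
      · simp [hg1 s h]
    have h2 := congrArg star (sqrt_mul_eq_zero he0 h1)
    rw [star_mul, star_sub, star_one, (cfc_predicate g (b 0) : IsSelfAdjoint _).star_eq, ← hq,
      hq0.star_eq, star_zero, sub_mul, one_mul, sub_eq_zero] at h2
    exact h2.symm
  have hgv : cfc g (b 0) * v = v := by
    refine closure_minimal (t := {v | cfc g (b 0) * v = v}) ?_
      (isClosed_eq (by fun_prop) continuous_id) hv
    rintro _ ⟨a, rfl⟩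
    simp only [z, Set.mem_ofPred_eq, smul_mul_assoc, mul_smul_comm, ← mul_assoc, hgq]
  have hnorm : ‖cfc g (b 0)‖ = 1 := by
    refine le_antisymm (norm_cfc_le zero_le_one fun s hs => ?_) ?_
    · rw [Real.norm_of_nonneg (hg0 s (hspec (h0 0) s hs))]
      exact hgle s
    · have := norm_apply_le_norm_cfc g (b 0) (CStarAlgebra.norm_mem_spectrum_of_nonneg (h0 0))
        hg.continuousOn
        (hsa 0)
      rwa [hg1 _ hball, norm_one] at this
  refine ⟨v, s, ?_, fun i => ?_, fun i => ?_, fun i j hij => ?_, ?_, ?_⟩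
  · have h1 : star v * v ≤ 1 := by
      rw [hvv, hww, sub_le_self_iff]
      exact cfc_nonneg fun s hs => hg0 s (hspec hB0 s hs)
    have h2 := CStarAlgebra.norm_le_norm_of_nonneg_of_le (star_mul_self_nonneg v) h1
    rw [CStarRing.norm_star_mul_self, norm_one] at h2
    nlinarith [norm_nonneg v]
  · have h2 : ‖s i‖ * ‖s i‖ = 1 := by rw [← CStarRing.norm_self_mul_star, hss', hnorm]
    nlinarith [norm_nonneg (s i)]
  · rw [hss, hss']
  · rw [hss, hss]
    exact cfc_mul_cfc_eq_zero (hsa i) (hsa j) (horth i j hij) hg hg (by simp [g]) (by simp [g])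
  · simp only [hss]
    rw [hvv, hww, hG]
  · rw [hss]
    have h1 := congrArg star hgv
    rw [star_mul, (cfc_predicate g (b 0) : IsSelfAdjoint _).star_eq] at h1
    rw [mul_assoc, h1]

theorem HasAlmostPartition.hasGenerators [Nontrivial A] {n : ℕ} [NeZero n]
    (h : HasAlmostPartition A n) : HasGenerators A n := by
  obtain ⟨ε, hε, b, h0, heq, horth, hle, hsub⟩ := h
  rcases lt_or_ge ε 1 with hε1 | hε1
  · exact hasGenerators_of_lt_one hε hε1 h0 heq horth hle hsub
  -- For `ε ≥ 1` the bound `b 0 ≤ 1` makes the cut-down zero. Then `1 - ∑ b i = 0`, which is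
  -- subequivalent to anything, and any smaller threshold serves.
  · refine hasGenerators_of_lt_one (ε := 1 / 2) (by norm_num) (by norm_num) h0 heq horth hle ?_
    have hb : b 0 ≤ 1 := (Finset.single_le_sum (fun i _ => h0 i) (Finset.mem_univ 0)).trans
      (sub_nonneg.1 hle)
    have hz : (b 0 - algebraMap ℝ A ε)⁺ = 0 := by
      rw [CFC.posPart_eq_zero_iff _ ((h0 0).isSelfAdjoint.sub (.algebraMap A (.all ε)))]
      refine sub_nonpos.2 (hb.trans ?_)
      rw [← map_one (algebraMap ℝ A)]
      exact algebraMap_mono A hε1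
    have h1 : (1 - ∑ i, b i) ∈ closure (Set.range fun x : A =>
        star x * (b 0 - algebraMap ℝ A ε)⁺ * x) := hsub
    rw [hz] at h1
    simp only [mul_zero, zero_mul, Set.range_const, closure_singleton,
      Set.mem_singleton_iff] at h1
    rw [h1]
    exact subset_closure ⟨0, by simp⟩

end PartitionToGenerators

/-! ### Multiples in the Cuntz semigroup as block diagonal matrices. -/

section Multiples

variable {A : Type*} [CStarAlgebra A] [PartialOrder A] [StarOrderedRing A]

/-- The block diagonal matrix with `m` blocks equal to `a`. -/
def blockDiag {k : Type*} (m : ℕ) (a : CStarMatrix k k A) :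
    CStarMatrix (k × Fin m) (k × Fin m) A :=
  CStarMatrix.ofMatrix (Matrix.blockDiagonal fun _ => CStarMatrix.ofMatrix.symm a)

omit [PartialOrder A] [StarOrderedRing A] in
theorem blockDiag_apply {k : Type*} (m : ℕ) (a : CStarMatrix k k A) (p q : k × Fin m) :
    blockDiag m a p q = if p.2 = q.2 then a p.1 q.1 else 0 :=
  Matrix.blockDiagonal_apply (fun _ => CStarMatrix.ofMatrix.symm a) p q

/-- Adjoining one more block. -/
def prodFinSuccEquiv (k : Type*) (m : ℕ) : (k × Fin m) ⊕ k ≃ k × Fin (m + 1) :=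
  ((Equiv.sumCongr (Equiv.refl _) (Equiv.prodUnique k (Fin 1)).symm).trans
    (Equiv.prodSumDistrib k (Fin m) (Fin 1)).symm).trans
      (Equiv.prodCongr (Equiv.refl _) finSumFinEquiv)

theorem prodFinSuccEquiv_inl {k : Type*} {m : ℕ} (p : k × Fin m) :
    prodFinSuccEquiv k m (.inl p) = (p.1, p.2.castSucc) := rfl

theorem prodFinSuccEquiv_inr {k : Type*} {m : ℕ} (p : k) :
    prodFinSuccEquiv k m (.inr p) = (p, Fin.last m) := rfl

/-- Iterated addition nests sums of index types. Flattening them once to `Fin k × Fin m` makes the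
later comparisons plain matrix computations. -/
theorem CuntzSemigroup.exists_nsmul_mk (a : PosMat A) (m : ℕ) :
    ∃ c : PosMat A, m • CuntzSemigroup.mk a = CuntzSemigroup.mk c ∧
      ∃ e : Fin c.1 ≃ Fin a.1 × Fin m, ∀ i j, c.2.1 i j = blockDiag m a.2.1 (e i) (e j) := by
  induction m with
  | zero => exact ⟨0, rfl, Equiv.equivOfIsEmpty (Fin 0) _, fun i => i.elim0⟩
  | succ m ih =>
    obtain ⟨c, hc, e, he⟩ := ih
    refine ⟨c + a, by rw [succ_nsmul, hc]; rfl,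
      (finSumFinEquiv.symm.trans (Equiv.sumCongr e (Equiv.refl _))).trans
        (prodFinSuccEquiv _ m), fun i j => ?_⟩
    obtain ⟨i, rfl⟩ := finSumFinEquiv.surjective i
    obtain ⟨j, rfl⟩ := finSumFinEquiv.surjective j
    change (Matrix.reindex finSumFinEquiv finSumFinEquiv
      (Matrix.fromBlocks (Matrix.of c.2.1) 0 0 (Matrix.of a.2.1))) _ _ = _
    simp only [Matrix.reindex_apply, Matrix.submatrix_apply, Equiv.trans_apply,
      Equiv.symm_apply_apply]
    rcases i with i | i <;> rcases j with j | j
    · change c.2.1 i j = blockDiag (m + 1) a.2.1 (prodFinSuccEquiv _ m (.inl (e i)))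
        (prodFinSuccEquiv _ m (.inl (e j)))
      rw [he, blockDiag_apply, blockDiag_apply, prodFinSuccEquiv_inl, prodFinSuccEquiv_inl]
      simp
    · change 0 = blockDiag (m + 1) a.2.1 (prodFinSuccEquiv _ m (.inl (e i)))
        (prodFinSuccEquiv _ m (.inr j))
      rw [blockDiag_apply, prodFinSuccEquiv_inl, prodFinSuccEquiv_inr]
      simp [Fin.castSucc_ne_last]
    · change 0 = blockDiag (m + 1) a.2.1 (prodFinSuccEquiv _ m (.inr i))
        (prodFinSuccEquiv _ m (.inl (e j)))
      rw [blockDiag_apply, prodFinSuccEquiv_inl, prodFinSuccEquiv_inr]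
      simp [(Fin.castSucc_ne_last _).symm]
    · change a.2.1 i j = blockDiag (m + 1) a.2.1 (prodFinSuccEquiv _ m (.inr i))
        (prodFinSuccEquiv _ m (.inr j))
      rw [blockDiag_apply, prodFinSuccEquiv_inr, prodFinSuccEquiv_inr]
      simp

theorem CuntzSemigroup.nsmul_mk_le_iff (a b : PosMat A) (m : ℕ) :
    m • CuntzSemigroup.mk a ≤ CuntzSemigroup.mk b ↔ MatSubeq (blockDiag m a.2.1) b.2.1 := by
  obtain ⟨c, hc, e, he⟩ := CuntzSemigroup.exists_nsmul_mk a m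
  have h : c.2.1 = CStarMatrix.ofMatrix
      ((CStarMatrix.ofMatrix.symm (blockDiag m a.2.1)).submatrix e e) := CStarMatrix.ext he
  rw [hc, CuntzSemigroup.mk_le_mk, h]
  exact ⟨(MatSubeq.submatrix' _ e).trans, (MatSubeq.submatrix _ e).trans⟩

theorem CuntzSemigroup.mk_le_nsmul_mk_iff (a b : PosMat A) (m : ℕ) :
    CuntzSemigroup.mk b ≤ m • CuntzSemigroup.mk a ↔ MatSubeq b.2.1 (blockDiag m a.2.1) := by
  obtain ⟨c, hc, e, he⟩ := CuntzSemigroup.exists_nsmul_mk a m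
  have h : c.2.1 = CStarMatrix.ofMatrix
      ((CStarMatrix.ofMatrix.symm (blockDiag m a.2.1)).submatrix e e) := CStarMatrix.ext he
  rw [hc, CuntzSemigroup.mk_le_mk, h]
  exact ⟨fun H => H.trans (MatSubeq.submatrix _ e), fun H => H.trans (MatSubeq.submatrix' _ e)⟩

theorem almostDivisible_iff {n : ℕ} : AlmostDivisible A n ↔
    ∃ (k : ℕ) (a : CStarMatrix (Fin k) (Fin k) A), 0 ≤ a ∧
      MatSubeq (blockDiag n a) (1 : CStarMatrix (Fin 1) (Fin 1) A) ∧
      MatSubeq (1 : CStarMatrix (Fin 1) (Fin 1) A) (blockDiag (n + 1) a) := by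
  constructor
  · rintro ⟨x, h1, h2⟩
    induction x using Quotient.ind with | _ x
    obtain ⟨k, a, ha⟩ := x
    exact ⟨k, a, ha, (CuntzSemigroup.nsmul_mk_le_iff _ _ _).1 h1,
      (CuntzSemigroup.mk_le_nsmul_mk_iff _ _ _).1 h2⟩
  · rintro ⟨k, a, ha, h1, h2⟩
    exact ⟨CuntzSemigroup.mk ⟨k, a, ha⟩, (CuntzSemigroup.nsmul_mk_le_iff _ _ _).2 h1,
      (CuntzSemigroup.mk_le_nsmul_mk_iff _ _ _).2 h2⟩

end Multiples

/-! ### Generator relations imply almost divisibility. -/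

section GeneratorsToDivisible

variable {A : Type*} [CStarAlgebra A] {n : ℕ} [NeZero n]

/-- The algebraic relations between the generators of `Z_{n,n+1}`. -/
structure GeneratorRelations (v : A) (s : Fin n → A) : Prop where
  star_mul_eq : ∀ i, star (s 0) * s 0 = s i * star (s i)
  orthogonal : ∀ i j, i ≠ j → (star (s i) * s i) * (star (s j) * s j) = 0
  star_v_mul : star v * v = 1 - ∑ k, star (s k) * s k
  v_mul_star : v * star v * (star (s 0) * s 0) = v * star v

namespace GeneratorRelations

variable {v : A} {s : Fin n → A}

/-- The C⋆-identity cancels `star (s i)` on the left and, after taking adjoints, `s j` on the right.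
-/
theorem mul_star_eq_zero (h : GeneratorRelations v s) {i j : Fin n} (hij : i ≠ j) :
    s i * star (s j) = 0 := by
  have h1 : s i * star (s j) * s j = 0 := by
    have := mul_eq_zero_of_star_mul_self_mul_eq_zero (h.orthogonal i j hij)
    rwa [← mul_assoc] at this
  have h2 : star (s i * star (s j)) = 0 := by
    have h3 : star (s j) * s j * star (s i) = 0 := by
      have := congrArg star h1
      simpa [mul_assoc] using this
    simpa using mul_eq_zero_of_star_mul_self_mul_eq_zero h3
  simpa using congrArg star h2

theorem one_sub_mul_v (h : GeneratorRelations v s) : (1 - star (s 0) * s 0) * v = 0 := by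
  have h1 : v * star v * (1 - star (s 0) * s 0) = 0 := by
    rw [mul_sub, mul_one, h.v_mul_star, sub_self]
  have h2 : star v * (1 - star (s 0) * s 0) = 0 :=
    mul_eq_zero_of_star_mul_self_mul_eq_zero (by simpa using h1)
  simpa using congrArg star h2

theorem mul_v (h : GeneratorRelations v s) : star (s 0) * s 0 * v = v := by
  have := h.one_sub_mul_v
  rw [sub_mul, one_mul, sub_eq_zero] at this
  exact this.symm

/-- Combined with `star_v_mul` this gives `v⋆ v s_k⋆ = s_k⋆ (1 - a)` for `a = s_0⋆ s_0`, the
exchange rule behind the construction of the local units. -/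
theorem sum_mul_star (h : GeneratorRelations v s) (k : Fin n) :
    (∑ i, star (s i) * s i) * star (s k) = star (s k) * (star (s 0) * s 0) := by
  rw [Finset.sum_mul, Finset.sum_eq_single k, h.star_mul_eq k, mul_assoc]
  · intro i _ hi
    rw [mul_assoc, h.mul_star_eq_zero hi, mul_zero]
  · simp

theorem map {B : Type*} [CStarAlgebra B] (h : GeneratorRelations v s) (φ : A →⋆ₐ[ℂ] B) :
    GeneratorRelations (φ v) (fun i => φ (s i)) where
  star_mul_eq i := by simp only [← map_star, ← map_mul, h.star_mul_eq i]
  orthogonal i j hij := by simp only [← map_star, ← map_mul, h.orthogonal i j hij, map_zero]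
  star_v_mul := by simp only [← map_star, ← map_mul, h.star_v_mul, map_sub, map_one, map_sum]
  v_mul_star := by simp only [← map_star, ← map_mul, h.v_mul_star]

variable [PartialOrder A] [StarOrderedRing A]

theorem almostDivisible (h : GeneratorRelations v s) : AlmostDivisible A n := by
  set a := star (s 0) * s 0 with ha
  have ha0 : 0 ≤ a := star_mul_self_nonneg _
  let m : CStarMatrix (Fin 1) (Fin 1) A := CStarMatrix.ofMatrix fun _ _ => a
  have hm : 0 ≤ m := by
    refine nonneg_iff_exists_star_mul_self.2 ⟨CStarMatrix.ofMatrix fun _ _ => s 0, ?_⟩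
    ext i j
    rw [CStarMatrix.mul_apply, Fin.sum_univ_one]
    rfl
  refine almostDivisible_iff.2 ⟨1, m, hm, ?_, ?_⟩
  -- The row of the `s_i⋆` has Gram matrix `(s_i s_j⋆)`, which is diagonal with entries `a`.
  · refine MatSubeq.of_eq (CStarMatrix.ofMatrix fun _ p => star (s p.2)) ?_
    ext p q
    rw [blockDiag_apply, CStarMatrix.mul_apply, Fin.sum_univ_one, CStarMatrix.mul_apply,
      Fin.sum_univ_one, CStarMatrix.one_apply_eq, mul_one]
    change (if p.2 = q.2 then a else 0) = star (star (s p.2)) * star (s q.2)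
    split_ifs with hpq
    · rw [star_star, hpq, ha, h.star_mul_eq]
    · rw [star_star, h.mul_star_eq_zero hpq]
  · set b := ∑ k, star (s k) * s k with hb
    -- Compressing `n + 1` copies of `a` by the column `(s_1, …, s_n, v)` gives `1 - b + b² = 3/4 +
    -- (b - 1/2)²`, which is invertible. Conjugating by `N^(-1/2)` then yields exactly `1`.
    let N : A := ∑ i, star (s i) * a * s i + star v * a * v
    have hN : N = 1 - b + b * b := by
      have h1 : ∀ i, star (s i) * a * s i = b * (star (s i) * s i) := fun i => by
        rw [← mul_assoc b, h.sum_mul_star]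
      simp only [N, h1]
      rw [← Finset.mul_sum, mul_assoc, h.mul_v, h.star_v_mul]
      abel
    have hbsa : IsSelfAdjoint b := isSelfAdjoint_sum _ fun i _ => .star_mul_self _
    have hNle : algebraMap ℝ A (3 / 4) ≤ N := by
      have : N - algebraMap ℝ A (3 / 4) =
          star (b - algebraMap ℝ A (1 / 2)) * (b - algebraMap ℝ A (1 / 2)) := by
        rw [star_sub, hbsa.star_eq, (IsSelfAdjoint.algebraMap A (.all _)).star_eq, hN]
        simp only [Algebra.algebraMap_eq_smul_one, mul_sub, sub_mul, smul_mul_assoc, mul_smul_comm,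
          one_mul, mul_one]
        module
      rw [← sub_nonneg, this]
      exact star_mul_self_nonneg _
    have hN0 : 0 ≤ N := le_trans (by
      rw [← map_zero (algebraMap ℝ A)]
      exact algebraMap_mono A (by norm_num)) hNle
    have hNu : IsUnit N := CStarAlgebra.isUnit_of_le _ hNle (IsStrictlyPositive.iff_of_unital.2
      ⟨by rw [← map_zero (algebraMap ℝ A)]; exact algebraMap_mono A (by norm_num),
        (IsUnit.mk0 (3 / 4 : ℝ) (by norm_num)).map _⟩)
    obtain ⟨r, hr, hrN⟩ := exists_conj_eq_one hN0 hNu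
    let x : Fin (n + 1) → A := Fin.snoc s v
    refine MatSubeq.of_eq (CStarMatrix.ofMatrix fun p _ => x p.2 * r) ?_
    ext p q
    obtain rfl := Subsingleton.elim p q
    have key : r * N * r = ∑ i, star (x i * r) * a * (x i * r) := by
      simp only [N, x, Fin.sum_univ_castSucc, Fin.snoc_castSucc, Fin.snoc_last, star_mul,
        hr.star_eq, mul_add, add_mul, Finset.mul_sum, Finset.sum_mul]
      congr 1
      · exact Finset.sum_congr rfl fun i _ => by noncomm_ring
      · noncomm_ring
    rw [CStarMatrix.one_apply_eq, ← hrN, key, CStarMatrix.mul_apply, Fintype.sum_prod_type,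
      Fin.sum_univ_one]
    refine Finset.sum_congr rfl fun i _ => ?_
    rw [CStarMatrix.mul_apply, Fintype.sum_prod_type, Fin.sum_univ_one, Finset.sum_eq_single i]
    · rw [blockDiag_apply, if_pos rfl]
      rfl
    · intro j _ hj
      rw [blockDiag_apply, if_neg hj, mul_zero]
    · simp

end GeneratorRelations

end GeneratorsToDivisible

/-! ### Approximate unitary equivalence under stable rank one. -/

section StableRankOne

variable {A : Type*} [CStarAlgebra A] [PartialOrder A] [StarOrderedRing A]

/-- The unitary is `x (x⋆x)^(-1/2)` from the polar decomposition: it is an isometry, and invertible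
because `x` is. -/
theorem exists_unitary_of_isUnit {x : A} (hx : IsUnit x) :
    ∃ u ∈ unitary A, u * (star x * x) * star u = x * star x := by
  obtain ⟨r, hr, hrN⟩ := exists_conj_eq_one (star_mul_self_nonneg x) (hx.star.mul hx)
  have hru : IsUnit r := isUnit_iff_exists_and_exists.2
    ⟨⟨star x * x * r, by rw [← mul_assoc, hrN]⟩, ⟨r * (star x * x), hrN⟩⟩
  have h1 : star (x * r) * (x * r) = 1 := by
    rw [← hrN, star_mul, hr.star_eq]; noncomm_ring
  refine ⟨x * r, Unitary.mem_iff.2 ⟨h1, ?_⟩, ?_⟩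
  · obtain ⟨y, hy⟩ := hx.mul hru
    rw [← hy] at h1 ⊢
    rw [← Units.inv_eq_of_mul_eq_one_left h1]
    exact y.mul_inv
  · calc x * r * (star x * x) * star (x * r) = x * (r * (star x * x) * r) * star x := by
          rw [star_mul, hr.star_eq]; noncomm_ring
      _ = _ := by rw [hrN, mul_one]

/-- In a C⋆-algebra of stable rank one, `x⋆ x` and `x x⋆` are approximately unitarily
equivalent. -/
theorem HasStableRankOne.exists_unitary_norm_lt (hA : HasStableRankOne A) (x : A) {ε : ℝ}
    (hε : 0 < ε) : ∃ u ∈ unitary A, ‖u * (star x * x) * star u - x * star x‖ < ε := by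
  have hc : Continuous fun y : A => ‖star x * x - star y * y‖ + ‖y * star y - x * star x‖ := by
    fun_prop
  have ho : IsOpen {y : A | ‖star x * x - star y * y‖ + ‖y * star y - x * star x‖ < ε} :=
    isOpen_lt hc continuous_const
  obtain ⟨y, hy, hyu⟩ := Dense.inter_open_nonempty hA _ ho ⟨x, by simpa using hε⟩
  obtain ⟨u, hu, hux⟩ := exists_unitary_of_isUnit hyu
  refine ⟨u, hu, lt_of_le_of_lt ?_ hy⟩
  have h1 : u * (star x * x) * star u - x * star x =
      u * (star x * x - star y * y) * star u + (y * star y - x * star x) := by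
    rw [← hux]; noncomm_ring
  rw [h1]
  refine (norm_add_le _ _).trans (add_le_add_left (le_of_eq ?_) _)
  rw [CStarRing.norm_mul_mem_unitary _ (Unitary.star_mem hu), CStarRing.norm_mem_unitary_mul _ hu]

end StableRankOne

/-! ### Orthogonal rows with a common Gram matrix. -/

section Rows

variable {A : Type*} [CStarAlgebra A]

/-- The block diagonal embedding as a ⋆-homomorphism. -/
def blockDiagHom (k : Type*) [Fintype k] [DecidableEq k] (m : ℕ) :
    CStarMatrix k k A →⋆ₐ[ℂ] CStarMatrix (k × Fin m) (k × Fin m) A where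
  toFun := blockDiag m
  map_one' := Matrix.blockDiagonal_one
  map_mul' a b := Matrix.blockDiagonal_mul (fun _ => CStarMatrix.ofMatrix.symm a)
    (fun _ => CStarMatrix.ofMatrix.symm b)
  map_zero' := Matrix.blockDiagonal_zero
  map_add' a b := Matrix.blockDiagonal_add (fun _ => CStarMatrix.ofMatrix.symm a)
    (fun _ => CStarMatrix.ofMatrix.symm b)
  commutes' c := by
    ext p q
    rw [blockDiag_apply, CStarMatrix.algebraMap_apply, CStarMatrix.algebraMap_apply]
    simp only [Prod.ext_iff]
    split_ifs <;> simp_all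
  map_star' a := by
    ext p q
    rw [blockDiag_apply, CStarMatrix.star_apply, CStarMatrix.star_apply, blockDiag_apply]
    by_cases h : p.2 = q.2
    · rw [if_pos h, if_pos h.symm]
    · rw [if_neg h, if_neg (Ne.symm h), star_zero]

variable [PartialOrder A] [StarOrderedRing A]

/-- An element of the form `Φ a` close to `D⋆ D` is, up to a perturbation of `a`, of the form
`V⋆ V` with `V` in the closed right ideal generated by `D`. -/
theorem exists_perturbed_factorization {M C : Type*} [CStarAlgebra M] [PartialOrder M]
    [StarOrderedRing M] [CStarAlgebra C] [PartialOrder C] [StarOrderedRing C] (Φ : M →⋆ₐ[ℂ] C)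
    {a : M} (ha : 0 ≤ a) {D : C} {η : ℝ} (hη0 : 0 < η) (hd : ‖Φ a - star D * D‖ < η) :
    ∃ (a' : M) (V : C), ‖a' - a‖ ≤ 2 * η ∧ V ∈ closure (Set.range fun x => D * x) ∧
      star V * V = Φ a' := by
  have hasa : IsSelfAdjoint a := ha.isSelfAdjoint
  have hle : Φ a - algebraMap ℝ _ η ≤ star D * D := by
    have h1 : ‖Φ a - star D * D‖ ≤ η := hd.le
    have h2 : IsSelfAdjoint (Φ a - star D * D) := (hasa.map Φ).sub (.star_mul_self D)
    have h3 := h2.le_algebraMap_norm_self.trans (algebraMap_mono _ h1)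
    rw [sub_le_iff_le_add] at h3 ⊢
    rwa [add_comm]
  -- Chosen so that `f² (s - η) = (s - 2η)₊`. Where the numerator is nonzero, `s - η ≥ η`, so the
  -- bounded denominator changes nothing. Conjugating `Φ a - η ≤ D⋆D` by `f(a)` gives `Φ((a - 2η)₊)
  -- ≤ (D Φ e)⋆ (D Φ e)`, and `a' = (a - 2η)₊`.
  let f : ℝ → ℝ := fun s => √(max (s - 2 * η) 0 * (max (s - η) η)⁻¹)
  have hf : Continuous f := Real.continuous_sqrt.comp ((by fun_prop : Continuous fun s : ℝ =>
    max (s - 2 * η) 0).mul ((by fun_prop : Continuous fun s : ℝ => max (s - η) η).inv₀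
      fun s => (lt_max_of_lt_right hη0).ne'))
  let ω : ℝ → ℝ := fun s => √(max (s - 2 * η) 0)
  have hω : Continuous ω := by fun_prop
  have hfω : ∀ s, f s * (s - η) * f s = ω s * ω s := by
    intro s
    have h1 : 0 < max (s - η) η := lt_max_of_lt_right hη0
    have h2 : f s * f s = max (s - 2 * η) 0 * (max (s - η) η)⁻¹ :=
      Real.mul_self_sqrt (by positivity)
    have h3 : ω s * ω s = max (s - 2 * η) 0 := Real.mul_self_sqrt (le_max_right _ _)
    rw [h3, mul_right_comm, h2]
    rcases le_total s (2 * η) with h | h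
    · rw [max_eq_right (by linarith)]; ring
    · rw [max_eq_left (a := s - η) (by linarith)]
      have : s - η ≠ 0 := by linarith
      field_simp
  set e := cfc f a with he
  have hesa : IsSelfAdjoint e := cfc_predicate _ _
  set w := cfc ω a with hw
  have hwsa : IsSelfAdjoint w := cfc_predicate _ _
  have hww : e * (a - algebraMap ℝ _ η) * e = w * w := by
    rw [hw, ← cfc_mul ω ω a hω.continuousOn hω.continuousOn]
    rw [← cfc_congr (fun s _ => hfω s), cfc_mul (fun s => f s * (s - η)) f a (by fun_prop)
      hf.continuousOn, cfc_mul f (fun s => s - η) a hf.continuousOn,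
      cfc_sub (fun s => s) (fun _ => η) a, cfc_id' ℝ a hasa, cfc_const η a hasa]
  have hΦη : Φ (algebraMap ℝ _ η) = algebraMap ℝ _ η :=
    (Φ.toAlgHom.restrictScalars ℝ).commutes η
  have hfac : Φ w * Φ w ≤ star (D * Φ e) * (D * Φ e) := by
    have h1 := star_left_conjugate_le_conjugate hle (Φ e)
    rw [(hesa.map Φ).star_eq] at h1
    calc Φ w * Φ w = Φ e * (Φ a - algebraMap ℝ _ η) * Φ e := by
          rw [← hΦη, ← map_sub, ← map_mul, ← map_mul, ← map_mul, hww]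
      _ ≤ _ := h1
      _ = _ := by rw [star_mul, (hesa.map Φ).star_eq]; noncomm_ring
  obtain ⟨V, hV, hVV⟩ := exists_factorization (hwsa.map Φ) hfac
  refine ⟨w * w, V, ?_, closure_mono ?_ hV, by rw [hVV, map_mul]⟩
  · have h1 : w * w - a = cfc (fun s => ω s * ω s - s) a := by
      rw [cfc_sub (fun s => ω s * ω s) (fun s => s) a (by fun_prop),
        cfc_mul ω ω a hω.continuousOn hω.continuousOn, cfc_id' ℝ a hasa]
    rw [h1]
    refine norm_cfc_le (by positivity) fun s hs => ?_
    have hs0 : 0 ≤ s := spectrum_nonneg_of_nonneg ha hs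
    have h3 : ω s * ω s = max (s - 2 * η) 0 := Real.mul_self_sqrt (le_max_right _ _)
    rw [h3, Real.norm_eq_abs, abs_le]
    rcases le_total s (2 * η) with h | h
    · rw [max_eq_right (by linarith)]; constructor <;> linarith
    · rw [max_eq_left (by linarith)]; constructor <;> linarith
  · rintro _ ⟨x, rfl⟩
    exact ⟨Φ e * x, (mul_assoc _ _ _).symm⟩

/-- If `n` copies of `a` are dominated by the unit, then approximately so in an exact fashion: there
are `n` orthogonal rows with common Gram matrix close to `a`. -/
theorem exists_orthogonal_rows {k n : ℕ} [NeZero n] {a : CStarMatrix (Fin k) (Fin k) A}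
    (ha : 0 ≤ a) (h : MatSubeq (blockDiag n a) (1 : CStarMatrix (Fin 1) (Fin 1) A)) {δ : ℝ}
    (hδ : 0 < δ) : ∃ (a' : CStarMatrix (Fin k) (Fin k) A) (v : Fin n → Fin k → A),
      ‖a' - a‖ < δ ∧ ∀ i j p q, star (v i p) * v j q = if i = j then a' p q else 0 := by
  rcases Nat.eq_zero_or_pos k with rfl | hk
  · exact ⟨a, fun _ p => p.elim0, by simpa using hδ, fun _ _ p => p.elim0⟩
  have : NeZero k := ⟨hk.ne'⟩
  set η := δ / 3 with hη
  have hη0 : 0 < η := by positivity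
  obtain ⟨_, ⟨d, rfl⟩, hd⟩ := Metric.mem_closure_iff.1 h η hη0
  let i₀ : Fin k × Fin n := (0, 0)
  -- The row `d` is padded by zero rows to a square matrix, so that factorization inside a
  -- C⋆-algebra applies. Elements of the closed right ideal of `D` again have a single nonzero row.
  let D : CStarMatrix (Fin k × Fin n) (Fin k × Fin n) A :=
    CStarMatrix.ofMatrix fun i j => if i = i₀ then d 0 j else 0
  have hD : star D * D = d.conjTranspose * (1 : CStarMatrix (Fin 1) (Fin 1) A) * d := by
    ext p q
    rw [CStarMatrix.mul_apply, CStarMatrix.mul_apply, Fin.sum_univ_one, CStarMatrix.mul_apply,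
      Fin.sum_univ_one, CStarMatrix.one_apply_eq, mul_one, Finset.sum_eq_single i₀]
    · rw [CStarMatrix.star_apply]
      change star (if i₀ = i₀ then d 0 p else 0) * (if i₀ = i₀ then d 0 q else 0) = _
      rw [if_pos rfl, if_pos rfl]
      rfl
    · intro i _ hi
      change _ * (if i = i₀ then d 0 q else 0) = 0
      rw [if_neg hi, mul_zero]
    · simp
  obtain ⟨a', V, hnorm, hV, hVV⟩ := exists_perturbed_factorization (blockDiagHom (Fin k) n) ha hη0
    (D := D) (by rw [hD, ← dist_eq_norm]; exact hd)
  have hrow : ∀ i j, i ≠ i₀ → V i j = 0 := by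
    intro i j hi
    have hcl : IsClosed {V : CStarMatrix (Fin k × Fin n) (Fin k × Fin n) A | V i j = 0} :=
      isClosed_eq ((continuous_apply j).comp (continuous_apply i)) continuous_const
    refine closure_minimal ?_ hcl hV
    rintro _ ⟨x, rfl⟩
    change (D * x) i j = 0
    rw [CStarMatrix.mul_apply]
    refine Finset.sum_eq_zero fun l _ => ?_
    change (if i = i₀ then d 0 l else 0) * _ = 0
    rw [if_neg hi, zero_mul]
  refine ⟨a', fun i p => V i₀ (p, i), hnorm.trans_lt (by linarith), fun i j p q => ?_⟩
  · have h1 : (star V * V) (p, i) (q, j) = star (V i₀ (p, i)) * V i₀ (q, j) := by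
      rw [CStarMatrix.mul_apply, Finset.sum_eq_single i₀]
      · rw [CStarMatrix.star_apply]
      · intro l _ hl
        rw [hrow l _ hl, mul_zero]
      · simp
    rw [← h1, hVV]
    exact blockDiag_apply n a' (p, i) (q, j)

end Rows

/-! ### From almost divisibility to almost partitions: (i) ⇒ (ii). -/

section DivisibleToPartition

variable {A : Type*} [CStarAlgebra A] [PartialOrder A] [StarOrderedRing A]

/-- A cut-off function vanishing on `[0, ε]` and equal to one on `[2 ε, ∞)`. -/
def cutoff (ε s : ℝ) : ℝ := max 0 (min 1 (ε⁻¹ * s - 1))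

theorem continuous_cutoff (ε : ℝ) : Continuous (cutoff ε) := by
  unfold cutoff; fun_prop

theorem cutoff_of_le {ε s : ℝ} (hε : 0 < ε) (h : s ≤ ε) : cutoff ε s = 0 := by
  have : ε⁻¹ * s ≤ 1 := by rwa [inv_mul_le_iff₀ hε, mul_one]
  exact max_eq_left ((min_le_right _ _).trans (by linarith))

theorem cutoff_of_ge {ε s : ℝ} (hε : 0 < ε) (h : 2 * ε ≤ s) : cutoff ε s = 1 := by
  have : 2 ≤ ε⁻¹ * s := by rw [le_inv_mul_iff₀ hε]; linarith
  rw [cutoff, min_eq_left (by linarith), max_eq_right zero_le_one]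

theorem cutoff_mem (ε s : ℝ) : 0 ≤ cutoff ε s ∧ cutoff ε s ≤ 1 :=
  ⟨le_max_left _ _, max_le zero_le_one (min_le_left _ _)⟩

/-- The cut-offs of `b` form an approximate unit for the elements `v` with `v v⋆ ≤ b`. -/
theorem tendsto_cfc_cutoff_mul {b v : A} (hv : v * star v ≤ b) :
    Filter.Tendsto (fun ε => cfc (cutoff ε) b * v) (nhdsWithin 0 (Set.Ioi 0)) (nhds v) := by
  have hb : 0 ≤ b := (mul_star_self_nonneg v).trans hv
  have hbsa : IsSelfAdjoint b := hb.isSelfAdjoint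
  rw [tendsto_iff_norm_sub_tendsto_zero]
  have hlim : Filter.Tendsto (fun ε : ℝ => √(2 * ε)) (nhdsWithin 0 (Set.Ioi 0)) (nhds 0) := by
    have : Continuous fun ε : ℝ => √(2 * ε) := by fun_prop
    simpa using (this.tendsto 0).mono_left nhdsWithin_le_nhds
  refine squeeze_zero' (.of_forall fun _ => norm_nonneg _) ?_ hlim
  filter_upwards [self_mem_nhdsWithin] with ε hε
  have hε : 0 < ε := hε
  -- `h` vanishes beyond `2ε` and `h² ≤ 1`, so `h² s ≤ 2ε` on the spectrum, which bounds `‖h(b)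
  -- v‖²`.
  let h : ℝ → ℝ := fun s => cutoff ε s - 1
  have hc : Continuous h := (continuous_cutoff ε).sub continuous_const
  have h1 : cfc (cutoff ε) b * v - v = cfc h b * v := by
    rw [cfc_sub (cutoff ε) (fun _ => 1) b (continuous_cutoff ε).continuousOn, cfc_const_one ℝ b,
      sub_mul, one_mul]
  have h2 : ‖cfc h b * v‖ * ‖cfc h b * v‖ ≤ 2 * ε := by
    rw [← CStarRing.norm_self_mul_star]
    have h3 := star_left_conjugate_le_conjugate hv (cfc h b)
    rw [(cfc_predicate h b : IsSelfAdjoint _).star_eq] at h3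
    have h4 : cfc h b * b * cfc h b = cfc (fun s => h s * s * h s) b := by
      rw [cfc_mul (fun s => h s * s) h b (by fun_prop) hc.continuousOn,
        cfc_mul h (fun s => s) b hc.continuousOn, cfc_id' ℝ b hbsa]
    have h5 : cfc h b * v * star (cfc h b * v) = cfc h b * (v * star v) * cfc h b := by
      rw [star_mul, (cfc_predicate h b : IsSelfAdjoint _).star_eq]; noncomm_ring
    refine (CStarAlgebra.norm_le_norm_of_nonneg_of_le (mul_star_self_nonneg _)
      (h5.trans_le h3)).trans ?_
    rw [h4]
    refine norm_cfc_le (by positivity) fun s hs => ?_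
    have hs0 : 0 ≤ s := spectrum_nonneg_of_nonneg hb hs
    rcases le_total s (2 * ε) with hs' | hs'
    · have := cutoff_mem ε s
      have hh : h s * h s ≤ 1 := by simp only [h]; nlinarith
      have : h s * s * h s = h s * h s * s := by ring
      rw [this, Real.norm_of_nonneg (mul_nonneg (mul_self_nonneg _) hs0)]
      nlinarith
    · simp [h, cutoff_of_ge hε hs', hε.le]
  rw [h1]
  exact Real.le_sqrt_of_sq_le (by rw [sq]; exact h2)

omit [PartialOrder A] [StarOrderedRing A] in
theorem isUnit_of_norm_one_sub_lt {N : A} (h : ‖1 - N‖ < 1) : IsUnit N := by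
  simpa using isUnit_one_sub_of_norm_lt_one h

theorem exists_norm_one_sub_lt {k m : ℕ} {a : CStarMatrix (Fin k) (Fin k) A}
    (h : MatSubeq (1 : CStarMatrix (Fin 1) (Fin 1) A) (blockDiag m a)) {η : ℝ} (hη : 0 < η) :
    ∃ z : Fin m → Fin k → A,
      ‖1 - ∑ i, ∑ q, ∑ p, star (z i p) * a p q * z i q‖ < η := by
  obtain ⟨_, ⟨x, rfl⟩, hx⟩ := Metric.mem_closure_iff.1 h η hη
  rw [dist_eq_norm] at hx
  refine ⟨fun i p => x (p, i) 0, lt_of_le_of_lt (le_of_eq_of_le ?_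
    (CStarMatrix.norm_entry_le_norm (i := 0) (j := 0))) hx⟩
  congr 1
  rw [CStarMatrix.sub_apply, CStarMatrix.one_apply_eq]
  congr 1
  change _ = (x.conjTranspose * blockDiag m a * x) 0 0
  rw [CStarMatrix.mul_apply, Fintype.sum_prod_type, Finset.sum_comm]
  refine Finset.sum_congr rfl fun q _ => Finset.sum_congr rfl fun i _ => ?_
  rw [CStarMatrix.mul_apply, Finset.sum_mul, Fintype.sum_prod_type]
  refine Finset.sum_congr rfl fun p _ => ?_
  rw [Finset.sum_eq_single i]
  · rw [blockDiag_apply, if_pos rfl]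
    rfl
  · intro j _ hj
    rw [blockDiag_apply, if_neg hj, mul_zero, zero_mul]
  · simp

/-- The columns `z` are fixed first, for the original `a`. The norm estimate is an open condition on
the matrix, so it survives the perturbation to the Gram matrix `a'`. -/
theorem exists_rows_and_columns {n : ℕ} [NeZero n] (h : AlmostDivisible A n) :
    ∃ (k : ℕ) (v : Fin n → Fin k → A) (a' : CStarMatrix (Fin k) (Fin k) A)
      (z : Fin (n + 1) → Fin k → A),
      (∀ i j p q, star (v i p) * v j q = if i = j then a' p q else 0) ∧
      ‖1 - ∑ i, ∑ q, ∑ p, star (z i p) * a' p q * z i q‖ < 1 := by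
  obtain ⟨k, a, ha, h1, h2⟩ := almostDivisible_iff.1 h
  obtain ⟨z, hz⟩ := exists_norm_one_sub_lt h2 (zero_lt_one (α := ℝ))
  have hc : Continuous fun a' : CStarMatrix (Fin k) (Fin k) A =>
      ‖1 - ∑ i, ∑ q, ∑ p, star (z i p) * a' p q * z i q‖ := by
    have hentry : ∀ p q, Continuous fun a' : CStarMatrix (Fin k) (Fin k) A => a' p q :=
      fun p q => (continuous_apply q).comp (continuous_apply p)
    fun_prop
  obtain ⟨δ, hδ, hball⟩ := Metric.isOpen_iff.1 (isOpen_lt hc continuous_const) a hz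
  obtain ⟨a', v, hav, hv⟩ := exists_orthogonal_rows ha h1 hδ
  exact ⟨k, v, a', z, hv, hball (by rwa [Metric.mem_ball, dist_eq_norm])⟩

theorem AlmostDivisible.hasAlmostPartition {n : ℕ} [NeZero n] (hA : HasStableRankOne A)
    (h : AlmostDivisible A n) : HasAlmostPartition A n := by
  obtain ⟨k, v, a', z, hv, hz⟩ := exists_rows_and_columns h
  have hv0 : ∀ {i j : Fin n}, i ≠ j → ∀ p q, star (v i p) * v j q = 0 := fun hij p q => by
    rw [hv, if_neg hij]
  have hv1 : ∀ i j p q, star (v i p) * v i q = star (v j p) * v j q := fun i j p q => by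
    rw [hv, hv, if_pos rfl, if_pos rfl]
  -- the positive elements and the partial isometries between them
  let y : Fin n → Fin n → A := fun i j => ∑ q, v i q * star (v j q)
  let b : Fin n → A := fun i => y i i
  have hy_star : ∀ i j, star (y i j) = y j i := fun i j => by simp [y]
  -- In row notation `y i j = v_i v_j⋆`, and the middle factor `v_j⋆ v_j = a'` does not depend on
  -- `j`. In particular `y j i` intertwines `b i` with `b j`.
  have hyy : ∀ i j l, y i j * y j l = y i i * y i l := fun i j l => by
    simp only [y, Finset.sum_mul, Finset.mul_sum]
    refine Finset.sum_congr rfl fun p _ => Finset.sum_congr rfl fun q _ => ?_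
    calc v i q * star (v j q) * (v j p * star (v l p))
        = v i q * (star (v j q) * v j p) * star (v l p) := by noncomm_ring
      _ = _ := by rw [hv1 j i]; noncomm_ring
  have hb0 : ∀ i, 0 ≤ b i := fun i => Finset.sum_nonneg fun q _ => mul_star_self_nonneg _
  have hsa : ∀ i, IsSelfAdjoint (b i) := fun i => (hb0 i).isSelfAdjoint
  have horth : ∀ i j, i ≠ j → b i * b j = 0 := fun i j hij => by
    simp only [b, y, Finset.sum_mul, Finset.mul_sum]
    refine Finset.sum_eq_zero fun p _ => Finset.sum_eq_zero fun q _ => ?_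
    calc v i q * star (v i q) * (v j p * star (v j p))
        = v i q * (star (v i q) * v j p) * star (v j p) := by noncomm_ring
      _ = 0 := by rw [hv0 hij]; simp
  -- the columns
  let c : Fin (n + 1) → Fin n := Fin.snoc id 0
  -- There are `n` rows but `n + 1` columns, and `c` lets the last column reuse row `0`. That
  -- repetition is what separates `Y` from `X` below.
  let ζ : Fin (n + 1) → A := fun i => ∑ q, v (c i) q * z i q
  have hζ : ∑ i, ∑ q, ∑ p, star (z i p) * a' p q * z i q = ∑ i, star (ζ i) * ζ i := by
    refine Finset.sum_congr rfl fun i _ => ?_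
    simp only [ζ, star_sum, Finset.sum_mul, Finset.mul_sum, star_mul]
    refine Finset.sum_congr rfl fun q _ => Finset.sum_congr rfl fun p _ => ?_
    have : a' p q = star (v (c i) p) * v (c i) q := by rw [hv, if_pos rfl]
    rw [this]
    noncomm_ring
  have hlim : Filter.Tendsto (fun ε => ‖1 - ∑ i, star (cfc (cutoff ε) (b (c i)) * ζ i) *
      (cfc (cutoff ε) (b (c i)) * ζ i)‖) (nhdsWithin 0 (Set.Ioi 0))
      (nhds ‖1 - ∑ i, star (ζ i) * ζ i‖) := by
    have h1 : ∀ i, Filter.Tendsto (fun ε => cfc (cutoff ε) (b (c i)) * ζ i)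
        (nhdsWithin 0 (Set.Ioi 0)) (nhds (ζ i)) := fun i => by
      simp only [ζ, Finset.mul_sum, ← mul_assoc]
      refine tendsto_finsetSum _ fun q _ => (tendsto_cfc_cutoff_mul ?_).mul_const _
      exact Finset.single_le_sum (f := fun q => v (c i) q * star (v (c i) q))
        (fun q _ => mul_star_self_nonneg _) (Finset.mem_univ q)
    exact (tendsto_const_nhds.sub (tendsto_finsetSum _ fun i _ =>
      (h1 i).star.mul (h1 i))).norm
  rw [hζ] at hz
  obtain ⟨ε, hεN, hε⟩ := ((hlim.eventually_lt_const hz).and self_mem_nhdsWithin).exists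
  have hε : 0 < ε := hε
  set N := ∑ i, star (cfc (cutoff ε) (b (c i)) * ζ i) * (cfc (cutoff ε) (b (c i)) * ζ i) with hN
  obtain ⟨r, hr, hrN⟩ := exists_conj_eq_one (N := N)
    (Finset.sum_nonneg fun i _ => star_mul_self_nonneg _) (isUnit_of_norm_one_sub_lt hεN)
  let g : Fin n → A := fun i => cfc (cutoff ε) (b i)
  have hgsa : ∀ i, IsSelfAdjoint (g i) := fun i => cfc_predicate _ _
  have hg_orth : ∀ i j, i ≠ j → g i * g j = 0 := fun i j hij =>
    cfc_mul_cfc_eq_zero (hsa i) (hsa j) (horth i j hij) (continuous_cutoff ε) (continuous_cutoff ε)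
      (cutoff_of_le hε hε.le) (cutoff_of_le hε hε.le)
  let X : A := ∑ i : Fin n, g i * (ζ i.castSucc * r)
  let Y : A := g 0 * (ζ (Fin.last n) * r)
  have hXX : star X * X = ∑ i : Fin n, star (g i * (ζ i.castSucc * r)) *
      (g i * (ζ i.castSucc * r)) := by
    simp only [X, star_sum, Finset.sum_mul]
    refine Finset.sum_congr rfl fun i _ => ?_
    rw [Finset.mul_sum, Finset.sum_eq_single i]
    · intro j _ hj
      rw [star_mul, (hgsa i).star_eq, mul_assoc, ← mul_assoc (g i), hg_orth i j hj.symm]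
      simp
    · simp
  -- Orthogonality of the `g i` lets the first `n` terms of `N` merge into a single `X⋆X`. Only the
  -- term reusing row `0` stays apart.
  have hXY : star X * X + star Y * Y = 1 := by
    rw [hXX, ← hrN, hN, Fin.sum_univ_castSucc, mul_add, add_mul, Finset.mul_sum, Finset.sum_mul]
    simp only [c, Fin.snoc_castSucc, Fin.snoc_last, id, Y, g, star_mul, hr.star_eq]
    congr 1
    · exact Finset.sum_congr rfl fun i _ => by noncomm_ring
    · noncomm_ring
  -- the new positive elements
  have hκ := continuous_inv_max hε
  -- The square appears because the intertwiners satisfy `(y j i)⋆ (y j i) = (b i)²`. Weighting them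
  -- by `(max s ε)⁻¹` makes the `P i` equivalent.
  let f : ℝ → ℝ := fun s => (max s ε)⁻¹ * (s * s) * (max s ε)⁻¹
  have hf : Continuous f := by fun_prop
  have hf1 : ∀ s, ε ≤ s → f s = 1 := fun s hs => by
    have : s ≠ 0 := (hε.trans_le hs).ne'
    simp only [f, max_eq_left hs]
    field_simp
  let P : Fin n → A := fun i => cfc f (b i)
  have hP0 : ∀ i, 0 ≤ P i := fun i => cfc_nonneg fun s _ => by
    have : 0 < max s ε := lt_max_of_lt_right hε
    have := mul_self_nonneg s
    positivity
  have hP1 : ∀ i, P i ≤ 1 := fun i => cfc_le_one _ _ fun s hs => by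
    have hs0 : 0 ≤ s := spectrum_nonneg_of_nonneg (hb0 i) hs
    have h1 : 0 < max s ε := lt_max_of_lt_right hε
    have h2 : (max s ε)⁻¹ * s ≤ 1 := by
      rw [inv_mul_le_iff₀ h1, mul_one]; exact le_max_left _ _
    have h3 : f s = ((max s ε)⁻¹ * s) * ((max s ε)⁻¹ * s) := by simp only [f]; ring
    rw [h3]
    exact mul_le_one₀ h2 (by positivity) h2
  have hP_orth : ∀ i j, i ≠ j → P i * P j = 0 := fun i j hij =>
    cfc_mul_cfc_eq_zero (hsa i) (hsa j) (horth i j hij) hf hf (by simp [f]) (by simp [f])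
  have hPeq : ∀ i, P i = cfc (fun s => (max s ε)⁻¹) (b i) * (b i * b i) *
      cfc (fun s => (max s ε)⁻¹) (b i) := fun i => by
    simp only [P, f]
    rw [cfc_mul (fun s => (max s ε)⁻¹ * (s * s)) (fun s => (max s ε)⁻¹) (b i) (by fun_prop)
      hκ.continuousOn, cfc_mul (fun s => (max s ε)⁻¹) (fun s => s * s) (b i) hκ.continuousOn,
      cfc_mul (fun s => s) (fun s => s) (b i), cfc_id' ℝ (b i) (hsa i)]
  have hPeq' : ∀ i,
      P i = cfc (fun s => (max s ε)⁻¹ * (max s ε)⁻¹) (b i) * (b i * b i) := fun i => by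
    have : f = fun s => (max s ε)⁻¹ * (max s ε)⁻¹ * (s * s) := by ext s; simp only [f]; ring
    simp only [P]
    rw [this, cfc_mul (fun s => (max s ε)⁻¹ * (max s ε)⁻¹) (fun s => s * s) (b i) (by fun_prop),
      cfc_mul (fun s => s) (fun s => s) (b i), cfc_id' ℝ (b i) (hsa i)]
  have hPg : ∀ i, P i * g i = g i := fun i => by
    simp only [P, g]
    rw [← cfc_mul f (cutoff ε) (b i) hf.continuousOn (continuous_cutoff ε).continuousOn]
    refine cfc_congr fun s _ => ?_
    rcases le_total s ε with hs | hs
    · simp [cutoff_of_le hε hs]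
    · simp [hf1 s hs]
  have hPg0 : ∀ i j, i ≠ j → P i * g j = 0 := fun i j hij =>
    cfc_mul_cfc_eq_zero (hsa i) (hsa j) (horth i j hij) hf (continuous_cutoff ε) (by simp [f])
      (cutoff_of_le hε hε.le)
  have hPX : (1 - ∑ i, P i) * X = 0 := by
    rw [sub_mul, one_mul, sub_eq_zero]
    simp only [X]
    rw [Finset.mul_sum]
    refine Finset.sum_congr rfl fun i _ => ?_
    have hs : (∑ j, P j) * g i = g i := by
      rw [Finset.sum_mul, Finset.sum_eq_single i (fun j _ hj => hPg0 j i hj) (by simp), hPg]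
    rw [← mul_assoc (∑ j, P j), hs]
  have hP : 0 ≤ 1 - ∑ i, P i := one_sub_sum_nonneg hP0 hP1 hP_orth
  set L := CFC.sqrt (1 - ∑ i, P i) with hL
  have hLsa : IsSelfAdjoint L := (CFC.sqrt_nonneg _).isSelfAdjoint
  have hLL : L * L = 1 - ∑ i, P i := CFC.sqrt_mul_sqrt_self _ hP
  have hLX : L * X = 0 := sqrt_mul_eq_zero hP hPX
  -- `P 0` acts as `1` on `g 0`, so `(P 0 - 1/2)₊` acts on it as `1/2`. This is the origin of the
  -- factors `2` and `√2` below.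
  refine ⟨1 / 2, by norm_num, P, hP0, fun i j => ?_, hP_orth, hP, ?_⟩
  · refine ⟨y j i * cfc (fun s => (max s ε)⁻¹) (b i), ?_, ?_⟩
    · rw [star_mul_cfc_self, hy_star, hyy i j i, ← hPeq]
    · have : y j i * star (y j i) = b j * b j := by rw [hy_star, hyy j i j]
      rw [mul_cfc_self_star (hsa i) (hsa j) (hyy j i i).symm hκ, this, ← hPeq']
  · set e := (P 0 - algebraMap ℝ A (1 / 2))⁺ with he
    have heg : g 0 * ((2 : ℝ) • e) * g 0 = g 0 * g 0 := by
      have h1 : e = cfc (fun s => max (f s - 1 / 2) 0) (b 0) := by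
        rw [he, posPart_sub_algebraMap (hP0 0).isSelfAdjoint,
          ← cfc_comp' (fun s => max (s - 1 / 2) 0) f (b 0) (by fun_prop) hf.continuousOn (hsa 0)]
      have h2 : ((2 : ℝ) • e) * g 0 = g 0 := by
        have hm : Continuous fun s => max (f s - 1 / 2) 0 := by fun_prop
        rw [h1, ← cfc_smul (2 : ℝ) _ (b 0) hm.continuousOn,
          ← cfc_mul (fun s => (2 : ℝ) • _) (cutoff ε)
          (b 0) (hm.const_smul (2 : ℝ)).continuousOn (continuous_cutoff ε).continuousOn]
        refine cfc_congr fun s _ => ?_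
        rcases le_total s ε with hs | hs
        · simp [cutoff_of_le hε hs]
        · norm_num [hf1 s hs]
      rw [mul_assoc, h2]
    refine Metric.mem_closure_iff.2 fun δ hδ => ?_
    have hδ' : 0 < δ / (‖L‖ * ‖L‖ + 1) := by positivity
    obtain ⟨u, hu, hux⟩ := hA.exists_unitary_norm_lt X hδ'
    have huu : u * star u = 1 := Unitary.mul_star_self_of_mem hu
    refine ⟨_, ⟨√2 • (Y * star u * L), rfl⟩, ?_⟩
    -- Since `Y⋆ (2e) Y = 1 - X⋆X`, the difference is `L u X⋆X u⋆ L`. Subtracting `L X X⋆ L = 0`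
    -- exposes the commutator-type error that stable rank one makes small.
    have hsub : 1 - ∑ i, P i - star (√2 • (Y * star u * L)) * e * (√2 • (Y * star u * L)) =
        L * (u * (star X * X) * star u - X * star X) * L := by
      have e1 : star Y * ((2 : ℝ) • e) * Y = 1 - star X * X := by
        rw [← hXY, add_sub_cancel_left]
        simp only [Y, star_mul, (hgsa 0).star_eq]
        calc _ = star r * star (ζ (Fin.last n)) * (g 0 * ((2 : ℝ) • e) * g 0) *
              (ζ (Fin.last n) * r) := by noncomm_ring
          _ = _ := by rw [heg]; noncomm_ring
      have e2 : star (√2 • (Y * star u * L)) * e * (√2 • (Y * star u * L)) =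
          L * u * (star Y * ((2 : ℝ) • e) * Y) * star u * L := by
        have e3 : √2 * √2 = 2 := Real.mul_self_sqrt (by norm_num)
        rw [star_smul, star_trivial, smul_mul_assoc, smul_mul_smul_comm, e3, star_mul, star_mul,
          star_star, hLsa.star_eq]
        simp only [mul_smul_comm, smul_mul_assoc, mul_assoc]
      rw [e2, e1, ← hLL]
      calc L * L - L * u * (1 - star X * X) * star u * L
          = L * L - L * (u * star u) * L + L * u * (star X * X) * star u * L := by noncomm_ring
        _ = L * u * (star X * X) * star u * L - L * X * star X * L := by
            rw [huu, hLX]; noncomm_ring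
        _ = _ := by noncomm_ring
    rw [dist_eq_norm, hsub]
    have hle : ‖L * (u * (star X * X) * star u - X * star X) * L‖ ≤
        ‖u * (star X * X) * star u - X * star X‖ * (‖L‖ * ‖L‖) := by
      refine (norm_mul_le _ _).trans ((mul_le_mul_of_nonneg_right (norm_mul_le _ _)
        (norm_nonneg _)).trans (le_of_eq (by ring)))
    refine hle.trans_lt ?_
    rw [lt_div_iff₀ (by positivity)] at hux
    refine lt_of_le_of_lt ?_ hux
    gcongr
    linarith

end DivisibleToPartition

/-! ### Matrix units of the tensor product. -/

section MatrixUnits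

open scoped Kronecker

variable {p q : ℕ}

namespace TensorMat

/-- Matrices as elements of `M_p ⊗ M_q`. -/
def ofMat : Matrix (Fin p × Fin q) (Fin p × Fin q) ℂ →ₗ[ℂ] TensorMat p q where
  toFun m := CStarMatrix.ofMatrix m
  map_add' _ _ := rfl
  map_smul' _ _ := rfl

/-- The matrix coefficients of an element of `M_p ⊗ M_q`. -/
def coeff (x y : Fin p × Fin q) : TensorMat p q →ₗ[ℂ] ℂ where
  toFun m := (show CStarMatrix (Fin p × Fin q) (Fin p × Fin q) ℂ from m) x y
  map_add' _ _ := rfl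
  map_smul' _ _ := rfl

theorem continuous_coeff (x y : Fin p × Fin q) : Continuous (coeff (p := p) (q := q) x y) :=
  (continuous_apply y).comp (continuous_apply x)

/-- The matrix units of `M_p ⊗ M_q`. -/
def unit (x y : Fin p × Fin q) : TensorMat p q := ofMat (Matrix.single x y 1)

theorem unit_mul_unit (x y x' y' : Fin p × Fin q) :
    unit x y * unit x' y' = if y = x' then unit x y' else 0 := by
  have h : unit x y * unit x' y' = ofMat (Matrix.single x y (1 : ℂ) * Matrix.single x' y' 1) := rfl
  rw [h]
  split_ifs with h
  · subst h
    rw [Matrix.single_mul_single_same, mul_one]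
    rfl
  · rw [Matrix.single_mul_single_of_ne (h := h), map_zero]

theorem star_unit (x y : Fin p × Fin q) : star (unit x y) = unit y x := by
  change CStarMatrix.ofMatrix (Matrix.conjTranspose (Matrix.single x y (1 : ℂ))) = _
  rw [Matrix.conjTranspose_single, star_one]
  rfl

theorem sum_smul_unit (m : TensorMat p q) : ∑ x, ∑ y, coeff x y m • unit x y = m := by
  have h : m = ofMat (fun x y => coeff x y m) := rfl
  conv_rhs => rw [h, Matrix.matrix_eq_sum_single (fun x y => coeff x y m)]
  simp only [map_sum]
  refine Finset.sum_congr rfl fun x _ => Finset.sum_congr rfl fun y _ => ?_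
  rw [unit, ← map_smul, Matrix.smul_single, smul_eq_mul, mul_one]

theorem one_eq_sum_unit : (1 : TensorMat p q) = ∑ x, unit x x := by
  have h : (1 : TensorMat p q) = ofMat 1 := rfl
  rw [h, ← Matrix.sum_single_one, map_sum]
  rfl

theorem tmul_single_one (i k : Fin p) :
    tmul (Matrix.single i k 1) (1 : Matrix (Fin q) (Fin q) ℂ) = ∑ j, unit (i, j) (k, j) := by
  have h : tmul (Matrix.single i k 1) (1 : Matrix (Fin q) (Fin q) ℂ) =
      ofMat (Matrix.single i k 1 ⊗ₖ 1) := rfl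
  have h2 : (Matrix.single i k (1 : ℂ) ⊗ₖ (1 : Matrix (Fin q) (Fin q) ℂ)) =
      ∑ j, Matrix.single (i, j) (k, j) 1 := by
    rw [← Matrix.sum_single_one]
    refine (map_sum (AddMonoidHom.mk'
      (fun y : Matrix (Fin q) (Fin q) ℂ => Matrix.single i k (1 : ℂ) ⊗ₖ y)
      (Matrix.kronecker_add _)) _ _).trans (Finset.sum_congr rfl fun j _ => ?_)
    simp [Matrix.single_kronecker_single]
  rw [h, h2, map_sum]
  rfl

theorem tmul_one_single (j l : Fin q) :
    tmul (1 : Matrix (Fin p) (Fin p) ℂ) (Matrix.single j l 1) = ∑ i, unit (i, j) (i, l) := by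
  have h : tmul (1 : Matrix (Fin p) (Fin p) ℂ) (Matrix.single j l 1) =
      ofMat (1 ⊗ₖ Matrix.single j l 1) := rfl
  have h2 : ((1 : Matrix (Fin p) (Fin p) ℂ) ⊗ₖ Matrix.single j l (1 : ℂ)) =
      ∑ i, Matrix.single (i, j) (i, l) 1 := by
    rw [← Matrix.sum_single_one]
    refine (map_sum (AddMonoidHom.mk' (fun x : Matrix (Fin p) (Fin p) ℂ => x ⊗ₖ Matrix.single j l 1)
      fun x y => Matrix.add_kronecker x y _) _ _).trans (Finset.sum_congr rfl fun i _ => ?_)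
    simp [Matrix.single_kronecker_single]
  rw [h, h2, map_sum]
  rfl

end TensorMat

end MatrixUnits

/-! ### A unitary path straightening the dimension-drop algebra. -/

section Flip

variable {n : ℕ}

/-- The flip `(i, j) ↦ (j, i)` on pairs with `j < n`, fixing the pairs `(i, n)`. -/
def flipIndex (x : Fin n × Fin (n + 1)) : Fin n × Fin (n + 1) :=
  Fin.lastCases (motive := fun _ => Fin n × Fin (n + 1)) (x.1, Fin.last n)
    (fun j => (j, x.1.castSucc)) x.2

@[simp]
theorem flipIndex_castSucc (i j : Fin n) : flipIndex (i, j.castSucc) = (j, i.castSucc) := by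
  simp [flipIndex]

@[simp]
theorem flipIndex_last (i : Fin n) : flipIndex (i, Fin.last n) = (i, Fin.last n) := by
  simp [flipIndex]

@[simp]
theorem flipIndex_flipIndex (x : Fin n × Fin (n + 1)) : flipIndex (flipIndex x) = x := by
  obtain ⟨i, j⟩ := x
  induction j using Fin.lastCases <;> simp

theorem flipIndex_eq_iff {x y : Fin n × Fin (n + 1)} : flipIndex x = y ↔ x = flipIndex y :=
  ⟨fun h => by rw [← h, flipIndex_flipIndex], fun h => by rw [h, flipIndex_flipIndex]⟩

open TensorMat

/-- The self-adjoint permutation unitary implementing the flip. -/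
def flipMat (n : ℕ) : TensorMat n (n + 1) := ∑ x, unit (flipIndex x) x

theorem flipMat_mul_unit (x y : Fin n × Fin (n + 1)) :
    flipMat n * unit x y = unit (flipIndex x) y := by
  simp [flipMat, Finset.sum_mul, unit_mul_unit]

theorem star_flipMat : star (flipMat n) = flipMat n := by
  simp only [flipMat, star_sum, star_unit]
  exact Fintype.sum_bijective flipIndex
    (Function.Involutive.bijective flipIndex_flipIndex) _ _ fun x => by simp

theorem unit_mul_flipMat (x y : Fin n × Fin (n + 1)) :
    unit x y * flipMat n = unit x (flipIndex y) := by
  have := congrArg star (flipMat_mul_unit y x)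
  simpa [star_unit, star_flipMat] using this

theorem flipMat_mul_flipMat : flipMat n * flipMat n = 1 := by
  nth_rewrite 2 [flipMat]
  simp only [Finset.mul_sum, flipMat_mul_unit, flipIndex_flipIndex, one_eq_sum_unit]

/-- A path of unitaries from the identity to the flip. -/
def flipPathFun (n : ℕ) (t : unitInterval) : TensorMat n (n + 1) :=
  (1 / 2 : ℂ) • (1 + flipMat n) + (Complex.exp (Real.pi * (t : ℝ) * Complex.I) / 2) •
    (1 - flipMat n)

theorem flipPathFun_zero : flipPathFun n 0 = 1 := by
  simp only [flipPathFun, Set.Icc.coe_zero, Complex.ofReal_zero, mul_zero, zero_mul,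
    Complex.exp_zero]
  module

theorem flipPathFun_one : flipPathFun n 1 = flipMat n := by
  simp only [flipPathFun, Set.Icc.coe_one, Complex.ofReal_one, mul_one, Complex.exp_pi_mul_I]
  module

theorem flipPathFun_mem (t : unitInterval) :
    star (flipPathFun n t) * flipPathFun n t = 1 ∧
      flipPathFun n t * star (flipPathFun n t) = 1 := by
  set c := Complex.exp (Real.pi * (t : ℝ) * Complex.I) with hc
  have hcc : star c * c = 1 := by
    have h1 : ‖c‖ = 1 := by
      rw [hc, ← Complex.ofReal_mul]; exact Complex.norm_exp_ofReal_mul_I _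
    have h2 := Complex.conj_mul' c
    rw [h1] at h2
    simpa using h2
  have hstar : star (flipPathFun n t) =
      (1 / 2 : ℂ) • (1 + flipMat n) + (star c / 2) • (1 - flipMat n) := by
    simp [flipPathFun, star_flipMat, ← hc]
  have h1 : (1 + flipMat n) * (1 + flipMat n) = (2 : ℂ) • (1 + flipMat n) := by
    rw [add_mul, mul_add, mul_add, flipMat_mul_flipMat, one_mul, mul_one, one_mul]; module
  have h2 : (1 + flipMat n) * (1 - flipMat n) = 0 := by
    rw [add_mul, mul_sub, mul_sub, flipMat_mul_flipMat, one_mul, mul_one, one_mul]; module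
  have h3 : (1 - flipMat n) * (1 + flipMat n) = 0 := by
    rw [sub_mul, mul_add, mul_add, flipMat_mul_flipMat, one_mul, mul_one, one_mul]; module
  have h4 : (1 - flipMat n) * (1 - flipMat n) = (2 : ℂ) • (1 - flipMat n) := by
    rw [sub_mul, mul_sub, mul_sub, flipMat_mul_flipMat, one_mul, mul_one, one_mul]; module
  rw [hstar, flipPathFun, ← hc]
  simp only [add_mul, mul_add, smul_mul_smul_comm, h1, h2, h3, h4, smul_zero, add_zero, zero_add,
    smul_smul]
  have e1 : star c / 2 * (c / 2) * 2 = 1 / 2 := by linear_combination (1 / 2) * hcc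
  have e2 : c / 2 * (star c / 2) * 2 = 1 / 2 := by linear_combination (1 / 2) * hcc
  constructor
  · rw [e1]; module
  · rw [e2]; module

/-- The path of unitaries as a unitary of `C([0,1], M_n ⊗ M_{n+1})`. -/
def flipPath (n : ℕ) : unitary C(unitInterval, TensorMat n (n + 1)) :=
  ⟨⟨flipPathFun n, by unfold flipPathFun; fun_prop⟩,
    Unitary.mem_iff.2 ⟨ContinuousMap.ext fun t => (flipPathFun_mem t).1,
      ContinuousMap.ext fun t => (flipPathFun_mem t).2⟩⟩

end Flip

/-! ### Explicit generators inside the dimension-drop algebra: (iv) ⇒ (i). -/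

section GeneratorsOfDimensionDrop

variable {n : ℕ}

open TensorMat

theorem GeneratorRelations.of_injective {A B : Type*} [CStarAlgebra A] [CStarAlgebra B]
    [NeZero n] {v : A} {s : Fin n → A} (φ : A →⋆ₐ[ℂ] B) (hφ : Function.Injective φ)
    (h : GeneratorRelations (φ v) (fun i => φ (s i))) : GeneratorRelations v s where
  star_mul_eq i := hφ (by
    simpa only [map_star, map_mul, map_sub, map_one, map_sum, map_zero] using h.star_mul_eq i)
  orthogonal i j hij := hφ (by
    simpa only [map_star, map_mul, map_sub, map_one, map_sum, map_zero] using h.orthogonal i j hij)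
  star_v_mul := hφ (by
    simpa only [map_star, map_mul, map_sub, map_one, map_sum, map_zero] using h.star_v_mul)
  v_mul_star := hφ (by
    simpa only [map_star, map_mul, map_sub, map_one, map_sum, map_zero] using h.v_mul_star)

/-- The inclusion of the dimension-drop algebra in `C([0,1], M_p ⊗ M_q)`. -/
def dimensionDropIncl (p q : ℕ) : DimensionDrop p q →⋆ₐ[ℂ] C(unitInterval, TensorMat p q) :=
  (dimensionDrop p q).subtype

theorem dimensionDropIncl_injective (p q : ℕ) : Function.Injective (dimensionDropIncl p q) :=
  Subtype.val_injective

/-- The weights of the model generators. -/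
def weight (t : unitInterval) (j : Fin (n + 1)) : ℝ := if j = Fin.last n then √(1 - t) else 1

/-- The model generators `s_i` in trivialized form. -/
def modelS [NeZero n] (i : Fin n) : C(unitInterval, TensorMat n (n + 1)) where
  toFun t := ∑ j, (weight t j : ℂ) • unit (0, j) (i, j)
  continuous_toFun := by
    refine continuous_finsetSum _ fun j _ => Continuous.smul (Complex.continuous_ofReal.comp ?_)
      continuous_const
    unfold weight
    split_ifs <;> fun_prop

/-- The model generator `v` in trivialized form. -/
def modelV (n : ℕ) [NeZero n] : C(unitInterval, TensorMat n (n + 1)) where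
  toFun t := ∑ i : Fin n, (√(t : ℝ) : ℂ) • unit (0, i.castSucc) (i, Fin.last n)
  continuous_toFun := by
    refine continuous_finsetSum _ fun j _ => Continuous.smul (Complex.continuous_ofReal.comp ?_)
      continuous_const
    fun_prop

@[simp]
theorem weight_castSucc (t : unitInterval) (j : Fin n) : weight t j.castSucc = 1 :=
  if_neg (Fin.castSucc_ne_last j)

theorem weight_last_mul (t : unitInterval) :
    weight t (Fin.last n) * weight t (Fin.last n) = 1 - t := by
  simp only [weight, if_true]
  exact Real.mul_self_sqrt (sub_nonneg.2 t.2.2)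

/-- Pointwise, `s_i⋆ s_i = e_ii ⊗ diag(1, …, 1, 1 - t)` and `v⋆ v = t (1 ⊗ e_nn)`, while `v v⋆` is
`t` times the projection onto the pairs `(0, j)` with `j < n`. -/
theorem generatorRelations_model [NeZero n] : GeneratorRelations (modelV n) (modelS (n := n)) := by
  have hs : ∀ (i : Fin n) (t : unitInterval), star (modelS i t) * modelS i t =
      ∑ j, (weight t j * weight t j) • unit (i, j) (i, j) := fun i t => by
    simp [modelS, Finset.sum_mul, Finset.mul_sum, star_unit, unit_mul_unit, smul_smul]
  refine ⟨fun i => ContinuousMap.ext fun t => ?_, fun i j hij => ContinuousMap.ext fun t => ?_,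
    ContinuousMap.ext fun t => ?_, ContinuousMap.ext fun t => ?_⟩
  · change star (modelS 0 t) * modelS 0 t = modelS i t * star (modelS i t)
    rw [hs]
    simp [modelS, Finset.sum_mul, Finset.mul_sum, star_unit, unit_mul_unit, smul_smul]
  · change star (modelS i t) * modelS i t * (star (modelS j t) * modelS j t) = 0
    rw [hs, hs]
    simp [Finset.sum_mul, Finset.mul_sum, unit_mul_unit, hij]
  · rw [ContinuousMap.mul_apply, ContinuousMap.sub_apply, ContinuousMap.sum_apply]
    change star (modelV n t) * modelV n t = 1 - ∑ i, star (modelS i t) * modelS i t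
    simp only [hs]
    rw [one_eq_sum_unit, Fintype.sum_prod_type, ← Finset.sum_sub_distrib]
    simp only [Fin.sum_univ_castSucc, weight_castSucc, weight_last_mul, mul_one, one_smul,
      add_sub_add_left_eq_sub]
    have ht : √(t : ℝ) * √(t : ℝ) = t := Real.mul_self_sqrt t.2.1
    simp [modelV, Finset.sum_mul, Finset.mul_sum, star_unit, unit_mul_unit, smul_smul, ht,
      sub_smul]
  · change modelV n t * star (modelV n t) * (star (modelS 0 t) * modelS 0 t) =
      modelV n t * star (modelV n t)
    rw [hs, Fin.sum_univ_castSucc]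
    simp [modelV, Finset.sum_mul, Finset.mul_sum, mul_add, star_unit, unit_mul_unit,
      Fin.castSucc_ne_last]

/-- A function in trivialized form, with the boundary values of an element of the dimension-drop
algebra. -/
theorem exists_dimensionDrop_eq {f : C(unitInterval, TensorMat n (n + 1))}
    (h0 : ∃ x : Matrix (Fin n) (Fin n) ℂ, tmul x 1 = f 0)
    (h1 : ∃ y : Matrix (Fin (n + 1)) (Fin (n + 1)) ℂ, tmul 1 y = flipMat n * f 1 * flipMat n) :
    ∃ g : DimensionDrop n (n + 1), dimensionDropIncl n (n + 1) g =
      Unitary.conjStarAlgAut ℂ _ (star (flipPath n)) f := by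
  refine ⟨⟨Unitary.conjStarAlgAut ℂ _ (star (flipPath n)) f, ?_, ?_⟩, rfl⟩
  · obtain ⟨x, hx⟩ := h0
    refine ⟨x, ?_⟩
    rw [hx, Unitary.conjStarAlgAut_apply]
    change f 0 = star (flipPathFun n 0) * f 0 * star (star (flipPathFun n 0))
    rw [flipPathFun_zero, star_one, star_one, one_mul, mul_one]
  · obtain ⟨y, hy⟩ := h1
    refine ⟨y, ?_⟩
    rw [hy, Unitary.conjStarAlgAut_apply]
    change _ = star (flipPathFun n 1) * f 1 * star (star (flipPathFun n 1))
    rw [flipPathFun_one, star_flipMat, star_flipMat]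

theorem exists_generatorRelations_dimensionDrop (n : ℕ) [NeZero n] :
    ∃ (v : DimensionDrop n (n + 1)) (s : Fin n → DimensionDrop n (n + 1)),
      GeneratorRelations v s := by
  -- Boundary values: `v` is `0` at `0` and, after the flip, `1 ⊗ e_{0n}` at `1`. Likewise `s_i`
  -- goes from `e_{0i} ⊗ 1` to `1 ⊗ e_{0i}`.
  have hv := exists_dimensionDrop_eq (f := modelV n)
    ⟨0, by
      rw [show tmul (0 : Matrix (Fin n) (Fin n) ℂ) 1 = 0 from map_zero (inl n (n + 1))]
      simp [modelV]⟩
    ⟨Matrix.single (0 : Fin n).castSucc (Fin.last n) 1, by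
      rw [tmul_one_single]
      simp [modelV, Finset.sum_mul, Finset.mul_sum, flipMat_mul_unit, unit_mul_flipMat]⟩
  have hs := fun i : Fin n => exists_dimensionDrop_eq (f := modelS i)
    ⟨Matrix.single 0 i 1, by
      rw [tmul_single_one]
      simp [modelS, weight]⟩
    ⟨Matrix.single (0 : Fin n).castSucc i.castSucc 1, by
      rw [tmul_one_single]
      have h : modelS i 1 = ∑ j : Fin n, unit (0, j.castSucc) (i, j.castSucc) := by
        simp [modelS, Fin.sum_univ_castSucc, weight]
      rw [h]
      simp [Finset.sum_mul, Finset.mul_sum, flipMat_mul_unit, unit_mul_flipMat]⟩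
  obtain ⟨v, hv⟩ := hv
  choose s hs using hs
  refine ⟨v, s, .of_injective (dimensionDropIncl n (n + 1)) (dimensionDropIncl_injective _ _) ?_⟩
  simp only [hv, hs]
  exact generatorRelations_model.map
    ((Unitary.conjStarAlgAut ℂ C(unitInterval, TensorMat n (n + 1)) (star (flipPath n)) :
      _ ≃⋆ₐ[ℂ] _) : C(unitInterval, TensorMat n (n + 1)) →⋆ₐ[ℂ]
        C(unitInterval, TensorMat n (n + 1)))

theorem ReceivesDimensionDrop.almostDivisible {A : Type*} [CStarAlgebra A] [PartialOrder A]
    [StarOrderedRing A] [NeZero n] (h : ReceivesDimensionDrop A n) : AlmostDivisible A n := by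
  obtain ⟨φ⟩ := h
  obtain ⟨v, s, hvs⟩ := exists_generatorRelations_dimensionDrop n
  exact (hvs.map φ).almostDivisible

end GeneratorsOfDimensionDrop

/-! ### Weighted matrix units built from the generators. -/

section LocalUnits

variable {A : Type*} [CStarAlgebra A] {n : ℕ}

/-- Weighted matrix units for a copy of `Z_{n,n+1}` in trivialized form, `T` playing the role of the
coordinate function. The weights of `ω`, `ε`, `φ` are `t (1 - t)`, `1 - t` and `t`. -/
structure LocalUnits (T : A) (ω : Fin n × Fin (n + 1) → Fin n × Fin (n + 1) → A)
    (ε : Fin n → Fin n → A) (φ : Fin (n + 1) → Fin (n + 1) → A) : Prop where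
  star_ω : ∀ x y, star (ω x y) = ω y x
  star_ε : ∀ i k, star (ε i k) = ε k i
  star_φ : ∀ j l, star (φ j l) = φ l j
  commute_ω : ∀ x y, Commute T (ω x y)
  commute_ε : ∀ i k, Commute T (ε i k)
  commute_φ : ∀ j l, Commute T (φ j l)
  ω_mul_ω : ∀ x y z w, ω x y * ω z w = if y = z then T * (1 - T) * ω x w else 0
  ε_mul_ε : ∀ i k l m, ε i k * ε l m = if k = l then (1 - T) * ε i m else 0
  φ_mul_φ : ∀ i k l m, φ i k * φ l m = if k = l then T * φ i m else 0
  T_mul_ε : ∀ i k, T * ε i k = ∑ j, ω (i, j) (k, j)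
  T_mul_φ : ∀ j l, (1 - T) * φ j l = ∑ i, ω (flipIndex (i, j)) (flipIndex (i, l))
  sum_ε : ∑ i, ε i i = 1 - T
  sum_φ : ∑ j, φ j j = T

variable [PartialOrder A] [StarOrderedRing A] [NeZero n]

/-- The formulas are read off from the model. With `E` its matrix units, `R j` is `√t` times the sum
over `i` of `E_{flip(i,j), (i,n)}`, so `∑ R_j R_j⋆` is `t`. Also `s_i⋆ (1 - v v⋆) s_k` is `(1 - t)
e_ik ⊗ 1`. The relations alone imply the same identities in any `A`. -/
theorem GeneratorRelations.exists_localUnits {v : A} {s : Fin n → A}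
    (h : GeneratorRelations v s) : ∃ (T : A) (ω : Fin n × Fin (n + 1) → Fin n × Fin (n + 1) → A)
      (ε : Fin n → Fin n → A) (φ : Fin (n + 1) → Fin (n + 1) → A),
      0 ≤ T ∧ T ≤ 1 ∧ LocalUnits T ω ε φ := by
  classical
  set a := star (s 0) * s 0 with ha
  have hasa : star a = a := by simp [ha]
  set b := ∑ k, star (s k) * s k with hb
  set m := CFC.sqrt (star v * v) with hm
  have hmsa : star m = m := (CFC.sqrt_nonneg _).isSelfAdjoint.star_eq
  have hmm : m * m = star v * v := CFC.sqrt_mul_sqrt_self _ (star_mul_self_nonneg v)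
  have hav : a * v = v := h.mul_v
  have hva : star v * a = star v := by simpa [hasa] using congrArg star hav
  have hss : ∀ i k, s i * star (s k) = if i = k then a else 0 := fun i k => by
    split_ifs with hik
    · rw [← hik, ← h.star_mul_eq]
    · exact h.mul_star_eq_zero hik
  have hvs : ∀ i, star v * v * star (s i) = star (s i) * (1 - a) := fun i => by
    rw [h.star_v_mul, sub_mul, one_mul, h.sum_mul_star, mul_sub, mul_one]
  have hsv : ∀ i, s i * (star v * v) = (1 - a) * s i := fun i => by
    simpa [hasa] using congrArg star (hvs i)
  have hcomm : ∀ i k, m * (star (s i) * s k) = star (s i) * s k * m := fun i k => by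
    have : Commute (star v * v) (star (s i) * s k) := by
      change _ * _ = _ * _
      rw [← mul_assoc, hvs, mul_assoc (star (s i)), mul_assoc (star (s i)), hsv]
    rw [hm, CFC.sqrt_eq_cfc]
    exact (this.cfc_nnreal _).eq
  -- `v⋆v s_i⋆ v = s_i⋆ (1 - a) v = 0`, and then `m = √(v⋆v)` annihilates `s_i⋆ v` too.
  have hsm : ∀ i, star v * s i * m = 0 := fun i => by
    have h1 : star v * v * (star (s i) * v) = 0 := by
      rw [← mul_assoc, hvs, mul_assoc, sub_mul, one_mul, hav, sub_self, mul_zero]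
    have h2 := congrArg star (sqrt_mul_eq_zero (star_mul_self_nonneg v) h1)
    simpa [hmsa, ← hm] using h2
  -- the elements `R`
  let R : Fin (n + 1) → A := Fin.snoc (fun j => star (s j) * v) m
  have hRc : ∀ j : Fin n, R j.castSucc = star (s j) * v := fun j => by simp [R]
  have hRl : R (Fin.last n) = m := by simp [R]
  have hRR : ∀ j l, star (R j) * R l = if j = l then star v * v else 0 := by
    intro j l
    induction j using Fin.lastCases with
    | last =>
      induction l using Fin.lastCases with
      | last => rw [hRl, hmsa, hmm, if_pos rfl]
      | cast l =>
        rw [hRl, hRc, if_neg (Fin.castSucc_ne_last l).symm]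
        have := congrArg star (hsm l)
        simpa [hmsa, mul_assoc] using this
    | cast j =>
      induction l using Fin.lastCases with
      | last => rw [hRl, hRc, if_neg (Fin.castSucc_ne_last j), star_mul, star_star, hsm]
      | cast l =>
        rw [hRc, hRc, star_mul, star_star, mul_assoc, ← mul_assoc (s j), hss]
        by_cases hjl : j = l
        · rw [if_pos hjl, if_pos (by rw [hjl]), hav]
        · rw [if_neg hjl, if_neg (by simpa using hjl), zero_mul, mul_zero]
  set T := ∑ j, R j * star (R j) with hT
  have hTsa : star T = T := by simp [hT]
  have hTeq : T = ∑ i, star (s i) * (v * star v) * s i + star v * v := by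
    rw [hT, Fin.sum_univ_castSucc, hRl, hmsa, hmm]
    congr 1
    refine Finset.sum_congr rfl fun i _ => ?_
    rw [hRc, star_mul, star_star]
    noncomm_ring
  have hTR : ∀ j, T * R j = R j * (star v * v) := fun j => by
    rw [hT, Finset.sum_mul, Finset.sum_eq_single j]
    · rw [mul_assoc, hRR, if_pos rfl]
    · intro l _ hl
      rw [mul_assoc, hRR, if_neg hl, mul_zero]
    · simp
  have hRT : ∀ j, star (R j) * T = (star v * v) * star (R j) := fun j => by
    simpa [hTsa] using congrArg star (hTR j)
  have hTs : ∀ i, T * star (s i) = star (s i) * (1 - a + v * star v) := fun i => by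
    rw [hTeq, add_mul, hvs, Finset.sum_mul, Finset.sum_eq_single i]
    · rw [mul_assoc, hss, if_pos rfl, mul_assoc, mul_assoc v, hva]
      noncomm_ring
    · intro j _ hj
      rw [mul_assoc, hss, if_neg hj, mul_zero]
    · simp
  -- In the model `S x = √(t (1 - t)) E_{x, (0,n)}`: a column of matrix units with a common source,
  -- so the `S x S y⋆` are the interior units.
  let S : Fin n × Fin (n + 1) → A := fun x => R (flipIndex x).2 * star (s (flipIndex x).1)
  have hSS : ∀ x y, star (S x) * S y = if x = y then a * (1 - a) else 0 := by
    intro x y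
    have e1 : star (S x) * S y = s (flipIndex x).1 * (star (R (flipIndex x).2) *
        R (flipIndex y).2) * star (s (flipIndex y).1) := by
      simp only [S, star_mul, star_star]; noncomm_ring
    have e2 : (x = y) ↔
        ((flipIndex x).2 = (flipIndex y).2 ∧ (flipIndex x).1 = (flipIndex y).1) := by
      rw [and_comm, ← Prod.ext_iff]
      exact (Function.Involutive.injective flipIndex_flipIndex).eq_iff.symm
    rw [e1, hRR]
    by_cases h1 : (flipIndex x).2 = (flipIndex y).2
    · rw [if_pos h1, mul_assoc, hvs, ← mul_assoc, hss]
      by_cases h2 : (flipIndex x).1 = (flipIndex y).1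
      · rw [if_pos h2, if_pos (e2.2 ⟨h1, h2⟩)]
      · rw [if_neg h2, if_neg fun h => h2 (e2.1 h).2, zero_mul]
    · rw [if_neg h1, if_neg fun h => h1 (e2.1 h).1, mul_zero, zero_mul]
  have hTS : ∀ x, T * S x = S x * (1 - a) := fun x => by
    simp only [S]
    rw [← mul_assoc, hTR, mul_assoc, hvs, mul_assoc]
  have hST : ∀ x, star (S x) * T = (1 - a) * star (S x) := fun x => by
    simpa [hTsa, hasa] using congrArg star (hTS x)
  let q := 1 - v * star v
  have hq : star q = q := by simp [q]
  have hqa : q * a = a - v * star v := by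
    simp only [q]; rw [sub_mul, one_mul, mul_assoc, hva]
  have haq : a * q = a - v * star v := by
    simp only [q]; rw [mul_sub, mul_one, ← mul_assoc, hav]
  have hTε : ∀ i k, T * (star (s i) * q * s k) =
      star (s i) * (1 - a + v * star v - v * star v * (v * star v)) * s k := fun i k => by
    have : (1 - a + v * star v) * q = 1 - a + v * star v - v * star v * (v * star v) := by
      rw [add_mul, sub_mul, haq]
      simp only [q]
      noncomm_ring
    rw [mul_assoc, ← mul_assoc, hTs, ← this]
    noncomm_ring
  refine ⟨T, fun x y => S x * star (S y), fun i k => star (s i) * q * s k,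
    fun j l => R j * star (R l), Finset.sum_nonneg fun j _ => mul_star_self_nonneg _, ?_,
    ?_, ?_, ?_, ?_, ?_, ?_, ?_, ?_, ?_, ?_, ?_, ?_, ?_⟩
  · have h1 : v * star v ≤ 1 := by
      have h2 : star v * v ≤ 1 := by
        rw [h.star_v_mul, sub_le_self_iff]
        exact Finset.sum_nonneg fun i _ => star_mul_self_nonneg _
      rw [← CStarAlgebra.norm_le_one_iff_of_nonneg _ (mul_star_self_nonneg v),
        CStarRing.norm_self_mul_star, ← CStarRing.norm_star_mul_self]
      exact (CStarAlgebra.norm_le_one_iff_of_nonneg _ (star_mul_self_nonneg v)).2 h2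
    have h3 : 1 - T = ∑ i, star (s i) * q * s i := by
      simp only [q, mul_sub, sub_mul, mul_one, Finset.sum_sub_distrib]
      rw [hTeq, h.star_v_mul]
      simp only [← hb]
      abel
    rw [← sub_nonneg, h3]
    exact Finset.sum_nonneg fun i _ => star_left_conjugate_nonneg (sub_nonneg.2 h1) _
  · intro x y; simp
  · intro i k; simp [hq, mul_assoc]
  · intro j l; simp
  · intro x y
    change _ * _ = _ * _
    rw [← mul_assoc, hTS, mul_assoc (S _), mul_assoc (S _), hST]
  · intro i k
    change _ * _ = _ * _
    have h1 := congrArg star (hTε k i)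
    have h2 : star (star (s k) * q * s i) = star (s i) * q * s k := by simp [hq, mul_assoc]
    rw [star_mul, h2, hTsa] at h1
    rw [h1, hTε]
    simp [hasa, mul_assoc]
  · intro j l
    change _ * _ = _ * _
    rw [← mul_assoc, hTR, mul_assoc (R j), mul_assoc (R j), hRT]
  · intro x y z w
    have e1 : S x * star (S y) * (S z * star (S w)) = S x * (star (S y) * S z) * star (S w) := by
      noncomm_ring
    rw [e1, hSS]
    split_ifs with hyz
    · have e2 : T * (1 - T) * S x = S x * (a * (1 - a)) := by
        have : T * (1 - T) * S x = T * S x - T * (T * S x) := by noncomm_ring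
        rw [this, hTS, ← mul_assoc, hTS]
        noncomm_ring
      rw [← mul_assoc (T * (1 - T)), e2]
    · rw [mul_zero, zero_mul]
  · intro i k l p
    have e1 : star (s i) * q * s k * (star (s l) * q * s p) =
        star (s i) * q * (s k * star (s l)) * q * s p := by noncomm_ring
    rw [e1, hss]
    split_ifs with hkl
    · have e2 : (1 - T) * star (s i) = star (s i) * q * a := by
        rw [mul_assoc, hqa, sub_mul, one_mul, hTs]; noncomm_ring
      rw [← e2]; noncomm_ring
    · simp
  · intro i k l p
    have e1 : R i * star (R k) * (R l * star (R p)) = R i * (star (R k) * R l) * star (R p) := by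
      noncomm_ring
    rw [e1, hRR]
    split_ifs with hkl
    · rw [← mul_assoc T, hTR]
    · simp
  · intro i k
    rw [hTε, Fin.sum_univ_castSucc]
    have e1 : ∀ i j : Fin n, S (i, j.castSucc) = star (s i) * v * star (s j) := fun i j => by
      simp [S, hRc]
    have e2 : ∀ i : Fin n, S (i, Fin.last n) = m * star (s i) := fun i => by simp [S, hRl]
    have e3 : ∑ j : Fin n, S (i, j.castSucc) * star (S (k, j.castSucc)) =
        star (s i) * (v * b * star v) * s k := by
      simp only [e1, hb, Finset.mul_sum, Finset.sum_mul, star_mul, star_star]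
      exact Finset.sum_congr rfl fun j _ => by noncomm_ring
    have e4 : S (i, Fin.last n) * star (S (k, Fin.last n)) = star (s i) * (1 - a) * s k := by
      rw [e2, e2, star_mul, star_star, hmsa]
      have : m * star (s i) * (s k * m) = m * (star (s i) * s k) * m := by noncomm_ring
      rw [this, hcomm, mul_assoc (star (s i) * s k), hmm, mul_assoc (star (s i)), hsv, mul_assoc]
    have e5 : b = 1 - star v * v := by rw [h.star_v_mul]; abel
    rw [e3, e4, e5]
    noncomm_ring
  · intro j l
    simp only [S, flipIndex_flipIndex]
    have e1 : ∀ i, R j * star (s i) * star (R l * star (s i)) =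
        R j * (star (s i) * s i) * star (R l) := fun i => by
      rw [star_mul, star_star]; noncomm_ring
    simp only [e1]
    rw [← Finset.sum_mul, ← Finset.mul_sum, ← hb]
    have e5 : b = 1 - star v * v := by rw [h.star_v_mul]; abel
    rw [e5, sub_mul, one_mul, ← mul_assoc T, hTR]
    noncomm_ring
  · simp only [q, mul_sub, sub_mul, mul_one, Finset.sum_sub_distrib]
    rw [hTeq, h.star_v_mul]
    simp only [← hb]
    abel
  · rfl

end LocalUnits

/-! ### Gluing weighted multiplicative maps. -/

section Gluing

variable {R M Z A : Type*} [CommRing R] [Ring M] [Algebra R M] [Ring Z] [Ring A]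

/-- Three maps that are multiplicative up to weights, over the two ends and over the interior of
the interval, are glued to a multiplicative map. -/
theorem glue_mul {FRA FZM FMA : Type*} [FunLike FRA R A] [RingHomClass FRA R A] [FunLike FZM Z M]
    [MulHomClass FZM Z M] [FunLike FMA M A] [AddMonoidHomClass FMA M A] (θ : FRA) (X Y Λ : FZM)
    (Ψ : FMA) (E F : Z → A) {τ r P Q m : R}
    (hθΨ : ∀ h H, θ h * Ψ H = Ψ (h • H)) (hΨθ : ∀ h H, Ψ H * θ h = Ψ (h • H))
    (hθE : ∀ h f, Commute (θ h) (E f)) (hθF : ∀ h f, Commute (θ h) (F f))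
    (hΨΨ : ∀ H K, Ψ H * Ψ K = Ψ ((τ * (1 - τ)) • (H * K)))
    (hEE : ∀ f g, E f * E g = θ (1 - τ) * E (f * g))
    (hFF : ∀ f g, F f * F g = θ τ * F (f * g))
    (hE : ∀ f, θ τ * E f = Ψ (X f)) (hF : ∀ f, θ (1 - τ) * F f = Ψ (Y f))
    (hP : P * (1 - τ) = 1 - r) (hQ : Q * τ = r) (hPQ : P * Q * (m * (τ * (1 - τ))) = P * Q)
    (hΛ : ∀ f, (m * (τ * (1 - τ))) • (Λ f - (1 - r) • X f - r • Y f) =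
      Λ f - (1 - r) • X f - r • Y f) (f g : Z) :
    (θ P * E f + θ Q * F f + Ψ (m • (Λ f - (1 - r) • X f - r • Y f))) *
        (θ P * E g + θ Q * F g + Ψ (m • (Λ g - (1 - r) • X g - r • Y g))) =
      θ P * E (f * g) + θ Q * F (f * g) +
        Ψ (m • (Λ (f * g) - (1 - r) • X (f * g) - r • Y (f * g))) := by
  set G : Z → M := fun f => Λ f - (1 - r) • X f - r • Y f with hG
  -- For `H` supported where `m` inverts `τ (1 - τ)`, a factor `τ` can be borrowed from `H`. It
  -- turns `E f` into `θ τ * E f = Ψ (X f)`, and the product is then taken inside `Ψ`.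
  have hEΨ : ∀ f H, (m * (τ * (1 - τ))) • H = H → E f * Ψ H = Ψ ((1 - τ) • (X f * H)) := by
    intro f H hH
    have h1 : E f * Ψ H = θ τ * E f * (θ (m * (1 - τ)) * Ψ H) := by
      nth_rewrite 1 [← hH]
      rw [← hθΨ, (hθE τ f).eq, mul_assoc, ← mul_assoc (θ τ), ← map_mul]
      ring_nf
    rw [h1, hE, hθΨ, hΨΨ]
    nth_rewrite 2 [← hH]
    simp only [mul_smul_comm, smul_smul]
    ring_nf
  have hΨE : ∀ f H, (m * (τ * (1 - τ))) • H = H → Ψ H * E f = Ψ ((1 - τ) • (H * X f)) := by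
    intro f H hH
    have h1 : Ψ H * E f = Ψ H * θ (m * (1 - τ)) * (θ τ * E f) := by
      nth_rewrite 1 [← hH]
      rw [← hΨθ, mul_assoc, mul_assoc, ← mul_assoc (θ _) (θ τ), ← map_mul]
      ring_nf
    rw [h1, hE, hΨθ, hΨΨ]
    nth_rewrite 2 [← hH]
    simp only [smul_mul_assoc, smul_smul]
    ring_nf
  have hFΨ : ∀ f H, (m * (τ * (1 - τ))) • H = H → F f * Ψ H = Ψ (τ • (Y f * H)) := by
    intro f H hH
    have h1 : F f * Ψ H = θ (1 - τ) * F f * (θ (m * τ) * Ψ H) := by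
      nth_rewrite 1 [← hH]
      rw [← hθΨ, (hθF (1 - τ) f).eq, mul_assoc, ← mul_assoc (θ (1 - τ)), ← map_mul]
      ring_nf
    rw [h1, hF, hθΨ, hΨΨ]
    nth_rewrite 2 [← hH]
    simp only [mul_smul_comm, smul_smul]
    ring_nf
  have hΨF : ∀ f H, (m * (τ * (1 - τ))) • H = H → Ψ H * F f = Ψ (τ • (H * Y f)) := by
    intro f H hH
    have h1 : Ψ H * F f = Ψ H * θ (m * τ) * (θ (1 - τ) * F f) := by
      nth_rewrite 1 [← hH]
      rw [← hΨθ, mul_assoc, mul_assoc, ← mul_assoc (θ _) (θ (1 - τ)), ← map_mul]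
      ring_nf
    rw [h1, hF, hΨθ, hΨΨ]
    nth_rewrite 2 [← hH]
    simp only [smul_mul_assoc, smul_smul]
    ring_nf
  have hmG : ∀ f, (m * (τ * (1 - τ))) • (m • G f) = m • G f := fun f => by
    rw [smul_comm, hΛ]
  have hr : m * (r * (1 - r)) = P * Q := by
    rw [← hPQ, ← hP]; nth_rewrite 1 [← hQ]; ring
  -- The weight is `P (1 - r) = P - P Q τ`. The correction contains a factor `τ`, so it belongs to
  -- the interior and can be written with `Ψ`.
  have e1 : θ P * E f * (θ P * E g) = θ P * E (f * g) - Ψ ((P * Q) • (X f * X g)) := by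
    have : θ P * E f * (θ P * E g) = θ (P * (P * (1 - τ))) * E (f * g) := by
      rw [← mul_assoc, mul_assoc (θ P) (E f), ← (hθE P f).eq, ← mul_assoc, mul_assoc _ (E f), hEE,
        ← mul_assoc, ← map_mul, ← map_mul]
      ring_nf
    rw [this, hP, show P * (1 - r) = P - P * Q * τ by linear_combination P * hQ, map_sub,
      sub_mul, map_mul θ (P * Q), mul_assoc, hE, hθΨ, map_mul X]
  have e2 : θ Q * F f * (θ Q * F g) = θ Q * F (f * g) - Ψ ((P * Q) • (Y f * Y g)) := by
    have : θ Q * F f * (θ Q * F g) = θ (Q * (Q * τ)) * F (f * g) := by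
      rw [← mul_assoc, mul_assoc (θ Q) (F f), ← (hθF Q f).eq, ← mul_assoc, mul_assoc _ (F f), hFF,
        ← mul_assoc, ← map_mul, ← map_mul]
      ring_nf
    rw [this, hQ, show Q * r = Q - P * Q * (1 - τ) by linear_combination Q * hP, map_sub,
      sub_mul, map_mul θ (P * Q), mul_assoc, hF, hθΨ, map_mul Y]
  have e3 : θ P * E f * (θ Q * F g) = Ψ ((P * Q) • (X f * Y g)) := by
    have : θ P * E f * (θ Q * F g) = θ (P * Q * m) * (θ τ * E f) * (θ (1 - τ) * F g) := by
      rw [← mul_assoc, mul_assoc (θ P) (E f), ← (hθE Q f).eq, ← mul_assoc, ← map_mul]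
      nth_rewrite 1 [← hPQ]
      rw [← mul_assoc (θ _) (θ τ), ← map_mul, ← mul_assoc _ (θ (1 - τ)),
        mul_assoc _ (E f) (θ (1 - τ)),
        ← (hθE (1 - τ) f).eq, ← mul_assoc _ (θ (1 - τ)), ← map_mul]
      ring_nf
    rw [this, hE, hF, hθΨ, hΨΨ, smul_mul_assoc, smul_smul]
    nth_rewrite 2 [← hPQ]
    ring_nf
  have e4 : θ Q * F f * (θ P * E g) = Ψ ((P * Q) • (Y f * X g)) := by
    have : θ Q * F f * (θ P * E g) = θ (P * Q * m) * (θ (1 - τ) * F f) * (θ τ * E g) := by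
      rw [← mul_assoc, mul_assoc (θ Q) (F f), ← (hθF P f).eq, ← mul_assoc, ← map_mul,
        mul_comm Q P]
      nth_rewrite 1 [← hPQ]
      rw [← mul_assoc (θ _) (θ (1 - τ)), ← map_mul, ← mul_assoc _ (θ τ), mul_assoc _ (F f) (θ τ),
        ← (hθF τ f).eq, ← mul_assoc _ (θ τ), ← map_mul]
      ring_nf
    rw [this, hE, hF, hθΨ, hΨΨ, smul_mul_assoc, smul_smul]
    nth_rewrite 2 [← hPQ]
    ring_nf
  have e5 : θ P * E f * Ψ (m • G g) = Ψ (((1 - r) * m) • (X f * G g)) := by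
    rw [mul_assoc, hEΨ f _ (hmG g), hθΨ, smul_smul, hP, mul_smul_comm, smul_smul]
  have e6 : Ψ (m • G f) * (θ P * E g) = Ψ (((1 - r) * m) • (G f * X g)) := by
    rw [(hθE P g).eq, ← mul_assoc, hΨE g _ (hmG f), hΨθ, smul_smul, hP, smul_mul_assoc, smul_smul]
  have e7 : θ Q * F f * Ψ (m • G g) = Ψ ((r * m) • (Y f * G g)) := by
    rw [mul_assoc, hFΨ f _ (hmG g), hθΨ, smul_smul, hQ, mul_smul_comm, smul_smul]
  have e8 : Ψ (m • G f) * (θ Q * F g) = Ψ ((r * m) • (G f * Y g)) := by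
    rw [(hθF Q g).eq, ← mul_assoc, hΨF g _ (hmG f), hΨθ, smul_smul, hQ, smul_mul_assoc, smul_smul]
  have e9 : Ψ (m • G f) * Ψ (m • G g) = Ψ (m • (G f * G g)) := by
    have h : (τ * (1 - τ)) • m • m • (G f * G g) =
        m • (((m * (τ * (1 - τ))) • G f) * G g) := by
      simp only [smul_mul_assoc, smul_smul]
      ring_nf
    rw [hΨΨ, smul_mul_assoc, mul_smul_comm, h, hΛ]
  -- This expands the multiplicativity of `Λ = (1 - r) X + r Y + G`, scaled by `m`, using `P Q = m r
  -- (1 - r)`.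
  have key : m • G (f * g) = -((P * Q) • (X f * X g)) - (P * Q) • (Y f * Y g) +
      (P * Q) • (X f * Y g) + (P * Q) • (Y f * X g) + ((1 - r) * m) • (X f * G g) +
      ((1 - r) * m) • (G f * X g) + (r * m) • (Y f * G g) + (r * m) • (G f * Y g) +
      m • (G f * G g) := by
    simp only [hG, map_mul, ← hr, mul_sub, sub_mul, smul_mul_assoc, mul_smul_comm]
    module
  change (θ P * E f + θ Q * F f + Ψ (m • G f)) * (θ P * E g + θ Q * F g + Ψ (m • G g)) =
    θ P * E (f * g) + θ Q * F (f * g) + Ψ (m • G (f * g))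
  rw [key]
  simp only [add_mul, mul_add, e1, e2, e3, e4, e5, e6, e7, e8, e9]
  simp only [map_add, map_sub, map_neg]
  abel

end Gluing

/-! ### Linear maps defined by weighted matrix units. -/

section UnitSum

variable {R A ι : Type*} [CommRing R] [StarRing R] [Algebra ℂ R] [Ring A] [StarRing A]
  [Algebra ℂ A] [Fintype ι]

/-- The element with coefficients `a` with respect to a system `u` of weighted matrix units. -/
def unitSum (θ : R →⋆ₐ[ℂ] A) (u : ι → ι → A) : Matrix ι ι R →ₗ[ℂ] A where
  toFun a := ∑ x, ∑ y, θ (a x y) * u x y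
  map_add' a b := by simp [add_mul, Finset.sum_add_distrib]
  map_smul' c a := by simp [Finset.smul_sum]

variable {θ : R →⋆ₐ[ℂ] A} {u : ι → ι → A}

theorem unitSum_apply (a : Matrix ι ι R) : unitSum θ u a = ∑ x, ∑ y, θ (a x y) * u x y := rfl

theorem unitSum_one [DecidableEq ι] : unitSum θ u 1 = ∑ x, u x x := by
  simp [unitSum_apply, Matrix.one_apply, apply_ite θ]

theorem mul_unitSum (h : R) (a : Matrix ι ι R) : θ h * unitSum θ u a = unitSum θ u (h • a) := by
  simp [unitSum_apply, Finset.mul_sum, mul_assoc]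

variable (hθ : ∀ h x y, Commute (θ h) (u x y))
include hθ

theorem commute_unitSum (h : R) (a : Matrix ι ι R) : Commute (θ h) (unitSum θ u a) :=
  Commute.sum_right _ _ _ fun x _ => Commute.sum_right _ _ _ fun y _ =>
    ((Commute.all h (a x y)).map θ).mul_right (hθ h x y)

theorem unitSum_mul (h : R) (a : Matrix ι ι R) : unitSum θ u a * θ h = unitSum θ u (h • a) := by
  rw [← (commute_unitSum hθ h a).eq, mul_unitSum]

theorem star_unitSum (hu : ∀ x y, star (u x y) = u y x) (a : Matrix ι ι R) :
    star (unitSum θ u a) = unitSum θ u (star a) := by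
  simp only [unitSum_apply, star_sum, star_mul, hu, ← map_star]
  rw [Finset.sum_comm]
  refine Finset.sum_congr rfl fun x _ => Finset.sum_congr rfl fun y _ => ?_
  rw [← (hθ _ x y).eq]
  rfl

theorem unitSum_mul_unitSum [DecidableEq ι] {w : R}
    (hu : ∀ x y z t, u x y * u z t = if y = z then θ w * u x t else 0) (a b : Matrix ι ι R) :
    unitSum θ u a * unitSum θ u b = θ w * unitSum θ u (a * b) := by
  have h1 : ∀ x y z t, θ (a x y) * u x y * (θ (b z t) * u z t) =
      if y = z then θ (w * (a x y * b z t)) * u x t else 0 := fun x y z t => by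
    rw [mul_assoc, ← mul_assoc (u x y), ← (hθ _ x y).eq, mul_assoc, hu]
    split_ifs with h
    · rw [← mul_assoc, ← mul_assoc, ← map_mul, ← map_mul]
      ring_nf
    · simp
  have h2 : ∀ x y, θ (a x y) * u x y * unitSum θ u b =
      ∑ t, θ (w * (a x y * b y t)) * u x t := fun x y => by
    simp only [unitSum_apply, Finset.mul_sum, h1]
    rw [Finset.sum_comm]
    simp
  nth_rewrite 1 [unitSum_apply]
  simp only [Finset.sum_mul, h2]
  rw [mul_unitSum, unitSum_apply]
  refine Finset.sum_congr rfl fun x _ => ?_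
  rw [Finset.sum_comm]
  refine Finset.sum_congr rfl fun t _ => ?_
  rw [Matrix.smul_apply, Matrix.mul_apply, smul_eq_mul, Finset.mul_sum, map_sum, Finset.sum_mul]

/-- The ⋆-homomorphism version of `glue_mul`. -/
theorem exists_glued [DecidableEq ι] {Z : Type*} [Ring Z] [StarRing Z] [Algebra ℂ Z]
    (X Y Λ : Z →⋆ₐ[ℂ] Matrix ι ι R) (E F : Z →ₗ[ℂ] A) {τ r P Q m : R}
    (hu : ∀ x y z t, u x y * u z t = if y = z then θ (τ * (1 - τ)) * u x t else 0)
    (hθE : ∀ h f, Commute (θ h) (E f)) (hθF : ∀ h f, Commute (θ h) (F f))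
    (hEE : ∀ f g, E f * E g = θ (1 - τ) * E (f * g))
    (hFF : ∀ f g, F f * F g = θ τ * F (f * g))
    (hE : ∀ f, θ τ * E f = unitSum θ u (X f)) (hF : ∀ f, θ (1 - τ) * F f = unitSum θ u (Y f))
    (hE1 : E 1 = θ (1 - τ)) (hF1 : F 1 = θ τ)
    (hEs : ∀ f, star (E f) = E (star f)) (hFs : ∀ f, star (F f) = F (star f))
    (hus : ∀ x y, star (u x y) = u y x)
    (hP : P * (1 - τ) = 1 - r) (hQ : Q * τ = r) (hPQ : P * Q * (m * (τ * (1 - τ))) = P * Q)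
    (hPs : star P = P) (hQs : star Q = Q) (hms : star m = m) (hrs : star r = r)
    (hΛ : ∀ f, (m * (τ * (1 - τ))) • (Λ f - (1 - r) • X f - r • Y f) =
      Λ f - (1 - r) • X f - r • Y f) : Nonempty (Z →⋆ₐ[ℂ] A) := by
  obtain ⟨Φ, hΦ⟩ : ∃ Φ : Z →ₗ[ℂ] A, ∀ f, Φ f = θ P * E f + θ Q * F f +
      unitSum θ u (m • (Λ f - (1 - r) • X f - r • Y f)) :=
    ⟨LinearMap.mulLeft ℂ (θ P) ∘ₗ E + LinearMap.mulLeft ℂ (θ Q) ∘ₗ F +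
      unitSum θ u ∘ₗ (m • (Λ.toAlgHom.toLinearMap - (1 - r) • X.toAlgHom.toLinearMap -
        r • Y.toAlgHom.toLinearMap)), fun _ => rfl⟩
  have hΦ1 : Φ 1 = 1 := by
    have h : m • (Λ 1 - (1 - r) • X 1 - r • Y 1) = 0 := by
      rw [map_one Λ, map_one X, map_one Y]
      module
    rw [hΦ, hE1, hF1, ← map_mul, ← map_mul, hP, hQ, h, map_zero, ← map_add, add_zero,
      sub_add_cancel, map_one]
  have hΦm : ∀ f g, Φ (f * g) = Φ f * Φ g := fun f g => by
    rw [hΦ, hΦ, hΦ]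
    refine (glue_mul θ X Y Λ (unitSum θ u) E F mul_unitSum (unitSum_mul hθ) hθE hθF
      (fun H K => ?_) hEE hFF hE hF hP hQ hPQ hΛ f g).symm
    rw [← mul_unitSum]
    exact unitSum_mul_unitSum hθ hu _ _
  refine ⟨{ AlgHom.ofLinearMap Φ hΦ1 hΦm with map_star' := fun f => ?_ }⟩
  change Φ (star f) = star (Φ f)
  simp only [hΦ, star_add, star_mul, hEs, hFs, star_unitSum hθ hus, ← map_star θ, hPs, hQs,
    (hθE _ _).eq, (hθF _ _).eq, star_smul, star_sub, hms, hrs, star_one, ← map_star X,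
    ← map_star Y, ← map_star Λ]

end UnitSum

open TensorMat

/-! ### End-point evaluations and coefficient matrices. -/

section Ends

variable {p q : ℕ}

theorem coeff_tmul (x : Matrix (Fin p) (Fin p) ℂ) (y : Matrix (Fin q) (Fin q) ℂ) (a b) :
    coeff a b (tmul x y) = x a.1 b.1 * y a.2 b.2 := rfl

/-- Makes the chosen end-point matrix unique, so algebraic laws for it can be checked after
tensoring with `1`. -/
theorem tmul_one_injective [NeZero q] : Function.Injective
    fun x : Matrix (Fin p) (Fin p) ℂ => tmul x (1 : Matrix (Fin q) (Fin q) ℂ) := fun x x' h => by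
  ext i k
  simpa [coeff_tmul] using congrArg (coeff (i, 0) (k, 0)) h

theorem one_tmul_injective [NeZero p] : Function.Injective
    fun y : Matrix (Fin q) (Fin q) ℂ => tmul (1 : Matrix (Fin p) (Fin p) ℂ) y := fun y y' h => by
  ext j l
  simpa [coeff_tmul] using congrArg (coeff (0, j) (0, l)) h

/-- The value at `0` of an element of `Z_{p,q}`, in `M_p`. -/
def leftEnd (f : DimensionDrop p q) : Matrix (Fin p) (Fin p) ℂ := f.2.1.choose

theorem tmul_leftEnd (f : DimensionDrop p q) : tmul (leftEnd f) 1 = dimensionDropIncl p q f 0 :=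
  f.2.1.choose_spec

/-- The value at `1` of an element of `Z_{p,q}`, in `M_q`. -/
def rightEnd (f : DimensionDrop p q) : Matrix (Fin q) (Fin q) ℂ := f.2.2.choose

theorem tmul_rightEnd (f : DimensionDrop p q) : tmul 1 (rightEnd f) = dimensionDropIncl p q f 1 :=
  f.2.2.choose_spec

/-- Evaluation at `0`, as a ⋆-homomorphism. -/
def leftEndHom (p q : ℕ) [NeZero q] : DimensionDrop p q →⋆ₐ[ℂ] Matrix (Fin p) (Fin p) ℂ where
  toFun := leftEnd
  map_one' := tmul_one_injective (q := q) <| by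
    simp only [tmul_leftEnd, map_one, one_tmul_one, ContinuousMap.one_apply]
  map_mul' f g := tmul_one_injective (q := q) <| by
    have := tmul_mul_tmul (leftEnd f) (leftEnd g) (1 : Matrix (Fin q) (Fin q) ℂ) 1
    simp only [mul_one] at this
    simp only [tmul_leftEnd, map_mul, ← this, ContinuousMap.mul_apply]
  map_zero' := tmul_one_injective (q := q) <| by
    simp only [tmul_leftEnd, map_zero]
    exact (map_zero (inl p q)).symm
  map_add' f g := tmul_one_injective (q := q) <| by
    have : tmul (leftEnd f + leftEnd g) (1 : Matrix (Fin q) (Fin q) ℂ) =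
      tmul (leftEnd f) 1 + tmul (leftEnd g) 1 := map_add (inl p q) _ _
    simp only [this, tmul_leftEnd, map_add, ContinuousMap.add_apply]
  commutes' c := tmul_one_injective (q := q) <| by
    have : tmul (algebraMap ℂ _ c) (1 : Matrix (Fin q) (Fin q) ℂ) =
        c • tmul (1 : Matrix (Fin p) (Fin p) ℂ) 1 := by
      rw [Algebra.algebraMap_eq_smul_one]
      exact map_smul (inl p q) c 1
    beta_reduce
    rw [this, one_tmul_one]
    simp only [tmul_leftEnd, Algebra.algebraMap_eq_smul_one, map_smul, map_one,
      ContinuousMap.smul_apply, ContinuousMap.one_apply]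
  map_star' f := tmul_one_injective (q := q) <| by
    have := star_tmul (leftEnd f) (1 : Matrix (Fin q) (Fin q) ℂ)
    rw [star_one] at this
    simp only [tmul_leftEnd, ← this, map_star, ContinuousMap.star_apply]

/-- Evaluation at `1`, as a ⋆-homomorphism. -/
def rightEndHom (p q : ℕ) [NeZero p] : DimensionDrop p q →⋆ₐ[ℂ] Matrix (Fin q) (Fin q) ℂ where
  toFun := rightEnd
  map_one' := one_tmul_injective (p := p) <| by
    simp only [tmul_rightEnd, map_one, one_tmul_one, ContinuousMap.one_apply]
  map_mul' f g := one_tmul_injective (p := p) <| by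
    have := tmul_mul_tmul (1 : Matrix (Fin p) (Fin p) ℂ) 1 (rightEnd f) (rightEnd g)
    simp only [mul_one] at this
    simp only [tmul_rightEnd, map_mul, ← this, ContinuousMap.mul_apply]
  map_zero' := one_tmul_injective (p := p) <| by
    simp only [tmul_rightEnd, map_zero]
    exact (map_zero (inr p q)).symm
  map_add' f g := one_tmul_injective (p := p) <| by
    have : tmul (1 : Matrix (Fin p) (Fin p) ℂ) (rightEnd f + rightEnd g) =
      tmul 1 (rightEnd f) + tmul 1 (rightEnd g) := map_add (inr p q) _ _
    simp only [this, tmul_rightEnd, map_add, ContinuousMap.add_apply]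
  commutes' c := one_tmul_injective (p := p) <| by
    have : tmul (1 : Matrix (Fin p) (Fin p) ℂ) (algebraMap ℂ _ c) =
        c • tmul 1 (1 : Matrix (Fin q) (Fin q) ℂ) := by
      rw [Algebra.algebraMap_eq_smul_one]
      exact map_smul (inr p q) c 1
    beta_reduce
    rw [this, one_tmul_one]
    simp only [tmul_rightEnd, Algebra.algebraMap_eq_smul_one, map_smul, map_one,
      ContinuousMap.smul_apply, ContinuousMap.one_apply]
  map_star' f := one_tmul_injective (p := p) <| by
    have := star_tmul (1 : Matrix (Fin p) (Fin p) ℂ) (rightEnd f)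
    rw [star_one] at this
    simp only [tmul_rightEnd, ← this, map_star, ContinuousMap.star_apply]

/-- The matrix of coefficient functions of a matrix-valued function. -/
def coeffHom (p q : ℕ) : C(unitInterval, TensorMat p q) →⋆ₐ[ℂ]
    Matrix (Fin p × Fin q) (Fin p × Fin q) C(unitInterval, ℂ) where
  toFun f := Matrix.of fun x y =>
    ⟨fun t => coeff x y (f t), (continuous_coeff x y).comp f.continuous⟩
  map_one' := by
    ext x y t
    change (1 : Matrix (Fin p × Fin q) (Fin p × Fin q) ℂ) x y = _
    simp only [Matrix.one_apply]
    split_ifs <;> rfl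
  map_mul' f g := by
    ext x y t
    simp only [Matrix.mul_apply, ContinuousMap.coe_sum, Finset.sum_apply]
    rfl
  map_zero' := rfl
  map_add' f g := rfl
  commutes' c := by
    ext x y t
    change (algebraMap ℂ (Matrix (Fin p × Fin q) (Fin p × Fin q) ℂ) c) x y = _
    simp only [Matrix.algebraMap_matrix_apply]
    split_ifs <;> rfl
  map_star' f := rfl

/-- Matrices over `ℂ` as matrices of constant functions. -/
def constMat (ι : Type*) [Fintype ι] [DecidableEq ι] :
    Matrix ι ι ℂ →⋆ₐ[ℂ] Matrix ι ι C(unitInterval, ℂ) where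
  __ := (Algebra.ofId ℂ C(unitInterval, ℂ)).mapMatrix
  map_star' _ := rfl

end Ends

/-! ### Cut-off functions on the unit interval. -/

section Cutoffs

/-- The coordinate function on the unit interval. -/
def coord : C(unitInterval, ℂ) := ⟨fun t => ((t : ℝ) : ℂ), by fun_prop⟩

/-- A continuous map of the unit interval that is constant near both end points. -/
def ramp : C(unitInterval, unitInterval) :=
  ⟨fun t => Set.projIcc 0 1 zero_le_one (3 * (t : ℝ) - 1), by fun_prop⟩

theorem coe_ramp (t : unitInterval) : (ramp t : ℝ) = max 0 (min 1 (3 * (t : ℝ) - 1)) := rfl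

/-- With `r = coord ∘ ramp`, these are `(1 - r) / (1 - t)`, `r / t` and `1 / (t (1 - t))`, with
denominators bounded below. Since `r` moves only on `(1/3, 2/3)`, the bounds `1/3`, `1/3` and `2/9 =
1/3 · 2/3` are inactive where the identities need exact quotients. -/
theorem exists_cutoffs : ∃ P Q m : C(unitInterval, ℂ), star P = P ∧ star Q = Q ∧ star m = m ∧
    P * (1 - coord) = 1 - coord.comp ramp ∧ Q * coord = coord.comp ramp ∧
    P * Q * (m * (coord * (1 - coord))) = P * Q ∧
    ∀ t, ramp t ≠ 0 → ramp t ≠ 1 → m t * (coord t * (1 - coord t)) = 1 := by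
  have hr0 : ∀ t, ramp t ≠ 0 → 1 / 3 < (t : ℝ) := fun t h => by
    by_contra! h'
    exact h (Subtype.ext (by
      rw [coe_ramp, max_eq_left ((min_le_right _ _).trans (by linarith))]
      rfl))
  have hr1 : ∀ t, ramp t ≠ 1 → (t : ℝ) < 2 / 3 := fun t h => by
    by_contra! h'
    exact h (Subtype.ext (by
      rw [coe_ramp, min_eq_left (by linarith), max_eq_right zero_le_one]
      rfl))
  have hm : ∀ t, ramp t ≠ 0 → ramp t ≠ 1 →
      ((1 / max ((t : ℝ) * (1 - t)) (2 / 9) : ℝ) : ℂ) * (coord t * (1 - coord t)) = 1 := by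
    intro t h0 h1
    have h0 := hr0 t h0
    have h1 := hr1 t h1
    have h2 : 2 / 9 ≤ (t : ℝ) * (1 - t) := by nlinarith
    rw [max_eq_left h2]
    simp only [coord, ContinuousMap.coe_mk]
    norm_cast
    exact one_div_mul_cancel (by linarith)
  have c1 : Continuous fun t : unitInterval => ((1 - ramp t : ℝ) / max (1 - (t : ℝ)) (1 / 3) : ℝ) :=
    (by fun_prop : Continuous fun t : unitInterval => (1 - ramp t : ℝ)).div (by fun_prop)
      fun t => (lt_of_lt_of_le (by norm_num) (le_max_right _ _)).ne'
  have c2 : Continuous fun t : unitInterval => ((ramp t : ℝ) / max (t : ℝ) (1 / 3) : ℝ) :=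
    (by fun_prop : Continuous fun t : unitInterval => (ramp t : ℝ)).div (by fun_prop)
      fun t => (lt_of_lt_of_le (by norm_num) (le_max_right _ _)).ne'
  have c3 : Continuous fun t : unitInterval => (1 / max ((t : ℝ) * (1 - t)) (2 / 9) : ℝ) :=
    continuous_const.div (by fun_prop)
      fun t => (lt_of_lt_of_le (by norm_num) (le_max_right _ _)).ne'
  refine ⟨⟨_, Complex.continuous_ofReal.comp c1⟩, ⟨_, Complex.continuous_ofReal.comp c2⟩,
    ⟨_, Complex.continuous_ofReal.comp c3⟩, ContinuousMap.ext fun t => Complex.conj_ofReal _,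
    ContinuousMap.ext fun t => Complex.conj_ofReal _,
    ContinuousMap.ext fun t => Complex.conj_ofReal _, ContinuousMap.ext fun t => ?_,
    ContinuousMap.ext fun t => ?_, ContinuousMap.ext fun t => ?_, hm⟩
  · simp only [ContinuousMap.mul_apply, ContinuousMap.sub_apply, ContinuousMap.one_apply,
      ContinuousMap.comp_apply, ContinuousMap.coe_mk, coord, Function.comp_apply]
    norm_cast
    by_cases h : ramp t = 1
    · simp [h]
    · have := hr1 t h
      rw [max_eq_left (by linarith)]
      exact div_mul_cancel₀ _ (by linarith)
  · simp only [ContinuousMap.mul_apply,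
      ContinuousMap.comp_apply, ContinuousMap.coe_mk, coord, Function.comp_apply]
    norm_cast
    by_cases h : ramp t = 0
    · simp [h]
    · have := hr0 t h
      rw [max_eq_left (by linarith)]
      exact div_mul_cancel₀ _ (by linarith)
  · simp only [ContinuousMap.mul_apply, ContinuousMap.coe_mk, Function.comp_apply,
      ContinuousMap.sub_apply, ContinuousMap.one_apply]
    by_cases h0 : ramp t = 0
    · simp [h0]
    by_cases h1 : ramp t = 1
    · simp [h1]
    rw [hm t h0 h1, mul_one]

end Cutoffs

/-! ### Functional calculus of a positive contraction over the unit interval. -/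

section FunctionalCalculus

open scoped ComplexOrder

variable {A : Type*} [CStarAlgebra A] [PartialOrder A] [StarOrderedRing A] [Nontrivial A]

/-- The continuous functional calculus of a positive contraction, on functions on `[0,1]`. -/
theorem exists_starAlgHom_coord_eq {T : A} (h0 : 0 ≤ T) (h1 : T ≤ 1) :
    ∃ θ : C(unitInterval, ℂ) →⋆ₐ[ℂ] A, θ coord = T ∧
      ∀ a, Commute T a → ∀ h, Commute (θ h) a := by
  have hsa : IsSelfAdjoint T := h0.isSelfAdjoint
  have hn : IsStarNormal T := hsa.isStarNormal
  have hnorm : ‖T‖ ≤ 1 := (CStarAlgebra.norm_le_one_iff_of_nonneg T h0).2 h1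
  have hmem : ∀ z : spectrum ℂ T, (z : ℂ).re ∈ unitInterval := fun z => by
    refine ⟨?_, (Complex.re_le_norm _).trans ((spectrum.norm_le_norm_of_mem z.2).trans hnorm)⟩
    exact (Complex.nonneg_iff.1 (spectrum_nonneg_of_nonneg h0 z.2)).1
  let g : C(spectrum ℂ T, unitInterval) := ⟨fun z => ⟨(z : ℂ).re, hmem z⟩, by fun_prop⟩
  refine ⟨(cfcHom (R := ℂ) hn).comp (ContinuousMap.compStarAlgHom' ℂ ℂ g), ?_, fun a ha h => ?_⟩
  · have : ContinuousMap.compStarAlgHom' ℂ ℂ g coord =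
        (ContinuousMap.id ℂ).restrict (spectrum ℂ T) := by
      ext z
      exact (hsa.mem_spectrum_eq_re z.2).symm
    rw [StarAlgHom.comp_apply, this]
    exact cfcHom_id hn
  · exact Commute.cfcHom hn ha (by rwa [hsa.star_eq]) _

end FunctionalCalculus

open TensorMat

/-! ### Realizing the dimension-drop algebra from local units. -/

section Realization

variable {n : ℕ}

theorem coeff_flipMat_conj (m : TensorMat n (n + 1)) (x y : Fin n × Fin (n + 1)) :
    coeff x y (flipMat n * m * flipMat n) = coeff (flipIndex x) (flipIndex y) m := by
  have hu : ∀ a b, coeff x y (unit (p := n) (q := n + 1) a b) =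
      if a = x ∧ b = y then 1 else 0 := fun a b => by
    change Matrix.single a b (1 : ℂ) x y = _
    rw [Matrix.single_apply]
  have hu' : ∀ a b, coeff (flipIndex x) (flipIndex y) (unit (p := n) (q := n + 1) a b) =
      if flipIndex a = x ∧ flipIndex b = y then 1 else 0 := fun a b => by
    change Matrix.single a b (1 : ℂ) _ _ = _
    rw [Matrix.single_apply]
    simp only [flipIndex_eq_iff]
  rw [← sum_smul_unit m]
  simp only [Finset.mul_sum, Finset.sum_mul, mul_smul_comm, smul_mul_assoc, flipMat_mul_unit,
    unit_mul_flipMat, map_sum, map_smul, hu, hu']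

/-- The trivialized form of an element of the dimension-drop algebra. -/
def trivialization (n : ℕ) : DimensionDrop n (n + 1) →⋆ₐ[ℂ] C(unitInterval, TensorMat n (n + 1)) :=
  (Unitary.conjStarAlgAut ℂ _ (flipPath n) : _ →⋆ₐ[ℂ] _).comp (dimensionDropIncl n (n + 1))

theorem trivialization_zero (f : DimensionDrop n (n + 1)) :
    trivialization n f 0 = tmul (leftEnd f) 1 := by
  change flipPathFun n 0 * dimensionDropIncl n (n + 1) f 0 * star (flipPathFun n 0) = _
  rw [flipPathFun_zero, star_one, one_mul, mul_one, tmul_leftEnd]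

theorem trivialization_one (f : DimensionDrop n (n + 1)) :
    trivialization n f 1 = flipMat n * tmul 1 (rightEnd f) * flipMat n := by
  change flipPathFun n 1 * dimensionDropIncl n (n + 1) f 1 * star (flipPathFun n 1) = _
  rw [flipPathFun_one, star_flipMat, tmul_rightEnd]

/-- The matrix of coefficients of the trivialized form, along a map of the interval. -/
def coeffAlong (n : ℕ) (g : C(unitInterval, unitInterval)) : DimensionDrop n (n + 1) →⋆ₐ[ℂ]
    Matrix (Fin n × Fin (n + 1)) (Fin n × Fin (n + 1)) C(unitInterval, ℂ) :=
  (coeffHom n (n + 1)).comp ((ContinuousMap.compStarAlgHom' ℂ _ g).comp (trivialization n))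

theorem coeffAlong_apply (g : C(unitInterval, unitInterval)) (f : DimensionDrop n (n + 1)) (x y)
    (t : unitInterval) : coeffAlong n g f x y t = coeff x y (trivialization n f (g t)) := rfl

variable {A : Type*} [CStarAlgebra A] {θ : C(unitInterval, ℂ) →⋆ₐ[ℂ] A} {T : A}
  {ω : Fin n × Fin (n + 1) → Fin n × Fin (n + 1) → A} {ε : Fin n → Fin n → A}
  {φ : Fin (n + 1) → Fin (n + 1) → A}

/-- The value at `0` is `x ⊗ 1`, whose coefficients are diagonal in the second index. This matches
the expansion of `T ε_ik` over the `ω`. -/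
theorem LocalUnits.mul_unitSum_ε (hL : LocalUnits T ω ε φ) (hθ : θ coord = T)
    (f : DimensionDrop n (n + 1)) :
    θ coord * unitSum θ ε (constMat (Fin n) (leftEnd f)) =
      unitSum θ ω (coeffAlong n (ContinuousMap.const _ 0) f) := by
  have h : ∀ i j k l, coeffAlong n (ContinuousMap.const _ 0) f (i, j) (k, l) =
      if j = l then algebraMap ℂ _ (leftEnd f i k) else 0 := fun i j k l => by
    ext t
    rw [coeffAlong_apply, ContinuousMap.const_apply, trivialization_zero, coeff_tmul,
      Matrix.one_apply]
    split_ifs <;> simp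
  have h2 : ∀ i k, θ coord * (θ (constMat (Fin n) (leftEnd f) i k) * ε i k) =
      ∑ j, θ (algebraMap ℂ _ (leftEnd f i k)) * ω (i, j) (k, j) := fun i k => by
    rw [← mul_assoc, ((Commute.all coord _).map θ).eq, mul_assoc, hθ, hL.T_mul_ε, Finset.mul_sum]
    rfl
  simp only [unitSum_apply, Finset.mul_sum, Fintype.sum_prod_type, h, h2, apply_ite θ, map_zero,
    ite_mul, zero_mul, Finset.sum_ite_eq, Finset.mem_univ, if_true]
  exact Finset.sum_congr rfl fun i _ => Finset.sum_comm

theorem LocalUnits.mul_unitSum_φ (hL : LocalUnits T ω ε φ) (hθ : θ coord = T)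
    (f : DimensionDrop n (n + 1)) :
    θ (1 - coord) * unitSum θ φ (constMat (Fin (n + 1)) (rightEnd f)) =
      unitSum θ ω (coeffAlong n (ContinuousMap.const _ 1) f) := by
  have h : ∀ i j k l, coeffAlong n (ContinuousMap.const _ 1) f (flipIndex (i, j))
      (flipIndex (k, l)) = if i = k then algebraMap ℂ _ (rightEnd f j l) else 0 := fun i j k l => by
    ext t
    rw [coeffAlong_apply, ContinuousMap.const_apply, trivialization_one, coeff_flipMat_conj,
      flipIndex_flipIndex, flipIndex_flipIndex, coeff_tmul, Matrix.one_apply]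
    split_ifs <;> simp
  have h2 : ∀ j l, θ (1 - coord) * (θ (constMat (Fin (n + 1)) (rightEnd f) j l) * φ j l) =
      ∑ i, θ (algebraMap ℂ _ (rightEnd f j l)) * ω (flipIndex (i, j)) (flipIndex (i, l)) :=
    fun j l => by
      rw [← mul_assoc, ((Commute.all (1 - coord) _).map θ).eq, mul_assoc, map_sub, map_one, hθ,
        hL.T_mul_φ, Finset.mul_sum]
      rfl
  have hb : Function.Bijective (flipIndex (n := n)) :=
    Function.Involutive.bijective flipIndex_flipIndex
  rw [unitSum_apply (u := ω), ← hb.sum_comp]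
  simp only [← hb.sum_comp fun y => θ (coeffAlong n (ContinuousMap.const _ 1) f _ y) * ω _ y]
  simp only [unitSum_apply, Finset.mul_sum, Fintype.sum_prod_type_right, h, h2, apply_ite θ,
    map_zero, ite_mul, zero_mul, Finset.sum_ite_eq, Finset.mem_univ, if_true]
  exact Finset.sum_congr rfl fun i _ => Finset.sum_comm

variable [NeZero n] [Nontrivial A] [PartialOrder A] [StarOrderedRing A]

/-- Formally `E f = (1 - t) f(0)`, `F f = t f(1)` and `unitSum θ ω H = t (1 - t) H`, so the glued
map is `f ↦ f ∘ ramp` in trivialized form. -/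
theorem LocalUnits.receivesDimensionDrop (hL : LocalUnits T ω ε φ) (h0 : 0 ≤ T) (h1 : T ≤ 1) :
    ReceivesDimensionDrop A n := by
  obtain ⟨θ, hθ, hc⟩ := exists_starAlgHom_coord_eq h0 h1
  obtain ⟨P, Q, m, hPs, hQs, hms, hP, hQ, hPQ, hm⟩ := exists_cutoffs
  have hθω : ∀ h x y, Commute (θ h) (ω x y) := fun h x y => hc _ (hL.commute_ω x y) h
  have hθε : ∀ h i k, Commute (θ h) (ε i k) := fun h i k => hc _ (hL.commute_ε i k) h
  have hθφ : ∀ h j l, Commute (θ h) (φ j l) := fun h j l => hc _ (hL.commute_φ j l) h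
  have hrs : star (coord.comp ramp) = coord.comp ramp :=
    ContinuousMap.ext fun t => Complex.conj_ofReal _
  obtain ⟨E, hE⟩ : ∃ E : DimensionDrop n (n + 1) →ₗ[ℂ] A, ∀ f,
      E f = unitSum θ ε (constMat (Fin n) (leftEndHom n (n + 1) f)) :=
    ⟨unitSum θ ε ∘ₗ ((constMat (Fin n)).comp (leftEndHom n (n + 1))).toAlgHom.toLinearMap,
      fun _ => rfl⟩
  obtain ⟨F, hF⟩ : ∃ F : DimensionDrop n (n + 1) →ₗ[ℂ] A, ∀ f,
      F f = unitSum θ φ (constMat (Fin (n + 1)) (rightEndHom n (n + 1) f)) :=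
    ⟨unitSum θ φ ∘ₗ ((constMat (Fin (n + 1))).comp (rightEndHom n (n + 1))).toAlgHom.toLinearMap,
      fun _ => rfl⟩
  obtain ⟨X, hX⟩ : ∃ X, X = coeffAlong n (ContinuousMap.const _ 0) := ⟨_, rfl⟩
  obtain ⟨Y, hY⟩ : ∃ Y, Y = coeffAlong n (ContinuousMap.const _ 1) := ⟨_, rfl⟩
  obtain ⟨Λ, hΛ⟩ : ∃ Λ, Λ = coeffAlong n ramp := ⟨_, rfl⟩
  -- Where `ramp` is `0` or `1` the function `Λ f` agrees with `X f` or `Y f` and the remainder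
  -- vanishes. Elsewhere `m` inverts `t (1 - t)`.
  have hG : ∀ f, (m * (coord * (1 - coord))) •
      (Λ f - (1 - coord.comp ramp) • X f - coord.comp ramp • Y f) =
        Λ f - (1 - coord.comp ramp) • X f - coord.comp ramp • Y f := fun f => by
    ext x y t
    change m t * (coord t * (1 - coord t)) * (Λ f x y t - (1 - coord (ramp t)) * X f x y t -
        coord (ramp t) * Y f x y t) =
      Λ f x y t - (1 - coord (ramp t)) * X f x y t - coord (ramp t) * Y f x y t
    simp only [hX, hY, hΛ, coeffAlong_apply, ContinuousMap.const_apply]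
    by_cases ht0 : ramp t = 0
    · simp [ht0, coord]
    by_cases ht1 : ramp t = 1
    · simp [ht1, coord]
    rw [hm t ht0 ht1, one_mul]
  have hEX : ∀ f, θ coord * E f = unitSum θ ω (X f) := fun f => by
    rw [hE, hX]
    exact hL.mul_unitSum_ε hθ f
  have hFY : ∀ f, θ (1 - coord) * F f = unitSum θ ω (Y f) := fun f => by
    rw [hF, hY]
    exact hL.mul_unitSum_φ hθ f
  have hE1 : E 1 = θ (1 - coord) := by
    rw [hE, map_one, map_one, unitSum_one, hL.sum_ε, map_sub, map_one, hθ]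
  have hF1 : F 1 = θ coord := by
    rw [hF, map_one, map_one, unitSum_one, hL.sum_φ, hθ]
  have hEc : ∀ h f, Commute (θ h) (E f) := fun h f => by
    rw [hE]
    exact commute_unitSum hθε h _
  have hFc : ∀ h f, Commute (θ h) (F f) := fun h f => by
    rw [hF]
    exact commute_unitSum hθφ h _
  have hEE : ∀ f g, E f * E g = θ (1 - coord) * E (f * g) := fun f g => by
    rw [hE, hE, hE, map_mul, map_mul]
    refine unitSum_mul_unitSum hθε (fun x y z t => ?_) _ _
    rw [hL.ε_mul_ε, map_sub, map_one, hθ]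
  have hFF : ∀ f g, F f * F g = θ coord * F (f * g) := fun f g => by
    rw [hF, hF, hF, map_mul, map_mul]
    refine unitSum_mul_unitSum hθφ (fun x y z t => ?_) _ _
    rw [hL.φ_mul_φ, hθ]
  have hEs : ∀ f, star (E f) = E (star f) := fun f => by
    rw [hE, hE, star_unitSum hθε hL.star_ε, map_star (leftEndHom n (n + 1)),
      map_star (constMat (Fin n))]
  have hFs : ∀ f, star (F f) = F (star f) := fun f => by
    rw [hF, hF, star_unitSum hθφ hL.star_φ, map_star (rightEndHom n (n + 1)),
      map_star (constMat (Fin (n + 1)))]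
  refine exists_glued hθω X Y Λ E F (fun x y z t => ?_) hEc hFc hEE hFF hEX hFY hE1 hF1 hEs hFs
    hL.star_ω hP hQ hPQ hPs hQs hms hrs hG
  rw [hL.ω_mul_ω, map_mul, map_sub, map_one, hθ]

end Realization

end CStarCuntz

end

/-! ### Assembly of the cycle of implications. -/

theorem proposition4p3 {A : Type*} [CStarAlgebra A] [Nontrivial A]
    [PartialOrder A] [StarOrderedRing A] (n : ℕ) [NeZero n] :
    (CStarCuntz.HasStableRankOne A →
      [CStarCuntz.AlmostDivisible A n, CStarCuntz.HasAlmostPartition A n,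
        CStarCuntz.HasGenerators A n, CStarCuntz.ReceivesDimensionDrop A n].TFAE) ∧
    (CStarCuntz.HasAlmostPartition A n → CStarCuntz.HasGenerators A n) ∧
    (CStarCuntz.HasGenerators A n → CStarCuntz.ReceivesDimensionDrop A n) ∧
    (CStarCuntz.ReceivesDimensionDrop A n → CStarCuntz.AlmostDivisible A n) := by
  have h23 : CStarCuntz.HasAlmostPartition A n → CStarCuntz.HasGenerators A n :=
    fun h => h.hasGenerators
  have h34 : CStarCuntz.HasGenerators A n → CStarCuntz.ReceivesDimensionDrop A n := by
    rintro ⟨v, s, _, _, h1, h2, h3, h4⟩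
    obtain ⟨T, ω, ε, φ, hT0, hT1, hL⟩ :=
      (CStarCuntz.GeneratorRelations.mk h1 h2 h3 h4).exists_localUnits
    exact hL.receivesDimensionDrop hT0 hT1
  have h41 : CStarCuntz.ReceivesDimensionDrop A n → CStarCuntz.AlmostDivisible A n :=
    fun h => h.almostDivisible
  refine ⟨fun hA => ?_, h23, h34, h41⟩
  tfae_have 1 → 2 := fun h => h.hasAlmostPartition hA
  tfae_have 2 → 3 := h23
  tfae_have 3 → 4 := h34
  tfae_have 4 → 1 := h41
  tfae_finish
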